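/- Let $\mathbb{M}_2=\mathbb{F}_2[\tau]$ with $\tau$ in bidegree (topological degree, weight) $(0,1)$. Let $A$ be the motivic Steenrod algebra over an algebraically closed field of characteristic zero: the $\mathbb{M}_2$-algebra generated by elements $\mathrm{Sq}^i$, $i\ge 1$, of bidegree $(i,\lfloor i/2\rfloor)$, subject to the motivic Adem relations $$\mathrm{Sq}^a\mathrm{Sq}^b=\sum_{c=0}^{\lfloor a/2\rfloor}\binom{b-1-c}{a-2c}\,\tau^{?}\,\mathrm{Sq}^{a+b-c}\mathrm{Sq}^c\qquad(0<a<2b),$$ where $\mathrm{Sq}^0=1$ and $\tau^?\in\{1,\tau\}$ is the power of $\tau$ that makes the relation homogeneous. Let $A(2)$ be the $\mathbb{M}_2$-subalgebra generated by $\mathrm{Sq}^1,\mathrm{Sq}^2,\mathrm{Sq}^4$, let $I$ be the two-sided ideal of $A(2)$ generated by these three elements, and let $\mathrm{Gr}\,A(2)=\bigoplus_{n\ge 0} I^n/I^{n+1}$. Let $\mathrm{Ext}_{\mathrm{Gr}A(2)}(\mathbb{M}_2,\mathbb{M}_2)$ be the Ext ring, i.e. the cohomology ring of the cobar complex of $\mathrm{Gr}\,A(2)$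 over $\mathbb{M}_2$, where elements of positive filtration act on $\mathbb{M}_2$ by zero. It is graded by $(m,s,a,w)$: $m$ is the May ($I$-adic) filtration, $s$ is the stem (topological degree minus homological degree), $a$ is the homological degree, and $w$ is the weight. Here $\tau$ has degree $(0,0,0,-1)$. Then, as a quadruply graded $\mathbb{M}_2$-algebra, $\mathrm{Ext}_{\mathrm{Gr}A(2)}(\mathbb{M}_2,\mathbb{M}_2)$ is isomorphic to the cohomology of the differential graded $\mathbb{M}_2$-algebra $\mathbb{M}_2[h_{10},h_{11},h_{12},h_{20},h_{21},h_{30}]$ with generators in degrees $$(1,0,1,0),\ (1,1,1,1),\ (1,3,1,2),\ (2,2,1,1),\ (2,5,1,3),\ (3,6,1,3),$$ respectively, and differential $d(h_{1j})=0$, $d(h_{20})=h_{10}h_{11}$, $d(h_{21})=h_{11}h_{12}$, $d(h_{30})=h_{10}h_{21}+h_{20}h_{12}$. Under such an isomorphism, the ring $\mathrm{Ext}_{\mathrm{Gr}A(2)}(\mathbb{M}_2,\mathbb{M}_2)$ is generated over $\mathbb{M}_2$ by the following classes: | generator | degree $(m,s,a,w)$ | description | |---|---|---| | $h_0$ | $(1,0,1,0)$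 | $h_{10}$ | | $h_1$ | $(1,1,1,1)$ | $h_{11}$ | | $h_2$ | $(1,3,1,2)$ | $h_{12}$ | | $b_{20}$ | $(4,4,2,2)$ | $h_{20}^2$ | | $b_{21}$ | $(4,10,2,6)$ | $h_{21}^2$ | | $b_{30}$ | $(6,12,2,6)$ | $h_{30}^2$ | | $h_0(1)$ | $(4,7,2,4)$ | $h_{20}h_{21}+h_{11}h_{30}$ | Moreover, it is the quotient of the commutative polynomial ring over $\mathbb{M}_2$ on these generators by the ideal generated by the relations $$h_0h_1=0,\quad h_1h_2=0,\quad h_2b_{20}=h_0h_0(1),\quad h_2h_0(1)=h_0b_{21},\quad h_0(1)^2=b_{20}b_{21}+h_1^2b_{30}.$$ -/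

import Mathlib

open Polynomial

noncomputable section

namespace MotivicA2

/-! ## The motivic Steenrod algebra and the subalgebra `A(2)` -/

/-- The ring `𝕄₂ = 𝔽₂[τ]`. -/
abbrev M2 : Type := Polynomial (ZMod 2)

/-- The element `τ` of `𝕄₂`. -/
abbrev τ : M2 := Polynomial.X

/-- The symbol `Sq^n` in the free `𝕄₂`-algebra on `Sq^1, Sq^2, …`, where `Sq^0` means `1`. -/
def freeSq (n : ℕ) : FreeAlgebra M2 ℕ+ :=
  if h : 0 < n then FreeAlgebra.ι M2 (n.toPNat h) else 1

/-- The motivic Adem relations. `Sq^n` has weight `⌊n/2⌋`, and the exponent of `τ` is the one that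
balances the weights of the two sides, which is `0` or `1` whenever the binomial coefficient is odd
(truncated subtraction plays a role only in terms whose coefficient vanishes modulo `2`). -/
inductive AdemRel : FreeAlgebra M2 ℕ+ → FreeAlgebra M2 ℕ+ → Prop
  | adem (a b : ℕ) (ha : 0 < a) (hab : a < 2 * b) :
      AdemRel (freeSq a * freeSq b)
        (∑ c ∈ Finset.range (a / 2 + 1),
          ((((b - 1 - c).choose (a - 2 * c) : ℕ) : M2) *
              τ ^ (a / 2 + b / 2 - ((a + b - c) / 2 + c / 2))) •
            (freeSq (a + b - c) * freeSq c))

/-- The motivic Steenrod algebra over an algebraically closed field of characteristic zero. -/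
def Steenrod : Type := RingQuot AdemRel

instance : Ring Steenrod := inferInstanceAs (Ring (RingQuot AdemRel))

instance : Algebra M2 Steenrod := inferInstanceAs (Algebra M2 (RingQuot AdemRel))

/-- The Steenrod square `Sq^n`, with `Sq^0 = 1`. -/
def Sq (n : ℕ) : Steenrod := RingQuot.mkAlgHom M2 AdemRel (freeSq n)

/-- The elements of `A` of topological degree `t` and weight `w`: the additive group generated by
the `τ^j Sq^{i₁} ⋯ Sq^{iᵣ}` of that bidegree, where `Sq^i` has bidegree `(i, ⌊i/2⌋)` and `τ` has
bidegree `(0, 1)`. -/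
def steenrodDeg (t w : ℕ) : AddSubgroup Steenrod :=
  AddSubgroup.closure
    {x | ∃ (j : ℕ) (l : List ℕ), (∀ i ∈ l, 0 < i) ∧ l.sum = t ∧
      j + (l.map fun i => i / 2).sum = w ∧ x = τ ^ j • (l.map Sq).prod}

/-- The subalgebra `A(2)` of `A` generated by `Sq^1`, `Sq^2` and `Sq^4`. -/
def A2 : Subalgebra M2 Steenrod := Algebra.adjoin M2 {Sq 1, Sq 2, Sq 4}

/-- The two-sided ideal `I` of `A(2)` generated by `Sq^1`, `Sq^2` and `Sq^4`. -/
def I2 : Ideal A2 :=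
  (TwoSidedIdeal.span {x : A2 | (x : Steenrod) ∈ ({Sq 1, Sq 2, Sq 4} : Set Steenrod)}).asIdeal

instance : I2.IsTwoSided := inferInstanceAs (TwoSidedIdeal.asIdeal _).IsTwoSided

/-! ## The associated graded algebra of an ideal-adic filtration -/

section AssociatedGraded

variable {R A : Type*} [CommRing R] [Ring A] [Algebra R A] (I : Ideal A)

/-- The quotient `I^n / I^{n+1}`. -/
abbrev GrPiece (n : ℕ) : Type _ :=
  ↥(I ^ n) ⧸ Submodule.comap (I ^ n).subtype (I ^ (n + 1))

theorem grPiece_mk_eq {n : ℕ} {x y : ↥(I ^ n)} :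
    (Submodule.Quotient.mk x : GrPiece I n) = Submodule.Quotient.mk y ↔
      (x : A) - y ∈ I ^ (n + 1) := by
  rw [Submodule.Quotient.eq]; simp

/-- The class in `I^n / I^{n+1}` of an element of `I^n`. -/
def grMk {n : ℕ} (x : A) (hx : x ∈ I ^ n) : GrPiece I n := Submodule.Quotient.mk ⟨x, hx⟩

theorem gr_induction {n : ℕ} {P : GrPiece I n → Prop}
    (h : ∀ (x : A) (hx : x ∈ I ^ n), P (grMk I x hx)) (x : GrPiece I n) : P x := by
  obtain ⟨⟨x, hx⟩, rfl⟩ := Submodule.Quotient.mk_surjective _ x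
  exact h x hx

theorem grMk_sigma {m n : ℕ} {x y : A} {hx : x ∈ I ^ m} {hy : y ∈ I ^ n} (hmn : m = n)
    (hxy : x = y) :
    (GradedMonoid.mk m (grMk I x hx) : GradedMonoid (GrPiece I)) =
      GradedMonoid.mk n (grMk I y hy) := by
  subst hmn; subst hxy; rfl

theorem mem_pow_zero (x : A) : x ∈ I ^ 0 := by
  rw [Submodule.pow_zero, Ideal.one_eq_top]; exact Submodule.mem_top

variable [I.IsTwoSided]

/-- The product `I^m / I^{m+1} × I^n / I^{n+1} → I^{m+n} / I^{m+n+1}`. -/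
def grMul {m n : ℕ} (x : GrPiece I m) (y : GrPiece I n) : GrPiece I (m + n) :=
  Quotient.liftOn₂ x y
    (fun a b => grMk I ((a : A) * b) (by rw [Ideal.IsTwoSided.pow_add]; exact Ideal.mul_mem_mul a.2 b.2))
    (by
      intro a b c d hac hbd
      have h1 : (a : A) - c ∈ I ^ (m + 1) :=
        (grPiece_mk_eq I).1 (Quotient.sound hac)
      have h2 : (b : A) - d ∈ I ^ (n + 1) :=
        (grPiece_mk_eq I).1 (Quotient.sound hbd)
      refine (grPiece_mk_eq I).2 ?_
      have e : (a : A) * b - c * d = (a - c) * b + c * (b - d) := by noncomm_ring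
      rw [e]
      refine add_mem ?_ ?_
      · have := Ideal.mul_mem_mul h1 b.2
        rw [← Ideal.IsTwoSided.pow_add] at this
        convert this using 2; omega
      · have := Ideal.mul_mem_mul c.2 h2
        rw [← Ideal.IsTwoSided.pow_add] at this
        exact this)

theorem grMul_mk {m n : ℕ} (x y : A) (hx : x ∈ I ^ m) (hy : y ∈ I ^ n) :
    grMul I (grMk I x hx) (grMk I y hy) =
      grMk I (x * y) (by rw [Ideal.IsTwoSided.pow_add]; exact Ideal.mul_mem_mul hx hy) := rfl

instance grGMul : GradedMonoid.GMul (GrPiece I) := ⟨fun x y => grMul I x y⟩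

instance grGOne : GradedMonoid.GOne (GrPiece I) := ⟨grMk I 1 (mem_pow_zero I 1)⟩

instance grGMonoid : GradedMonoid.GMonoid (GrPiece I) where
  one_mul := by
    rintro ⟨n, x⟩
    induction x using gr_induction with
    | h x hx => exact grMk_sigma I (zero_add n) (one_mul x)
  mul_one := by
    rintro ⟨n, x⟩
    induction x using gr_induction with
    | h x hx => exact grMk_sigma I (add_zero n) (mul_one x)
  mul_assoc := by
    rintro ⟨m, x⟩ ⟨n, y⟩ ⟨p, z⟩
    induction x using gr_induction with
    | h x hx =>
      induction y using gr_induction with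
      | h y hy =>
        induction z using gr_induction with
        | h z hz => exact grMk_sigma I (add_assoc m n p) (mul_assoc x y z)

instance grGSemiring : DirectSum.GSemiring (GrPiece I) where
  mul_zero := by
    intro m n x
    induction x using gr_induction with
    | h x hx => exact congrArg Submodule.Quotient.mk (Subtype.ext (mul_zero x))
  zero_mul := by
    intro m n x
    induction x using gr_induction with
    | h x hx => exact congrArg Submodule.Quotient.mk (Subtype.ext (zero_mul x))
  mul_add := by
    intro m n x y z
    induction x using gr_induction with
    | h x hx =>
      induction y using gr_induction with
      | h y hy =>
        induction z using gr_induction with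
        | h z hz => exact congrArg Submodule.Quotient.mk (Subtype.ext (mul_add x y z))
  add_mul := by
    intro m n x y z
    induction x using gr_induction with
    | h x hx =>
      induction y using gr_induction with
      | h y hy =>
        induction z using gr_induction with
        | h z hz => exact congrArg Submodule.Quotient.mk (Subtype.ext (add_mul x y z))
  natCast k := grMk I (k : A) (mem_pow_zero I _)
  natCast_zero := congrArg Submodule.Quotient.mk (Subtype.ext Nat.cast_zero)
  natCast_succ k := congrArg Submodule.Quotient.mk (Subtype.ext (Nat.cast_succ k))

instance grGRing : DirectSum.GRing (GrPiece I) where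
  intCast k := grMk I (k : A) (mem_pow_zero I _)
  intCast_ofNat k := congrArg Submodule.Quotient.mk (Subtype.ext (Int.cast_natCast k))
  intCast_negSucc_ofNat k := congrArg Submodule.Quotient.mk (Subtype.ext (Int.cast_negSucc k))

instance grGAlgebra : DirectSum.GAlgebra R (GrPiece I) where
  toFun :=
    { toFun := fun r => grMk I (algebraMap R A r) (mem_pow_zero I _)
      map_zero' := congrArg Submodule.Quotient.mk (Subtype.ext (map_zero _))
      map_add' := fun r s => congrArg Submodule.Quotient.mk (Subtype.ext (map_add _ r s)) }
  map_one := congrArg Submodule.Quotient.mk (Subtype.ext (map_one _))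
  map_mul r s := grMk_sigma I rfl (map_mul _ r s)
  commutes := by
    rintro r ⟨n, x⟩
    induction x using gr_induction with
    | h x hx => exact grMk_sigma I (add_comm 0 n) (Algebra.commutes r x)
  smul_def := by
    rintro r ⟨n, x⟩
    induction x using gr_induction with
    | h x hx =>
      exact grMk_sigma I (hx := (I ^ n).smul_of_tower_mem r hx) (zero_add n).symm
        (Algebra.smul_def r x)

/-- The associated graded algebra `A/I ⊕ I/I² ⊕ I²/I³ ⊕ ⋯`. -/
def Gr : Type _ := DirectSum ℕ (GrPiece I)

instance : Ring (Gr I) := inferInstanceAs (Ring (DirectSum ℕ (GrPiece I)))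

instance : Algebra R (Gr I) := inferInstanceAs (Algebra R (DirectSum ℕ (GrPiece I)))

/-- The inclusion of the summand `I^n / I^{n+1}`. -/
def grOf (n : ℕ) : GrPiece I n →+ Gr I := DirectSum.of (GrPiece I) n

/-- The component in degree `n` of the algebra map `Gr A → K` induced by an algebra map `α : A → K`
that vanishes on `I`: it is `A/I → K` for `n = 0` and zero for `n > 0`. -/
def grAugPiece {K : Type*} [CommRing K] [Algebra R K] (α : A →ₐ[R] K) (hα : ∀ x ∈ I, α x = 0)
    (n : ℕ) : GrPiece I n →ₗ[R] K where
  toFun x := Quotient.liftOn x (fun a => if n = 0 then α (a : A) else 0) (by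
    intro a b hab
    have h : (a : A) - b ∈ I ^ (n + 1) :=
      (grPiece_mk_eq I).1 (Quotient.sound hab)
    by_cases hn : n = 0
    · subst hn
      have := hα _ (by simpa [Submodule.pow_one] using h)
      rw [map_sub, sub_eq_zero] at this
      simpa using this
    · simp [hn])
  map_add' x y := by
    induction x using gr_induction with
    | h x hx =>
      induction y using gr_induction with
      | h y hy =>
        change (if n = 0 then α (x + y) else 0) =
          (if n = 0 then α x else 0) + (if n = 0 then α y else 0)
        split_ifs <;> simp
  map_smul' r x := by
    induction x using gr_induction with
    | h x hx =>
      change (if n = 0 then α (r • x) else 0) = r • (if n = 0 then α x else 0)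
      split_ifs <;> simp

/-- The augmentation `Gr A → A/I → K` induced by an algebra map `α : A → K` vanishing on `I`. -/
def grAug {K : Type*} [CommRing K] [Algebra R K] (α : A →ₐ[R] K) (hα : ∀ x ∈ I, α x = 0) :
    Gr I →ₐ[R] K :=
  DirectSum.toAlgebra R (GrPiece I) (grAugPiece I α hα)
    (by
      change (if 0 = 0 then α 1 else 0) = 1
      simp)
    (by
      intro m n x y
      induction x using gr_induction with
      | h x hx =>
        induction y using gr_induction with
        | h y hy =>
          change (if m + n = 0 then α (x * y) else 0) =
            (if m = 0 then α x else 0) * (if n = 0 then α y else 0)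
          by_cases hm : m = 0 <;> by_cases hn : n = 0 <;> simp [hm, hn])

end AssociatedGraded

/-! ## Cohomology of differential graded algebras -/

section Cohomology

variable {k W : Type*} [CommRing k] [Ring W] [Algebra k W] (C : Subalgebra k W) (d : W →ₗ[k] W)
  (hd : ∀ x y, d (x * y) = d x * y + x * d y)

/-- The algebra of cocycles of `C` for a differential `d` satisfying the Leibniz rule. -/
def cocycles : Subalgebra k W where
  carrier := {x | x ∈ C ∧ d x = 0}
  mul_mem' := by
    rintro x y ⟨hx, hx'⟩ ⟨hy, hy'⟩
    exact ⟨mul_mem hx hy, by rw [hd, hx', hy', zero_mul, mul_zero, add_zero]⟩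
  add_mem' := by
    rintro x y ⟨hx, hx'⟩ ⟨hy, hy'⟩
    exact ⟨add_mem hx hy, by rw [map_add, hx', hy', add_zero]⟩
  algebraMap_mem' r := by
    refine ⟨C.algebraMap_mem r, ?_⟩
    have h : d 1 = 0 := by simpa using hd 1 1
    rw [Algebra.algebraMap_eq_smul_one, map_smul, h, smul_zero]

/-- The ideal of the cocycles of the form `d y` with `y ∈ C`. -/
def coboundaries : Ideal (cocycles C d hd) where
  carrier := {x | ∃ y ∈ C, d y = x}
  zero_mem' := ⟨0, zero_mem C, by simp⟩
  add_mem' := by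
    rintro _ _ ⟨y, hy, h⟩ ⟨z, hz, h'⟩
    exact ⟨y + z, add_mem hy hz, by rw [map_add, h, h']; rfl⟩
  smul_mem' := by
    rintro c _ ⟨y, hy, h⟩
    refine ⟨c * y, mul_mem c.2.1 hy, ?_⟩
    rw [hd, c.2.2, zero_mul, zero_add, h]; rfl

instance : (coboundaries C d hd).IsTwoSided where
  mul_mem_of_left := by
    rintro _ c ⟨y, hy, h⟩
    refine ⟨y * c, mul_mem hy c.2.1, ?_⟩
    rw [hd, c.2.2, mul_zero, add_zero, h]; rfl

/-- The cohomology algebra of `(C, d)`. -/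
abbrev Cohomology : Type _ := cocycles C d hd ⧸ coboundaries C d hd

end Cohomology

/-! ## The cobar complex and `Ext` -/

/-- The functions on the words `[x₁|⋯|xₙ]`, `n ≥ 0`, in the alphabet `X`. -/
structure WordFun (X k : Type*) where
  /-- The underlying function. -/
  toFun : List X → k

namespace WordFun

section Basic

variable {X k : Type*}

instance : FunLike (WordFun X k) (List X) k where
  coe := toFun
  coe_injective := fun f g h => by cases f; cases g; exact congrArg mk h

theorem ext' {f g : WordFun X k} (h : ∀ l, f l = g l) : f = g := DFunLike.ext f g h

/-- The function `l ↦ f (x :: l)`. -/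
def shift (x : X) (f : WordFun X k) : WordFun X k := ⟨fun l => f (x :: l)⟩

theorem shift_apply (x : X) (f : WordFun X k) (l : List X) : shift x f l = f (x :: l) := rfl

end Basic

variable {X k : Type*} [CommRing k]

instance : Zero (WordFun X k) := ⟨⟨fun _ => 0⟩⟩

instance : Add (WordFun X k) := ⟨fun f g => ⟨fun l => f l + g l⟩⟩

instance : Neg (WordFun X k) := ⟨fun f => ⟨fun l => -f l⟩⟩

instance : SMul k (WordFun X k) := ⟨fun r f => ⟨fun l => r * f l⟩⟩

theorem add_apply (f g : WordFun X k) (l : List X) : (f + g) l = f l + g l := rfl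

theorem smul_apply (r : k) (f : WordFun X k) (l : List X) : (r • f) l = r * f l := rfl

theorem zero_apply (l : List X) : (0 : WordFun X k) l = 0 := rfl

instance : AddCommGroup (WordFun X k) where
  add_assoc := by intros; exact ext' fun _ => add_assoc _ _ _
  zero_add := by intros; exact ext' fun _ => zero_add _
  add_zero := by intros; exact ext' fun _ => add_zero _
  add_comm := by intros; exact ext' fun _ => add_comm _ _
  neg_add_cancel := by intros; exact ext' fun _ => neg_add_cancel _
  nsmul := nsmulRec
  zsmul := zsmulRec

instance : Module k (WordFun X k) where
  one_smul := by intros; exact ext' fun _ => one_mul _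
  mul_smul := by intros; exact ext' fun _ => mul_assoc _ _ _
  smul_zero := by intros; exact ext' fun _ => mul_zero _
  smul_add := by intros; exact ext' fun _ => mul_add _ _ _
  add_smul := by intros; exact ext' fun _ => add_mul _ _ _
  zero_smul := by intros; exact ext' fun _ => zero_mul _

/-- The cup product:
`(f * g)[x₁|⋯|xₙ] = ∑ᵢ f[x₁|⋯|xᵢ] g[xᵢ₊₁|⋯|xₙ]`, with `0 ≤ i ≤ n`. -/
instance : Mul (WordFun X k) :=
  ⟨fun f g => ⟨fun l => ∑ i ∈ Finset.range (l.length + 1), f (l.take i) * g (l.drop i)⟩⟩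

theorem mul_apply (f g : WordFun X k) (l : List X) :
    (f * g) l = ∑ i ∈ Finset.range (l.length + 1), f (l.take i) * g (l.drop i) := rfl

instance : One (WordFun X k) :=
  ⟨⟨fun l => match l with
    | [] => 1
    | _ :: _ => 0⟩⟩

theorem one_nil : (1 : WordFun X k) [] = 1 := rfl

theorem one_cons (x : X) (l : List X) : (1 : WordFun X k) (x :: l) = 0 := rfl

theorem mul_nil (f g : WordFun X k) : (f * g) [] = f [] * g [] := by
  simp [mul_apply]

theorem mul_cons (f g : WordFun X k) (x : X) (l : List X) :
    (f * g) (x :: l) = f [] * g (x :: l) + (shift x f * g) l := by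
  rw [mul_apply, List.length_cons, Finset.sum_range_succ', add_comm]
  rfl

theorem shift_add (x : X) (f g : WordFun X k) : shift x (f + g) = shift x f + shift x g := rfl

theorem shift_smul (x : X) (r : k) (f : WordFun X k) : shift x (r • f) = r • shift x f := rfl

theorem shift_one (x : X) : shift x (1 : WordFun X k) = 0 := rfl

theorem shift_mul (x : X) (f g : WordFun X k) :
    shift x (f * g) = f [] • shift x g + shift x f * g := by
  refine ext' fun l => ?_
  exact mul_cons f g x l

theorem add_mul' (f g h : WordFun X k) : (f + g) * h = f * h + g * h := by
  refine ext' fun l => ?_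
  rw [add_apply, mul_apply, mul_apply, mul_apply, ← Finset.sum_add_distrib]
  exact Finset.sum_congr rfl fun i _ => add_mul _ _ _

theorem mul_add' (f g h : WordFun X k) : f * (g + h) = f * g + f * h := by
  refine ext' fun l => ?_
  rw [add_apply, mul_apply, mul_apply, mul_apply, ← Finset.sum_add_distrib]
  exact Finset.sum_congr rfl fun i _ => mul_add _ _ _

theorem smul_mul' (r : k) (f g : WordFun X k) : (r • f) * g = r • (f * g) := by
  refine ext' fun l => ?_
  rw [smul_apply, mul_apply, mul_apply, Finset.mul_sum]
  exact Finset.sum_congr rfl fun i _ => mul_assoc _ _ _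

theorem mul_smul' (r : k) (f g : WordFun X k) : f * (r • g) = r • (f * g) := by
  refine ext' fun l => ?_
  rw [smul_apply, mul_apply, mul_apply, Finset.mul_sum]
  exact Finset.sum_congr rfl fun i _ => mul_left_comm _ _ _

theorem zero_mul' (f : WordFun X k) : 0 * f = 0 := by
  have h := smul_mul' (0 : k) 0 f
  simpa only [zero_smul] using h

theorem mul_zero' (f : WordFun X k) : f * 0 = 0 := by
  have h := mul_smul' (0 : k) f 0
  simpa only [zero_smul] using h

theorem one_mul' (f : WordFun X k) : 1 * f = f := by
  refine ext' fun l => ?_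
  cases l with
  | nil => rw [mul_nil, one_nil, one_mul]
  | cons x l => rw [mul_cons, one_nil, one_mul, shift_one, zero_mul', zero_apply, add_zero]

theorem mul_one' (f : WordFun X k) : f * 1 = f := by
  refine ext' fun l => ?_
  induction l generalizing f with
  | nil => rw [mul_nil, one_nil, mul_one]
  | cons x l ih => rw [mul_cons, one_cons, mul_zero, zero_add, ih]; rfl

theorem mul_assoc' (f g h : WordFun X k) : f * g * h = f * (g * h) := by
  refine ext' fun l => ?_
  induction l generalizing f with
  | nil => simp only [mul_nil, mul_assoc]
  | cons x l ih =>
    rw [mul_cons, mul_cons, mul_cons, shift_mul, add_mul', smul_mul', add_apply, smul_apply, ih,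
      mul_nil]
    ring

instance : Ring (WordFun X k) :=
  { (inferInstance : AddCommGroup (WordFun X k)), (inferInstance : Mul (WordFun X k)),
    (inferInstance : One (WordFun X k)) with
    left_distrib := mul_add'
    right_distrib := add_mul'
    zero_mul := zero_mul'
    mul_zero := mul_zero'
    mul_assoc := mul_assoc'
    one_mul := one_mul'
    mul_one := mul_one' }

instance : Algebra k (WordFun X k) :=
  Algebra.ofModule smul_mul' (fun r f g => mul_smul' r f g)

/-- The list of all words obtained from a word `[x₁|⋯|xₙ]` by multiplying two consecutive letters,
that is, the words `[x₁|⋯|xᵢxᵢ₊₁|⋯|xₙ]` for `1 ≤ i < n`. -/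
def contractions (μ : X → X → X) : List X → List (List X)
  | [] => []
  | [_] => []
  | x :: y :: l => (μ x y :: l) :: (contractions μ (y :: l)).map (List.cons x)

/-- The differential of the cobar complex:
`(d f)[x₁|⋯|xₙ] = ∑ᵢ f[x₁|⋯|xᵢxᵢ₊₁|⋯|xₙ]`. It is used in characteristic two only, and so the signs
are omitted. -/
def diff (μ : X → X → X) : WordFun X k →ₗ[k] WordFun X k where
  toFun f := ⟨fun l => ((contractions μ l).map f).sum⟩
  map_add' _ _ := ext' fun _ => List.sum_map_add
  map_smul' r f := ext' fun l => List.sum_map_mul_left (contractions μ l) f r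

theorem diff_apply (μ : X → X → X) (f : WordFun X k) (l : List X) :
    diff μ f l = ((contractions μ l).map f).sum := rfl

theorem diff_nil (μ : X → X → X) (f : WordFun X k) : diff μ f [] = 0 := rfl

theorem diff_single (μ : X → X → X) (f : WordFun X k) (x : X) : diff μ f [x] = 0 := rfl

theorem diff_cons_cons (μ : X → X → X) (f : WordFun X k) (x y : X) (l : List X) :
    diff μ f (x :: y :: l) = f (μ x y :: l) + diff μ (shift x f) (y :: l) := by
  rw [diff_apply, contractions, List.map_cons, List.sum_cons, List.map_map]
  rfl

/-- The Leibniz rule. -/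
theorem diff_mul (μ : X → X → X) (f g : WordFun X k) :
    diff μ (f * g) = diff μ f * g + f * diff μ g := by
  refine ext' fun l => ?_
  induction l generalizing f with
  | nil => simp only [add_apply, mul_nil, diff_nil, mul_zero, zero_mul, add_zero]
  | cons x l ih =>
    cases l with
    | nil =>
      simp only [add_apply, mul_cons, mul_nil, diff_nil, diff_single, shift_apply, mul_zero, zero_mul,
        add_zero]
    | cons y l =>
      have e : shift y (shift x (diff μ f)) =
          shift (μ x y) f + shift y (diff μ (shift x f)) :=
        ext' fun l => diff_cons_cons μ f x y l
      have e1 : shift x (diff μ f) [] = 0 := diff_single μ f x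
      have e2 : diff μ (shift x f) [] = 0 := diff_nil μ _
      rw [diff_cons_cons, shift_mul, map_add, map_smul, add_apply, smul_apply, ih, add_apply,
        add_apply, mul_cons f g, mul_cons (diff μ f), mul_cons (shift x (diff μ f)), e, add_mul',
        add_apply, mul_cons (diff μ (shift x f)), mul_cons f (diff μ g), diff_cons_cons μ g, e1, e2,
        diff_nil]
      ring

end WordFun

section Ext

variable {k B : Type*} [CommRing k] [Ring B] [Algebra k B] (ε : B →ₐ[k] k)

/-- The augmentation ideal of an augmented algebra. -/
abbrev AugIdeal : Type _ := ↥(RingHom.ker ε)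

/-- The product of two elements of the augmentation ideal. -/
def augMul (x y : AugIdeal ε) : AugIdeal ε :=
  ⟨(x : B) * y, Ideal.mul_mem_left _ _ y.2⟩

/-- The algebra of the normalized cobar complex
`⨁ₙ Hom_k(B̄ ⊗ₖ ⋯ ⊗ₖ B̄, k)` (`n` tensor factors, `B̄` the augmentation ideal): functions on the
words in `B̄` that are `k`-linear in each letter and vanish on all words of large length. -/
def cobar : Subalgebra k (WordFun (AugIdeal ε) k) where
  carrier := {f |
    (∀ l₁ l₂ x y, f (l₁ ++ (x + y) :: l₂) = f (l₁ ++ x :: l₂) + f (l₁ ++ y :: l₂)) ∧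
    (∀ l₁ l₂ (r : k) x, f (l₁ ++ (r • x) :: l₂) = r * f (l₁ ++ x :: l₂)) ∧
    ∃ N : ℕ, ∀ l : List (AugIdeal ε), N < l.length → f l = 0}
  mul_mem' := by
    rintro f g ⟨fa, fs, N, fN⟩ ⟨ga, gs, M, gM⟩
    refine ⟨?_, ?_, N + M, ?_⟩
    · clear fN fs
      intro l₁
      induction l₁ generalizing f with
      | nil =>
        intro l₂ x y
        have h := ga [] l₂ x y
        have e : WordFun.shift (x + y) f = WordFun.shift x f + WordFun.shift y f :=
          WordFun.ext' fun l => fa [] l x y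
        simp only [List.nil_append] at h ⊢
        rw [WordFun.mul_cons, WordFun.mul_cons, WordFun.mul_cons, h, e, WordFun.add_mul',
          WordFun.add_apply]
        ring
      | cons z l₁ ih =>
        intro l₂ x y
        have h := ga (z :: l₁) l₂ x y
        have h' := ih (f := WordFun.shift z f) (fun l₁ l₂ x y => fa (z :: l₁) l₂ x y) l₂ x y
        simp only [List.cons_append] at h ⊢
        rw [WordFun.mul_cons, WordFun.mul_cons, WordFun.mul_cons, h, h']
        ring
    · clear fN fa
      intro l₁
      induction l₁ generalizing f with
      | nil =>
        intro l₂ r x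
        have h := gs [] l₂ r x
        have e : WordFun.shift (r • x) f = r • WordFun.shift x f :=
          WordFun.ext' fun l => fs [] l r x
        simp only [List.nil_append] at h ⊢
        rw [WordFun.mul_cons, WordFun.mul_cons, h, e, WordFun.smul_mul', WordFun.smul_apply]
        ring
      | cons z l₁ ih =>
        intro l₂ r x
        have h := gs (z :: l₁) l₂ r x
        have h' := ih (f := WordFun.shift z f) (fun l₁ l₂ r x => fs (z :: l₁) l₂ r x) l₂ r x
        simp only [List.cons_append] at h ⊢
        rw [WordFun.mul_cons, WordFun.mul_cons, h, h']
        ring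
    · intro l hl
      rw [WordFun.mul_apply]
      refine Finset.sum_eq_zero fun i hi => ?_
      have hi' := Finset.mem_range.1 hi
      by_cases hN : N < i
      · rw [fN _ (by rw [List.length_take]; omega), zero_mul]
      · rw [gM _ (by rw [List.length_drop]; omega), mul_zero]
  add_mem' := by
    rintro f g ⟨fa, fs, N, fN⟩ ⟨ga, gs, M, gM⟩
    refine ⟨fun l₁ l₂ x y => ?_, fun l₁ l₂ r x => ?_, max N M, fun l hl => ?_⟩
    · simp only [WordFun.add_apply, fa, ga]; ring
    · simp only [WordFun.add_apply, fs, gs]; ring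
    · rw [WordFun.add_apply, fN l (by omega), gM l (by omega), add_zero]
  algebraMap_mem' r := by
    have key : ∀ l : List (AugIdeal ε), l ≠ [] →
        (algebraMap k (WordFun (AugIdeal ε) k) r) l = 0 := by
      intro l hl
      rw [Algebra.algebraMap_eq_smul_one, WordFun.smul_apply]
      cases l with
      | nil => exact absurd rfl hl
      | cons x l => rw [WordFun.one_cons, mul_zero]
    refine ⟨fun l₁ l₂ x y => ?_, fun l₁ l₂ r x => ?_, 0, fun l hl => key l ?_⟩
    · rw [key _ (by simp), key _ (by simp), key _ (by simp), add_zero]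
    · rw [key _ (by simp), key _ (by simp), mul_zero]
    · rintro rfl
      simp at hl

/-- The algebra `Ext_B(k, k)` of an augmented algebra `B` that is projective as a module over the
ring `k` of characteristic two: the cohomology of the cobar complex, which is `Hom_B(-, k)` of the
normalized bar resolution of `k`. (The `𝕄₂`-algebra `Gr A(2)`, to which this is applied, is free of
rank `64` over `𝕄₂`.) -/
abbrev Ext : Type _ :=
  Cohomology (cobar ε) (WordFun.diff (augMul ε)) (WordFun.diff_mul (augMul ε))

end Ext

/-! ## The algebra `Gr A(2)`, its augmentation and its grading -/

/-- The augmentation `A → 𝕄₂`, sending `Sq^i` to `0` for `i > 0`; it defines the `A`-module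
structure on `𝕄₂`. -/
def steenrodAug : Steenrod →ₐ[M2] M2 :=
  RingQuot.liftAlgHom M2 ⟨FreeAlgebra.lift M2 fun _ : ℕ+ => (0 : M2), by
    have key : ∀ n : ℕ, 0 < n →
        FreeAlgebra.lift M2 (fun _ : ℕ+ => (0 : M2)) (freeSq n) = 0 := by
      intro n hn
      rw [freeSq, dif_pos hn, FreeAlgebra.lift_ι_apply]
    rintro _ _ ⟨a, b, ha, hab⟩
    rw [map_mul, key a ha, zero_mul, map_sum]
    refine (Finset.sum_eq_zero fun c hc => ?_).symm
    have hc' := Finset.mem_range.1 hc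
    rw [map_smul, map_mul, key (a + b - c) (by omega), zero_mul, smul_zero]⟩

theorem steenrodAug_Sq {n : ℕ} (hn : 0 < n) : steenrodAug (Sq n) = 0 := by
  refine (RingQuot.liftAlgHom_mkAlgHom_apply M2 _ _ (freeSq n)).trans ?_
  rw [freeSq, dif_pos hn, FreeAlgebra.lift_ι_apply]

/-- The augmentation of `A(2)`. -/
def a2Aug : A2 →ₐ[M2] M2 := steenrodAug.comp A2.val

theorem a2Aug_I2 : ∀ x ∈ I2, a2Aug x = 0 := by
  intro x hx
  have h : TwoSidedIdeal.span
      {x : A2 | (x : Steenrod) ∈ ({Sq 1, Sq 2, Sq 4} : Set Steenrod)} ≤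
        TwoSidedIdeal.ker a2Aug := by
    rw [TwoSidedIdeal.span_le]
    rintro y hy
    rw [SetLike.mem_coe, TwoSidedIdeal.mem_ker]
    change steenrodAug (y : Steenrod) = 0
    rcases hy with hy | hy | hy <;> rw [hy] <;> exact steenrodAug_Sq (by norm_num)
  have := h (TwoSidedIdeal.mem_asIdeal.1 hx)
  rwa [TwoSidedIdeal.mem_ker] at this

/-- The associated graded algebra `Gr A(2)` of the `I`-adic filtration. -/
abbrev GrA2 : Type := Gr I2

/-- The augmentation `Gr A(2) → A(2)/I = 𝕄₂`; it defines the `Gr A(2)`-module structure on `𝕄₂`. -/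
def grA2Aug : GrA2 →ₐ[M2] M2 := grAug I2 a2Aug a2Aug_I2

/-- `b ∈ Gr A(2)` is homogeneous of May filtration `m`, topological degree `t` and weight `w`. -/
def GrA2Homogeneous (m t w : ℕ) (b : GrA2) : Prop :=
  ∃ (x : A2) (hx : x ∈ I2 ^ m), (x : Steenrod) ∈ steenrodDeg t w ∧
    b = grOf I2 m (grMk I2 x hx)

/-- `p ∈ 𝕄₂` is homogeneous of tridegree `(m, t, w)`, where `τ` has tridegree `(0, 0, 1)`. -/
def M2Homogeneous (m t w : ℤ) (p : M2) : Prop :=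
  ∀ n : ℕ, p.coeff n ≠ 0 → m = 0 ∧ t = 0 ∧ w = n

/-- `Ext_{Gr A(2)}(𝕄₂, 𝕄₂)`. -/
abbrev ExtGrA2 : Type := Ext grA2Aug

/-- A cochain of the cobar complex of `Gr A(2)` is homogeneous of degree `(m, s, a, w)` (May
filtration, stem, Adams filtration, weight) if it is supported on the words of length `a` and lowers
tridegrees by `(m, s + a, w)`. In particular, `τ` has degree `(0, 0, 0, -1)`. -/
def CochainHomogeneous (q : ℤ × ℤ × ℤ × ℤ) (f : WordFun (AugIdeal grA2Aug) M2) : Prop :=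
  (∀ l, (l.length : ℤ) ≠ q.2.2.1 → f l = 0) ∧
  ∀ (l : List (AugIdeal grA2Aug)) (δ : List (ℕ × ℕ × ℕ)),
    List.Forall₂ (fun b e => GrA2Homogeneous e.1 e.2.1 e.2.2 (b : GrA2)) l δ →
      M2Homogeneous (((δ.map fun e => e.1).sum : ℕ) - q.1)
        (((δ.map fun e => e.2.1).sum : ℕ) - (q.2.1 + q.2.2.1))
        (((δ.map fun e => e.2.2).sum : ℕ) - q.2.2.2) (f l)

/-- A class in `Ext_{Gr A(2)}(𝕄₂, 𝕄₂)` is homogeneous of degree `(m, s, a, w)` if it is represented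
by a cocycle that is homogeneous of this degree. -/
def ExtHomogeneous (q : ℤ × ℤ × ℤ × ℤ) (x : ExtGrA2) : Prop :=
  ∃ z : cocycles (cobar grA2Aug) (WordFun.diff (augMul grA2Aug)) (WordFun.diff_mul _),
    CochainHomogeneous q z ∧ Ideal.Quotient.mk _ z = x

/-! ## The differential graded algebra `𝕄₂[h₁₀, h₁₁, h₁₂, h₂₀, h₂₁, h₃₀]` -/

/-- The names of the generators `h_{ij}`. -/
inductive HIndex
  | h10 | h11 | h12 | h20 | h21 | h30

/-- The polynomial ring `𝕄₂[h₁₀, h₁₁, h₁₂, h₂₀, h₂₁, h₃₀]`. -/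
abbrev HPoly : Type := MvPolynomial HIndex M2

/-- The variable `h_{ij}`. -/
abbrev hvar (i : HIndex) : HPoly := MvPolynomial.X i

/-- The differential: `d h₂₀ = h₁₀ h₁₁`, `d h₂₁ = h₁₁ h₁₂`, `d h₃₀ = h₁₀ h₂₁ + h₂₀ h₁₂`, and
`d h₁ⱼ = 0`. -/
def hDiff : Derivation M2 HPoly HPoly :=
  MvPolynomial.mkDerivation M2 fun i => match i with
    | .h10 => 0
    | .h11 => 0
    | .h12 => 0
    | .h20 => hvar .h10 * hvar .h11
    | .h21 => hvar .h11 * hvar .h12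
    | .h30 => hvar .h10 * hvar .h21 + hvar .h20 * hvar .h12

/-- The degrees `(m, s, a, w)` of the `h_{ij}`. -/
def hDegree : HIndex → ℤ × ℤ × ℤ × ℤ
  | .h10 => (1, 0, 1, 0)
  | .h11 => (1, 1, 1, 1)
  | .h12 => (1, 3, 1, 2)
  | .h20 => (2, 2, 1, 1)
  | .h21 => (2, 5, 1, 3)
  | .h30 => (3, 6, 1, 3)

/-- `p` is homogeneous of degree `q`, where `τ` has degree `(0, 0, 0, -1)`. -/
def HPolyHomogeneous (q : ℤ × ℤ × ℤ × ℤ) (p : HPoly) : Prop :=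
  ∀ (e : HIndex →₀ ℕ) (n : ℕ), (p.coeff e).coeff n ≠ 0 →
    (e.sum fun i r => r • hDegree i) + n • ((0, 0, 0, -1) : ℤ × ℤ × ℤ × ℤ) = q

theorem hDiff_mul (x y : HPoly) :
    (hDiff : HPoly →ₗ[M2] HPoly) (x * y) =
      (hDiff : HPoly →ₗ[M2] HPoly) x * y + x * (hDiff : HPoly →ₗ[M2] HPoly) y := by
  change hDiff (x * y) = hDiff x * y + x * hDiff y
  rw [Derivation.leibniz, smul_eq_mul, smul_eq_mul]
  ring

/-- The cocycles of the differential graded algebra `𝕄₂[h₁₀, h₁₁, h₁₂, h₂₀, h₂₁, h₃₀]`. -/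
abbrev HCocycles : Subalgebra M2 HPoly :=
  cocycles ⊤ (hDiff : HPoly →ₗ[M2] HPoly) hDiff_mul

/-- The cohomology of the differential graded algebra `𝕄₂[h₁₀, h₁₁, h₁₂, h₂₀, h₂₁, h₃₀]`. -/
abbrev HCohomology : Type :=
  Cohomology ⊤ (hDiff : HPoly →ₗ[M2] HPoly) hDiff_mul

/-- A class in the cohomology is homogeneous of degree `q` if it is represented by a cocycle that is
homogeneous of this degree. -/
def HCohomologyHomogeneous (q : ℤ × ℤ × ℤ × ℤ) (x : HCohomology) : Prop :=
  ∃ z : HCocycles, HPolyHomogeneous q z ∧ Ideal.Quotient.mk _ z = x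

/-! ## The generators and relations of `Ext_{Gr A(2)}(𝕄₂, 𝕄₂)` -/

/-- The names of the generators; `h01` stands for `h₀(1)`. -/
inductive Gen
  | h0 | h1 | h2 | b20 | b21 | b30 | h01

/-- The degrees `(m, s, a, w)` of the generators. -/
def genDegree : Gen → ℤ × ℤ × ℤ × ℤ
  | .h0 => (1, 0, 1, 0)
  | .h1 => (1, 1, 1, 1)
  | .h2 => (1, 3, 1, 2)
  | .b20 => (4, 4, 2, 2)
  | .b21 => (4, 10, 2, 6)
  | .b30 => (6, 12, 2, 6)
  | .h01 => (4, 7, 2, 4)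

/-- The descriptions of the generators in terms of the `h_{ij}`. -/
def genPoly : Gen → HPoly
  | .h0 => hvar .h10
  | .h1 => hvar .h11
  | .h2 => hvar .h12
  | .b20 => hvar .h20 ^ 2
  | .b21 => hvar .h21 ^ 2
  | .b30 => hvar .h30 ^ 2
  | .h01 => hvar .h20 * hvar .h21 + hvar .h11 * hvar .h30

theorem hDiff_genPoly (g : Gen) : hDiff (genPoly g) = 0 := by
  have h2 : ∀ x : HPoly, x + x = 0 := fun x => CharTwo.add_self_eq_zero x
  have hX : ∀ i, hDiff (hvar i) = _ := fun i => MvPolynomial.mkDerivation_X M2 _ i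
  cases g <;>
    simp only [genPoly, pow_two, map_add, Derivation.leibniz, hX, smul_eq_mul, h2, mul_zero,
      add_zero]
  linear_combination h2 (hvar .h10 * hvar .h11 * hvar .h21) +
    h2 (hvar .h20 * hvar .h11 * hvar .h12)

/-- The cohomology classes of the generators. -/
def genClass (g : Gen) : HCohomology :=
  Ideal.Quotient.mk _ (⟨genPoly g, Algebra.mem_top, hDiff_genPoly g⟩ : HCocycles)

/-- The relations among the generators, as elements of the polynomial ring over `𝕄₂` on them. -/
def relations : Set (MvPolynomial Gen M2) :=
  let h0 : MvPolynomial Gen M2 := MvPolynomial.X .h0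
  let h1 : MvPolynomial Gen M2 := MvPolynomial.X .h1
  let h2 : MvPolynomial Gen M2 := MvPolynomial.X .h2
  let b20 : MvPolynomial Gen M2 := MvPolynomial.X .b20
  let b21 : MvPolynomial Gen M2 := MvPolynomial.X .b21
  let b30 : MvPolynomial Gen M2 := MvPolynomial.X .b30
  let h01 : MvPolynomial Gen M2 := MvPolynomial.X .h01
  {h0 * h1, h1 * h2, h2 * b20 - h0 * h01, h2 * h01 - h0 * b21,
    h01 ^ 2 - (b20 * b21 + h1 ^ 2 * b30)}

end MotivicA2
end

open MotivicA2

/-!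
The algebra `A(2)` behaves like the enveloping algebra of a Lie algebra with six generators, and
`Gr A(2)` has an explicit multiplication in which the cobar complex can be compared directly with
the polynomial ring on the dual generators, which is small enough to be computed by hand.

*Structure of `A(2)`.* Commutators of `Sq¹`, `Sq²`, `Sq⁴` give six elements `sqGen i`, and the Adem
relations imply commutation relations that put every product of them in order
(`isPBWFamily_sqGen`). Hence the ordered squarefree monomials span `A(2)`, and those of May
filtration at least `n` span `Iⁿ` (`mem_pow_iff`). They are linearly independent: the total square
`ξ₁ ↦ ξ₁ + s`, `ξ₂ ↦ ξ₂ + s ξ₁²`, `ξ₃ ↦ ξ₃ + s ξ₂²` makes the Steenrod algebra act on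
`𝔽₂[ξ₁, ξ₂, ξ₃]` (the Adem relations hold by the symmetry `totalSq_totalSq` of the iterated total
square and the binomial identity `sum_choose_mul_choose_zmod_two`), and the `64` monomials act by
linearly independent operators (`linearIndependent_monom_xiGen`). Letting powers of `τ` and of an
additional variable record weights and degrees turns this into a representation over `𝕄₂`, which
also shows that coordinates of homogeneous elements are homogeneous (`repr_of_mem_steenrodDeg`). So
`Gr A(2)` is free over `𝕄₂` on the classes of the ordered monomials, and its product is that of an
exterior algebra up to shorter monomials (`grCoord_grMonom_mul`).

*From the cobar complex to the polynomial ring.* Sending a cochain to the sum of its values on the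
words in the six generators, each multiplied by the product of the variables, is an algebra map
`symbol` from the cobar complex to the polynomial ring. It commutes with the differentials because
the derivation `hDiff` is dual to the products of two generators in `Gr A(2)`
(`isKoszulBasis_augBasis`). It is surjective, and its kernel is acyclic. For the latter, modulo
coboundaries one can permute the letters of a word in the generators, so a cochain in the kernel
may be assumed to vanish on such words (`Letter.exists_wordDiff_eq_on_single`). The remaining words
contain a letter with several elements, and splitting off the least element of the first such letter
is a contracting homotopy up to terms that come later in a suitable order of the words
(`Letter.extDiff_contract`, `Letter.exists_wordDiff_eq`). All steps preserve degrees. The result is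
`extEquiv`, the isomorphism of the cohomology of the polynomial ring with `Ext`.

*Cohomology of the polynomial ring.* Squares are cocycles in characteristic two, and the polynomial
ring is free, on the squarefree monomials in `h₂₀`, `h₂₁`, `h₃₀`, over the subring generated by the
`h_{1j}` and the squares of these three variables (`exists_evenSum_eq`, `evenSum_injective`). In
this basis the differential is an `8 × 8` matrix (`hDiff_evenSum`). Its kernel is spanned by `1`,
`h₀(1)` and coboundaries (`exists_of_hDiff_eq_zero`), and the coefficients of a coboundary at `1`
and `h₀(1)` are combinations of the relations (`mem_span_relations_of_hDiff_eq`).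
-/

noncomputable section

namespace MotivicA2

/-! ### A binomial identity modulo two -/

/-- Both sides are the coefficient of `zᵃ` in `(1 + z + z²)^(a+b) (1 + z)^(b-1) / (1 + z)^(a+b)`,
where `1 + z + z²` is regarded as `(1 + z) + z²` on the left and as `z (1 + z) + 1` on the right.
-/
theorem sum_choose_mul_choose_zmod_two (a b : ℕ) (hab : a < 2 * b) :
    ∑ c ∈ Finset.range (a / 2 + 1),
      (((b - 1 - c).choose (a - 2 * c) : ℕ) : ZMod 2) * ((a + b).choose c : ℕ) =
      ((a + b).choose a : ℕ) := by
  set v : PowerSeries (ZMod 2) := PowerSeries.mk 1 with hv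
  set u : PowerSeries (ZMod 2) := 1 + PowerSeries.X with hu
  have huv : u * v = 1 := by
    have h := PowerSeries.mk_one_mul_one_sub_eq_one (ZMod 2)
    have h2 : (2 : PowerSeries (ZMod 2)) = 0 := by
      rw [← map_ofNat (PowerSeries.C (R := ZMod 2)) 2, show (OfNat.ofNat 2 : ZMod 2) = 0 from rfl,
        map_zero]
    linear_combination h + v * PowerSeries.X * h2
  have hcancel : ∀ m n : ℕ, u ^ m * v ^ (m + n) = v ^ n := by
    intro m n
    rw [pow_add, ← mul_assoc, ← mul_pow, huv, one_pow, one_mul]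
  have hcancel' : ∀ m n : ℕ, u ^ (m + n) * v ^ m = u ^ n := by
    intro m n
    rw [pow_add, mul_right_comm, ← mul_pow, huv, one_pow, one_mul]
  have hucoe : ∀ m n : ℕ, PowerSeries.coeff n (u ^ m) = ((m.choose n : ℕ) : ZMod 2) := by
    intro m n
    have h := Polynomial.coeff_one_add_X_pow (ZMod 2) m n
    rw [← h, ← Polynomial.coeff_coe]
    simp [hu]
  have e1 : (u + PowerSeries.X ^ 2) ^ (a + b) * (u ^ (b - 1) * v ^ (a + b)) =
      ∑ c ∈ Finset.range (a + b + 1),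
        PowerSeries.X ^ (2 * c) * ((u ^ (b - 1) * v ^ c) * (((a + b).choose c : ℕ) :
          PowerSeries (ZMod 2))) := by
    rw [add_comm u, add_pow, Finset.sum_mul]
    refine Finset.sum_congr rfl fun c hc => ?_
    have hc' : c ≤ a + b := Nat.lt_succ_iff.1 (Finset.mem_range.1 hc)
    have := hcancel (a + b - c) c
    rw [Nat.sub_add_cancel hc'] at this
    rw [← this, pow_mul]; ring
  have e2 : (u + PowerSeries.X ^ 2) ^ (a + b) * (u ^ (b - 1) * v ^ (a + b)) =
      ∑ k ∈ Finset.range (a + b + 1),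
        PowerSeries.X ^ k * ((u ^ (b - 1 + k) * v ^ (a + b)) * (((a + b).choose k : ℕ) :
          PowerSeries (ZMod 2))) := by
    have h : u + PowerSeries.X ^ 2 = PowerSeries.X * u + 1 := by rw [hu]; ring
    rw [h, add_pow, Finset.sum_mul]
    refine Finset.sum_congr rfl fun k _ => ?_
    rw [one_pow, mul_pow, pow_add]; ring
  have key := congrArg (PowerSeries.coeff a) (e1.symm.trans e2)
  have hcast : ∀ (n m : ℕ) (p : PowerSeries (ZMod 2)),
      PowerSeries.coeff n (p * (m : PowerSeries (ZMod 2))) = PowerSeries.coeff n p * m := by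
    intro n m p
    rw [← nsmul_eq_mul', map_nsmul, nsmul_eq_mul']
  rw [map_sum, map_sum] at key
  simp only [PowerSeries.coeff_X_pow_mul', hcast] at key
  have l1 : ∑ c ∈ Finset.range (a + b + 1),
      (if 2 * c ≤ a then PowerSeries.coeff (a - 2 * c) (u ^ (b - 1) * v ^ c) *
        (((a + b).choose c : ℕ) : ZMod 2) else 0) =
      ∑ c ∈ Finset.range (a / 2 + 1),
        (((b - 1 - c).choose (a - 2 * c) : ℕ) : ZMod 2) * ((a + b).choose c : ℕ) := by
    rw [Finset.sum_ite, Finset.sum_const_zero, add_zero]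
    refine Finset.sum_congr ?_ fun c hc => ?_
    · ext c
      simp only [Finset.mem_range, Finset.mem_filter]
      omega
    · have hc' := Finset.mem_range.1 hc
      have := hcancel' c (b - 1 - c)
      rw [show c + (b - 1 - c) = b - 1 by omega] at this
      rw [this, hucoe]
  have l2 : ∑ k ∈ Finset.range (a + b + 1),
      (if k ≤ a then PowerSeries.coeff (a - k) (u ^ (b - 1 + k) * v ^ (a + b)) *
        (((a + b).choose k : ℕ) : ZMod 2) else 0) = ((a + b).choose a : ℕ) := by
    rw [Finset.sum_eq_single a]
    · have := hcancel (b - 1 + a) 1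
      rw [show b - 1 + a + 1 = a + b by omega] at this
      rw [if_pos le_rfl, this, Nat.sub_self]
      simp [hv]
    · intro k _ hk
      split_ifs with h
      -- For `k < a` the coefficient is a central binomial coefficient, which is even.
      · have h1 := hcancel (b - 1 + k) (a - k + 1)
        rw [show b - 1 + k + (a - k + 1) = a + b by omega] at h1
        have h2 : (((a - k + (a - k)).choose (a - k) : ℕ) : ZMod 2) = 0 := by
          rw [← two_mul]
          exact (ZMod.natCast_eq_zero_iff _ _).2
            (Nat.two_dvd_centralBinom_of_one_le (by omega))
        rw [h1, hv, PowerSeries.mk_one_pow_eq_mk_choose_add, PowerSeries.coeff_mk, h2, zero_mul]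
      · rfl
    · intro h
      exact absurd (Finset.mem_range.2 (by omega)) h
  rw [← l1, key, l2]

/-! ### A faithful model of `A(2)` -/

/-- The coefficient of `s^a t^b` in `(s + t)^i (s^2 t)^j`, modulo two. -/
def admCoeff (i j a b : ℕ) : ZMod 2 :=
  if j ≤ b ∧ a + b = i + 3 * j then (i.choose (b - j) : ℕ) else 0

/-- The coefficients of a polynomial in `s + t` and `s² t` satisfy the Adem relations. -/
theorem admCoeff_adem (i j a b : ℕ) (hab : a < 2 * b) :
    admCoeff i j a b = ∑ c ∈ Finset.range (a / 2 + 1),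
      (((b - 1 - c).choose (a - 2 * c) : ℕ) : ZMod 2) * admCoeff i j (a + b - c) c := by
  by_cases hij : a + b = i + 3 * j
  swap
  · rw [admCoeff, if_neg (by omega)]
    refine (Finset.sum_eq_zero fun c hc => ?_).symm
    have := Finset.mem_range.1 hc
    rw [admCoeff, if_neg (by omega), mul_zero]
  by_cases hj : 2 * j ≤ a
  · obtain ⟨a, rfl⟩ := Nat.exists_eq_add_of_le' hj
    obtain ⟨b, rfl⟩ : ∃ b', b = b' + j := ⟨b - j, by omega⟩
    obtain rfl : i = a + b := by omega
    rw [admCoeff, if_pos ⟨by omega, hij⟩, show (a + 2 * j) / 2 + 1 = j + (a / 2 + 1) by omega,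
      Finset.sum_range_add, Finset.sum_eq_zero, zero_add, Nat.add_sub_cancel,
      ← Nat.choose_symm (Nat.le_add_left b a), Nat.add_sub_cancel,
      ← sum_choose_mul_choose_zmod_two a b (by omega)]
    · refine Finset.sum_congr rfl fun c hc => ?_
      have := Finset.mem_range.1 hc
      rw [admCoeff, if_pos ⟨by omega, by omega⟩, show b + j - 1 - (j + c) = b - 1 - c by omega,
        show a + 2 * j - 2 * (j + c) = a - 2 * c by omega, Nat.add_sub_cancel_left]
    · intro c hc
      have := Finset.mem_range.1 hc
      rw [admCoeff, if_neg (by omega), mul_zero]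
  · rw [Finset.sum_eq_zero, admCoeff]
    · split_ifs with h
      · rw [Nat.choose_eq_zero_of_lt (by omega), Nat.cast_zero]
      · rfl
    · intro c hc
      have := Finset.mem_range.1 hc
      rw [admCoeff, if_neg (by omega), mul_zero]

/-- The polynomial ring `𝔽₂[ξ₁, ξ₂, ξ₃]`, on which the classical Steenrod algebra acts. -/
def XiPoly : Type := MvPolynomial (Fin 3) (ZMod 2)

instance : CommRing XiPoly := inferInstanceAs (CommRing (MvPolynomial (Fin 3) (ZMod 2)))

instance : Algebra (ZMod 2) XiPoly :=
  inferInstanceAs (Algebra (ZMod 2) (MvPolynomial (Fin 3) (ZMod 2)))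

instance : CharP XiPoly 2 := inferInstanceAs (CharP (MvPolynomial (Fin 3) (ZMod 2)) 2)

/-- The generator `ξ₁`. -/
def xi1 : XiPoly := MvPolynomial.X (R := ZMod 2) (0 : Fin 3)
/-- The generator `ξ₂`. -/
def xi2 : XiPoly := MvPolynomial.X (R := ZMod 2) (1 : Fin 3)
/-- The generator `ξ₃`. -/
def xi3 : XiPoly := MvPolynomial.X (R := ZMod 2) (2 : Fin 3)

/-- The algebra homomorphism with prescribed values on `ξ₁`, `ξ₂` and `ξ₃`. -/
def xiLift {B : Type*} [CommRing B] [Algebra (ZMod 2) B] (x y z : B) : XiPoly →ₐ[ZMod 2] B :=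
  MvPolynomial.aeval (R := ZMod 2) ![x, y, z]

section XiLift

variable {B : Type*} [CommRing B] [Algebra (ZMod 2) B] (x y z : B)

theorem xiLift_xi1 : xiLift x y z xi1 = x := MvPolynomial.aeval_X _ _

theorem xiLift_xi2 : xiLift x y z xi2 = y := MvPolynomial.aeval_X _ _

theorem xiLift_xi3 : xiLift x y z xi3 = z := MvPolynomial.aeval_X _ _

end XiLift

theorem xi_ringHom_ext {B : Type*} [CommRing B] {f g : XiPoly →+* B} (h1 : f xi1 = g xi1)
    (h2 : f xi2 = g xi2) (h3 : f xi3 = g xi3) : f = g := by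
  refine MvPolynomial.ringHom_ext (R := ZMod 2) (fun r => ?_) fun i => ?_
  · exact DFunLike.congr_fun (Subsingleton.elim (f.comp (algebraMap (ZMod 2) XiPoly))
      (g.comp (algebraMap (ZMod 2) XiPoly))) r
  · fin_cases i
    exacts [h1, h2, h3]

/-- The total square `∑ sⁿ Sqⁿ`, the ring homomorphism with `ξ₁ ↦ ξ₁ + s`, `ξ₂ ↦ ξ₂ + s ξ₁²` and
`ξ₃ ↦ ξ₃ + s ξ₂²`. -/
def totalSq : XiPoly →ₐ[ZMod 2] XiPoly[X] :=
  xiLift (C xi1 + X) (C xi2 + X * C (xi1 ^ 2)) (C xi3 + X * C (xi2 ^ 2))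

/-- The action of `Sqⁿ` on `𝔽₂[ξ₁, ξ₂, ξ₃]`; it lowers degrees by `n`. -/
def xiSq (n : ℕ) : Module.End (ZMod 2) XiPoly :=
  ((lcoeff XiPoly n).restrictScalars (ZMod 2)).comp totalSq.toLinearMap

theorem xiSq_apply (n : ℕ) (f : XiPoly) : xiSq n f = (totalSq f).coeff n := rfl

/-- The homomorphism with `ξ₁ ↦ ξ₁ + e`, `ξ₂ ↦ ξ₂ + e ξ₁² + m` and `ξ₃ ↦ ξ₃ + e ξ₂² + m ξ₁⁴`, where
`e` is the inner and `m` the outer variable. -/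
def doubleSq : XiPoly →ₐ[ZMod 2] XiPoly[X][X] :=
  xiLift (C (C xi1) + C X) (C (C xi2) + C X * C (C (xi1 ^ 2)) + X)
    (C (C xi3) + C X * C (C (xi2 ^ 2)) + X * C (C (xi1 ^ 4)))

/-- The substitution `e ↦ s + t`, `m ↦ s² t`, where `s` is the inner and `t` the outer variable. -/
def symSubst : XiPoly[X][X] →+* XiPoly[X][X] :=
  eval₂RingHom (S := XiPoly[X][X])
    (eval₂RingHom (S := XiPoly[X][X]) (C.comp C) (X + C X)) (C X ^ 2 * X)

/-- The composition of two total squares depends on `s + t` and `s² t` only. -/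
theorem totalSq_totalSq (f : XiPoly) :
    (totalSq f).map totalSq.toRingHom = symSubst (doubleSq f) := by
  have h2 : (2 : XiPoly[X][X]) = 0 := CharTwo.two_eq_zero
  have h : ((mapRingHom totalSq.toRingHom).comp totalSq.toRingHom) =
      symSubst.comp doubleSq.toRingHom := by
    have hC : ∀ v, symSubst (C (C v)) = C (C v) := fun v => by simp [symSubst]
    have hX : symSubst (C X) = X + C X := by simp [symSubst]
    have hY : symSubst X = C X ^ 2 * X := by simp [symSubst]
    refine xi_ringHom_ext ?_ ?_ ?_
    · simp [totalSq, doubleSq, xiLift_xi1, hC, hX]; ring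
    · simp [totalSq, doubleSq, xiLift_xi1, xiLift_xi2, hC, hX, hY]
      linear_combination (C X * X * C (C xi1)) * h2
    · simp [totalSq, doubleSq, xiLift_xi2, xiLift_xi3, hC, hX, hY]
      linear_combination (C X * X * C (C xi1) ^ 2 * C (C xi2)) * h2
  exact DFunLike.congr_fun h f

theorem xiSq_mul_apply (a b : ℕ) (f : XiPoly) :
    (xiSq a * xiSq b) f = ((symSubst (doubleSq f)).coeff b).coeff a := by
  rw [← totalSq_totalSq, coeff_map]; rfl

theorem coeff_symSubst (i j a b : ℕ) (f : XiPoly) :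
    ((symSubst (monomial j (monomial i f))).coeff b).coeff a = admCoeff i j a b • f := by
  have h : symSubst (monomial j (monomial i f)) =
      C (C f) * (X + C X) ^ i * C (X ^ (2 * j)) * X ^ j := by
    simp only [symSubst, coe_eval₂RingHom, eval₂_monomial, RingHom.comp_apply]
    rw [mul_pow, ← pow_mul, ← map_pow]; ring
  rw [h, coeff_mul_X_pow', admCoeff]
  by_cases hj : j ≤ b
  · rw [if_pos hj, coeff_mul_C, coeff_C_mul, coeff_X_add_C_pow]
    have e : C f * (X ^ (i - (b - j)) * ((i.choose (b - j) : ℕ) : XiPoly[X])) * X ^ (2 * j) =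
        C (f * (i.choose (b - j) : ℕ)) * X ^ (i - (b - j) + 2 * j) := by
      rw [pow_add, C_mul, ← C_eq_natCast]; ring
    rw [e, coeff_C_mul_X_pow]
    by_cases hi : b - j ≤ i
    · by_cases h1 : a + b = i + 3 * j
      · rw [if_pos (by omega), if_pos ⟨hj, h1⟩, Nat.cast_smul_eq_nsmul, nsmul_eq_mul, mul_comm]
      · rw [if_neg (by omega), if_neg (by omega), zero_smul]
    · rw [Nat.choose_eq_zero_of_lt (not_le.1 hi)]
      simp
  · rw [if_neg hj, if_neg (fun h => hj h.1), coeff_zero, zero_smul]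

/-- The Adem relations hold on `𝔽₂[ξ₁, ξ₂, ξ₃]`. -/
theorem xiSq_adem (a b : ℕ) (hab : a < 2 * b) :
    xiSq a * xiSq b = ∑ c ∈ Finset.range (a / 2 + 1),
      (((b - 1 - c).choose (a - 2 * c) : ℕ) : ZMod 2) • (xiSq (a + b - c) * xiSq c) := by
  have key : ∀ p : XiPoly[X][X], ((symSubst p).coeff b).coeff a =
      ∑ c ∈ Finset.range (a / 2 + 1), (((b - 1 - c).choose (a - 2 * c) : ℕ) : ZMod 2) •
        ((symSubst p).coeff c).coeff (a + b - c) := by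
    intro p
    induction p using Polynomial.induction_on' with
    | add p q hp hq =>
      simp only [map_add, coeff_add, hp, hq, smul_add, Finset.sum_add_distrib]
    | monomial j p =>
      induction p using Polynomial.induction_on' with
      | add p q hp hq =>
        simp only [map_add, coeff_add, hp, hq, smul_add, Finset.sum_add_distrib]
      | monomial i f =>
        simp only [coeff_symSubst, smul_smul, ← Finset.sum_smul]
        rw [admCoeff_adem i j a b hab]
  refine LinearMap.ext fun f => ?_
  rw [xiSq_mul_apply, key, LinearMap.sum_apply]
  refine Finset.sum_congr rfl fun c _ => ?_
  rw [LinearMap.smul_apply, xiSq_mul_apply]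

/-- The homomorphism with `ξ₁ ↦ ξ₁`, `ξ₂ ↦ ξ₂ + m` and `ξ₃ ↦ ξ₃ + m ξ₁⁴`. -/
def divSq : XiPoly →+* XiPoly[X] := (mapRingHom constantCoeff).comp doubleSq.toRingHom

theorem coeff_divSq (n : ℕ) (f : XiPoly) :
    (divSq f).coeff n = ((doubleSq f).coeff n).coeff 0 := by
  simp [divSq, coeff_map]

theorem divSq_xi1 : divSq xi1 = C xi1 := by simp [divSq, doubleSq, xiLift_xi1]

theorem divSq_xi2 : divSq xi2 = C xi2 + X := by simp [divSq, doubleSq, xiLift_xi2]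

theorem divSq_xi3 : divSq xi3 = C xi3 + X * C (xi1 ^ 4) := by
  simp [divSq, doubleSq, xiLift_xi3]

/-- A commutator of squares is a coefficient of `divSq` if the corresponding combination of
coefficients of `(s + t)^i (s² t)^j` vanishes unless `i = 0` and `j = n`. -/
theorem xiSq_commutator_apply {a b n : ℕ}
    (h : ∀ i j, admCoeff i j a b + admCoeff i j b a = if i = 0 ∧ j = n then 1 else 0)
    (f : XiPoly) : (xiSq a * xiSq b + xiSq b * xiSq a) f = (divSq f).coeff n := by
  have key : ∀ p : XiPoly[X][X], ((symSubst p).coeff b).coeff a +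
      ((symSubst p).coeff a).coeff b = (p.coeff n).coeff 0 := by
    intro p
    induction p using Polynomial.induction_on' with
    | add p q hp hq =>
      simp only [map_add, coeff_add, ← hp, ← hq]; abel
    | monomial j p =>
      induction p using Polynomial.induction_on' with
      | add p q hp hq =>
        simp only [map_add, coeff_add, ← hp, ← hq]; abel
      | monomial i f =>
        rw [coeff_symSubst, coeff_symSubst, ← add_smul, h, coeff_monomial]
        by_cases hj : j = n <;> by_cases hi : i = 0 <;> simp [hi, hj, coeff_monomial]
  rw [LinearMap.add_apply, xiSq_mul_apply, xiSq_mul_apply, key, coeff_divSq]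

/-- The action of the commutator of `Sq¹` and `Sq²`. -/
def xiQ1 : Module.End (ZMod 2) XiPoly := xiSq 1 * xiSq 2 + xiSq 2 * xiSq 1

/-- The action of the commutator of `Sq²` and `Sq⁴`. -/
def xiP21 : Module.End (ZMod 2) XiPoly := xiSq 2 * xiSq 4 + xiSq 4 * xiSq 2

/-- The action of the commutator of `Sq¹` and `xiP21`. -/
def xiQ2 : Module.End (ZMod 2) XiPoly := xiSq 1 * xiP21 + xiP21 * xiSq 1

theorem xiQ1_apply (f : XiPoly) : xiQ1 f = (divSq f).coeff 1 := by
  refine xiSq_commutator_apply (fun i j => ?_) f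
  by_cases h : i + 3 * j = 3
  · obtain ⟨rfl, rfl⟩ | ⟨rfl, rfl⟩ : (i = 3 ∧ j = 0) ∨ (i = 0 ∧ j = 1) := by omega
    all_goals decide
  · simp only [admCoeff]
    rw [if_neg (by omega), if_neg (by omega), if_neg (by omega), add_zero]

theorem xiP21_apply (f : XiPoly) : xiP21 f = (divSq f).coeff 2 := by
  refine xiSq_commutator_apply (fun i j => ?_) f
  by_cases h : i + 3 * j = 6
  · obtain ⟨rfl, rfl⟩ | ⟨rfl, rfl⟩ | ⟨rfl, rfl⟩ :
      (i = 6 ∧ j = 0) ∨ (i = 3 ∧ j = 1) ∨ (i = 0 ∧ j = 2) := by omega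
    all_goals decide
  · simp only [admCoeff]
    rw [if_neg (by omega), if_neg (by omega), if_neg (by omega), add_zero]

theorem xiSq_xi1_pow (n p : ℕ) :
    xiSq n (xi1 ^ p) = ((p.choose n : ℕ) : XiPoly) * xi1 ^ (p - n) := by
  rw [xiSq_apply, map_pow, totalSq, xiLift_xi1, add_comm, coeff_X_add_C_pow, mul_comm]

theorem divSq_xi2_pow_mul (n q p : ℕ) :
    (divSq (xi2 ^ q * xi1 ^ p)).coeff n =
      ((q.choose n : ℕ) : XiPoly) * (xi2 ^ (q - n) * xi1 ^ p) := by
  rw [map_mul, map_pow, map_pow, divSq_xi1, divSq_xi2, ← C_pow, coeff_mul_C, add_comm,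
    coeff_X_add_C_pow]
  ring

theorem xiP21_xi3_mul (f : XiPoly) :
    xiP21 (xi3 * f) = xi3 * xiP21 f + xi1 ^ 4 * xiQ1 f := by
  rw [xiP21_apply, xiP21_apply, xiQ1_apply, map_mul, divSq_xi3, add_mul, coeff_add, coeff_C_mul,
    mul_right_comm, coeff_mul_C, coeff_X_mul]
  ring

theorem xiSq_one_mul_apply (f g : XiPoly) : xiSq 1 (f * g) = xiSq 1 f * g + f * xiSq 1 g := by
  have h0 : ∀ f : XiPoly, (totalSq f).coeff 0 = f := by
    intro f
    have h : (constantCoeff.comp totalSq.toRingHom) = RingHom.id XiPoly := by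
      refine xi_ringHom_ext ?_ ?_ ?_ <;>
        simp [totalSq, xiLift_xi1, xiLift_xi2, xiLift_xi3]
    exact DFunLike.congr_fun h f
  simp only [xiSq_apply, map_mul, coeff_mul, Finset.Nat.antidiagonal_succ,
    Finset.Nat.antidiagonal_zero, Finset.map_singleton, Finset.sum_cons, Finset.sum_singleton]
  simp [h0]
  ring

theorem xiSq_one_xi1 : xiSq 1 xi1 = 1 := by simp [xiSq_apply, totalSq, xiLift_xi1]

theorem xiSq_one_xi2 : xiSq 1 xi2 = xi1 ^ 2 := by
  have : C xi2 + X * C (xi1 ^ 2) = C xi2 + C (xi1 ^ 2) * X := by ring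
  rw [xiSq_apply, totalSq, xiLift_xi2, this]
  simp [-map_pow]

theorem xiSq_one_xi3 : xiSq 1 xi3 = xi2 ^ 2 := by
  have : C xi3 + X * C (xi2 ^ 2) = C xi3 + C (xi2 ^ 2) * X := by ring
  rw [xiSq_apply, totalSq, xiLift_xi3, this]
  simp [-map_pow]

theorem xiSq_one_xi2_pow_mul (q p : ℕ) : xiSq 1 (xi2 ^ q * xi1 ^ p) =
    (q : XiPoly) * (xi2 ^ (q - 1) * xi1 ^ (p + 2)) + (p : XiPoly) * (xi2 ^ q * xi1 ^ (p - 1)) := by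
  have hpow : ∀ (f : XiPoly) (n : ℕ), xiSq 1 (f ^ n) = n * f ^ (n - 1) * xiSq 1 f := by
    intro f n
    induction n with
    | zero =>
      have := xiSq_one_mul_apply 1 1
      simpa using this
    | succ n ih =>
      rw [pow_succ, xiSq_one_mul_apply, ih]
      cases n with
      | zero => simp
      | succ n => simp; ring
  rw [xiSq_one_mul_apply, hpow, hpow, xiSq_one_xi1, xiSq_one_xi2]
  ring

/-! ### Commutation relations in `A(2)` -/

/-- The commutation relations that put every product of the elements `a`, `b`, `c`, `d`, `e`, `f`
into alphabetical order. -/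
structure IsPBWFamily {k B : Type*} [CommRing k] [Ring B] [Algebra k B] (t : k)
    (a b c d e f : B) : Prop where
  ba : b * a = a * b + d
  ca : c * a = a * c + b * d
  da : d * a = a * d
  ea : e * a = a * e + f
  fa : f * a = a * f
  cb : c * b = b * c + e
  db : d * b = b * d
  eb : e * b = b * e + t • (a * f)
  fb : f * b = b * f
  dc : d * c = c * d + f
  ec : e * c = c * e + t • (a * (b * f) + d * f)
  fc : f * c = c * f
  ed : e * d = d * e
  fd : f * d = d * f
  fe : f * e = e * f
  aa : a * a = 0
  bb : b * b = t • (a * d)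
  cc : c * c = b * e
  dd : d * d = 0
  ee : e * e = 0
  ff : f * f = 0

theorem reassoc {B : Type*} [Semigroup B] {x y z : B} (h : x * y = z) (w : B) :
    x * (y * w) = z * w := by rw [← mul_assoc, h]

/-- The commutation relations follow from those of degrees `2`, `4`, `5`, `8` between the generators
`a`, `b`, `c` of the algebra, together with one relation in degree `14`. The latter is not a
consequence of the former: they imply only `t f² = 0`. -/
theorem IsPBWFamily.of_generators {k B : Type*} [CommRing k] [Ring B] [Algebra k B] (t : k)
    {a b c d e f : B} (h2 : ∀ x : B, x + x = 0) (hd : d = a * b + b * a) (he : e = b * c + c * b)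
    (hf : f = d * c + c * d) (aa : a * a = 0) (bb₀ : b * b = t • (a * (b * a)))
    (ca₀ : c * a = a * c + b * (a * b)) (cc₀ : c * c = b * (c * b) + t • (a * (b * (c * a))))
    (ff₀ : d * (c * (d * c)) = c * (d * (c * d))) : IsPBWFamily t a b c d e f := by
  have h2' : ∀ x y : B, x + (x + y) = y := fun x y => by rw [← add_assoc, h2, zero_add]
  have ba : b * a = a * b + d := by rw [hd, h2']
  have cb : c * b = b * c + e := by rw [he, h2']
  have dc : d * c = c * d + f := by rw [hf, add_comm (d * c), h2']
  have bb : b * b = t • (a * d) := by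
    rw [bb₀, ba, mul_add, ← mul_assoc, aa, zero_mul, zero_add]
  have da : d * a = a * d := by
    simp only [hd, mul_add, add_mul, mul_assoc, aa, reassoc aa, zero_mul, mul_zero, add_zero,
      zero_add]
  have db : d * b = b * d := by
    have h : a * (b * b) = b * (b * a) := by
      rw [reassoc bb, bb]
      simp only [smul_mul_assoc, mul_smul_comm, mul_assoc, da, reassoc aa, zero_mul]
    simp only [hd, mul_add, add_mul, mul_assoc, h]
    rw [add_comm]
  have ca : c * a = a * c + b * d := by
    have h : b * (b * a) = 0 := by
      rw [reassoc bb, smul_mul_assoc, mul_assoc, da, reassoc aa, zero_mul, smul_zero]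
    rw [ca₀, hd, mul_add, h, add_zero]
  have dd : d * d = 0 := by
    have h : a * (b * d) = b * (d * a) := by
      have h1 : b * d = a * c + c * a := by rw [ca, h2']
      rw [h1, ← mul_assoc b, h1]
      simp only [mul_add, add_mul, mul_assoc, aa, reassoc aa, zero_mul, mul_zero, add_zero,
        zero_add]
    rw [da, reassoc ba, add_mul, mul_assoc] at h
    exact left_eq_add.1 h
  have ea : e * a = a * e + f := by
    simp only [he, hf, mul_add, add_mul, mul_assoc, smul_mul_assoc, ba, reassoc ba, ca, reassoc ca,
      db, reassoc bb, dd, mul_zero, smul_zero, add_assoc, add_comm, add_left_comm, add_zero]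
  have cc : c * c = b * e := by
    simp only [cc₀, mul_add, add_mul, mul_assoc, smul_mul_assoc, reassoc ba, ca, cb, reassoc bb, dd,
      reassoc aa, zero_mul, mul_zero, smul_zero, add_comm, add_left_comm, add_zero, h2]
  have eb : e * b = b * e + t • (a * f) := by
    simp only [he, hf, mul_add, add_mul, mul_assoc, smul_mul_assoc, mul_smul_comm, reassoc ca, bb,
      reassoc bb, dd, mul_zero, add_comm, add_left_comm, add_zero, smul_add, h2]
  have fa : f * a = a * f := by
    simp only [hf, mul_add, add_mul, mul_assoc, ca, reassoc ca, da, reassoc da, reassoc db, dd,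
      mul_zero, add_comm, add_zero]
  -- The relations for `e c`, `e d` and `e e` come from the two ways to rewrite `c c b`, `c c a` and
  -- `c c c`.
  have ec : e * c = c * e + t • (a * (b * f) + d * f) := by
    have h := mul_assoc c c b
    rw [cc, cb] at h
    simp only [mul_add, add_mul, mul_assoc, smul_mul_assoc, mul_smul_comm, reassoc ba, reassoc cb,
      cc, reassoc bb, eb, add_assoc, smul_add] at h
    have h' := congrArg (fun x => x + (t • (a * (d * e)) + c * e)) h
    simp only [add_assoc, add_comm, add_left_comm, h2, h2', add_zero] at h'
    rw [← h']
    simp only [smul_add]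
  have ed : e * d = d * e := by
    have h := mul_assoc c c a
    rw [cc, ca] at h
    simp only [mul_add, add_mul, mul_assoc, reassoc ba, reassoc ca, reassoc cb, cc, ea, dc,
      add_assoc] at h
    have h' := congrArg (fun x => x + (a * (b * e) + b * f)) h
    simp only [add_assoc, add_comm, add_left_comm, h2'] at h'
    exact h'.symm
  have fb : f * b = b * f := by
    simp only [hf, mul_add, add_mul, mul_assoc, cb, reassoc cb, db, reassoc db, ed, add_comm,
      add_left_comm, h2, add_zero]
  have fc : f * c = c * f := by
    simp only [hf, mul_add, add_mul, mul_assoc, cc, reassoc cc, reassoc db, ed]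
    rw [add_comm]
  have fd : f * d = d * f := by
    simp only [hf, mul_add, add_mul, mul_assoc, dd, reassoc dd, mul_zero, zero_mul, zero_add,
      add_zero]
  have ee : e * e = 0 := by
    have h := mul_assoc c c c
    rw [cc] at h
    simp only [mul_assoc, reassoc cb, add_mul, ec, mul_add, mul_smul_comm, reassoc ba, reassoc bb,
      smul_mul_assoc, smul_add, reassoc aa, zero_mul, smul_zero, reassoc db, zero_add, h2,
      add_zero] at h
    exact left_eq_add.1 h
  have fe : f * e = e * f := by
    have h : c * e = e * c + t • (a * (b * f) + d * f) := by rw [ec, add_assoc, h2, add_zero]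
    have h1 : d * (c * e) + c * (d * e) = e * (d * c) + e * (c * d) := by
      rw [← ed, h, reassoc h, reassoc ed]
      simp only [mul_add, add_mul, mul_assoc, smul_mul_assoc, mul_smul_comm, reassoc da, reassoc db,
        fd, reassoc dd, zero_mul, add_zero, add_comm, add_left_comm, h2]
    simp only [hf, mul_add, add_mul, mul_assoc]
    exact h1
  have ff : f * f = 0 := by
    simp only [dc, mul_add, mul_assoc, reassoc dc, add_mul, fd, reassoc fc, add_assoc, h2'] at ff₀
    exact add_eq_left.1 ((add_assoc _ _ _).trans ff₀)
  exact ⟨ba, ca, da, ea, fa, cb, db, eb, fb, dc, ec, fc, ed, fd, fe, aa, bb, cc, dd, ee, ff⟩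

theorem steenrod_add_self (x : Steenrod) : x + x = 0 := by
  have h2 : (2 : M2) = 0 := CharTwo.two_eq_zero
  rw [← two_smul M2 x, h2, zero_smul]

theorem Sq_zero : Sq 0 = 1 := by
  rw [Sq, freeSq, dif_neg (lt_irrefl 0)]
  exact map_one (RingQuot.mkAlgHom M2 AdemRel)

/-- The Adem relations, with the binomial coefficients reduced modulo two. -/
theorem Sq_mul_Sq (a b : ℕ) (ha : 0 < a) (hab : a < 2 * b) :
    Sq a * Sq b = ∑ c ∈ Finset.range (a / 2 + 1),
      (((b - 1 - c).choose (a - 2 * c) % 2 : ℕ) : M2) •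
        (τ ^ (a / 2 + b / 2 - ((a + b - c) / 2 + c / 2)) • (Sq (a + b - c) * Sq c)) := by
  have h := RingQuot.mkAlgHom_rel M2 (AdemRel.adem a b ha hab)
  rw [map_mul, map_sum] at h
  refine h.trans (Finset.sum_congr rfl fun c _ => ?_)
  have hc : ∀ n : ℕ, ((n % 2 : ℕ) : M2) = (n : M2) := fun n => by
    conv_rhs => rw [← Nat.div_add_mod n 2]
    have h2 : (2 : M2) = 0 := CharTwo.two_eq_zero
    rw [Nat.cast_add, Nat.cast_mul, Nat.cast_ofNat, h2, zero_mul, zero_add]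
  rw [map_smul, map_mul, hc, mul_smul]
  rfl

/-- The elements of `A(2)` dual to the generators `h_{ij}`. -/
def sqGen : HIndex → Steenrod
  | .h10 => Sq 1
  | .h11 => Sq 2
  | .h12 => Sq 4
  | .h20 => Sq 1 * Sq 2 + Sq 2 * Sq 1
  | .h21 => Sq 2 * Sq 4 + Sq 4 * Sq 2
  | .h30 => (Sq 1 * Sq 2 + Sq 2 * Sq 1) * Sq 4 + Sq 4 * (Sq 1 * Sq 2 + Sq 2 * Sq 1)

theorem isPBWFamily_sqGen : IsPBWFamily τ (sqGen .h10) (sqGen .h11) (sqGen .h12) (sqGen .h20)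
    (sqGen .h21) (sqGen .h30) := by
  have h2 := steenrod_add_self
  have h2' : ∀ x y : Steenrod, x + (x + y) = y := fun x y => by rw [← add_assoc, h2, zero_add]
  have r11 : Sq 1 * Sq 1 = 0 := by
    rw [Sq_mul_Sq 1 1 (by norm_num) (by norm_num)]
    simp [Sq_zero]
  have r12 : Sq 1 * Sq 2 = Sq 3 := by
    rw [Sq_mul_Sq 1 2 (by norm_num) (by norm_num)]
    simp [Sq_zero]
  have r13 : Sq 1 * Sq 3 = 0 := by
    rw [Sq_mul_Sq 1 3 (by norm_num) (by norm_num)]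
    simp [Sq_zero]
  have r14 : Sq 1 * Sq 4 = Sq 5 := by
    rw [Sq_mul_Sq 1 4 (by norm_num) (by norm_num)]
    simp [Sq_zero]
  have r15 : Sq 1 * Sq 5 = 0 := by
    rw [Sq_mul_Sq 1 5 (by norm_num) (by norm_num)]
    simp [Sq_zero]
  have r16 : Sq 1 * Sq 6 = Sq 7 := by
    rw [Sq_mul_Sq 1 6 (by norm_num) (by norm_num)]
    simp [Sq_zero]
  have r17 : Sq 1 * Sq 7 = 0 := by
    rw [Sq_mul_Sq 1 7 (by norm_num) (by norm_num)]
    simp [Sq_zero]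
  have r22 : Sq 2 * Sq 2 = τ • (Sq 3 * Sq 1) := by
    rw [Sq_mul_Sq 2 2 (by norm_num) (by norm_num)]
    simp [Finset.sum_range_succ, Sq_zero]
  have r23 : Sq 2 * Sq 3 = Sq 5 + Sq 4 * Sq 1 := by
    rw [Sq_mul_Sq 2 3 (by norm_num) (by norm_num)]
    simp [Finset.sum_range_succ, Sq_zero]
  have r24 : Sq 2 * Sq 4 = Sq 6 + τ • (Sq 5 * Sq 1) := by
    rw [Sq_mul_Sq 2 4 (by norm_num) (by norm_num)]
    simp [Finset.sum_range_succ, Sq_zero]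
  have r25 : Sq 2 * Sq 5 = Sq 6 * Sq 1 := by
    rw [Sq_mul_Sq 2 5 (by norm_num) (by norm_num)]
    simp [Finset.sum_range_succ, Nat.choose, Sq_zero]
  have r34 : Sq 3 * Sq 4 = Sq 7 := by
    rw [Sq_mul_Sq 3 4 (by norm_num) (by norm_num)]
    simp [Finset.sum_range_succ, Sq_zero]
  have r43 : Sq 4 * Sq 3 = Sq 5 * Sq 2 := by
    rw [Sq_mul_Sq 4 3 (by norm_num) (by norm_num)]
    simp [Finset.sum_range_succ, Nat.choose, Sq_zero]
  have r44 : Sq 4 * Sq 4 = τ • (Sq 7 * Sq 1) + Sq 6 * Sq 2 := by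
    rw [Sq_mul_Sq 4 4 (by norm_num) (by norm_num)]
    simp [Finset.sum_range_succ, Sq_zero]
  have r46 : Sq 4 * Sq 6 = Sq 10 + Sq 8 * Sq 2 := by
    rw [Sq_mul_Sq 4 6 (by norm_num) (by norm_num)]
    simp [Finset.sum_range_succ, Nat.choose, Sq_zero]
  have r55 : Sq 5 * Sq 5 = Sq 9 * Sq 1 := by
    rw [Sq_mul_Sq 5 5 (by norm_num) (by norm_num)]
    simp [Finset.sum_range_succ, Sq_zero]
  have r56 : Sq 5 * Sq 6 = Sq 11 + Sq 9 * Sq 2 := by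
    rw [Sq_mul_Sq 5 6 (by norm_num) (by norm_num)]
    simp [Finset.sum_range_succ, Sq_zero]
  have r67 : Sq 6 * Sq 7 = Sq 13 + (Sq 12 * Sq 1 + Sq 10 * Sq 3) := by
    rw [Sq_mul_Sq 6 7 (by norm_num) (by norm_num)]
    simp [Finset.sum_range_succ, Nat.choose, Sq_zero, add_assoc]
  have r76 : Sq 7 * Sq 6 = Sq 11 * Sq 2 := by
    rw [Sq_mul_Sq 7 6 (by norm_num) (by norm_num)]
    simp [Finset.sum_range_succ, Nat.choose, Sq_zero]
  have r77 : Sq 7 * Sq 7 = Sq 13 * Sq 1 + Sq 11 * Sq 3 := by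
    rw [Sq_mul_Sq 7 7 (by norm_num) (by norm_num)]
    simp [Finset.sum_range_succ, Sq_zero]
  have r85 : Sq 8 * Sq 5 = Sq 9 * Sq 4 := by
    rw [Sq_mul_Sq 8 5 (by norm_num) (by norm_num)]
    simp [Finset.sum_range_succ, Nat.choose, Sq_zero]
  have r95 : Sq 9 * Sq 5 = 0 := by
    rw [Sq_mul_Sq 9 5 (by norm_num) (by norm_num)]
    simp [Finset.sum_range_succ, Nat.choose, Sq_zero]
  refine .of_generators τ h2 rfl rfl rfl r11 ?_ ?_ ?_ ?_
  · change Sq 2 * Sq 2 = τ • (Sq 1 * (Sq 2 * Sq 1))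
    rw [reassoc r12, r22]
  · change Sq 4 * Sq 1 = Sq 1 * Sq 4 + Sq 2 * (Sq 1 * Sq 2)
    rw [r14, r12, r23, h2']
  · change Sq 4 * Sq 4 = Sq 2 * (Sq 4 * Sq 2) + τ • (Sq 1 * (Sq 2 * (Sq 4 * Sq 1)))
    have h : Sq 1 * (Sq 5 * (Sq 1 * Sq 1)) = 0 := by rw [r11, mul_zero, mul_zero]
    rw [r44, reassoc r24, reassoc r24, add_mul, add_mul, mul_add, reassoc r16, smul_mul_assoc,
      smul_mul_assoc, mul_smul_comm, mul_assoc (Sq 5) (Sq 1), mul_assoc (Sq 5) (Sq 1), h, r12,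
      smul_zero, add_zero]
    have h5 : Sq 5 * Sq 3 = 0 := by
      rw [← r14, mul_assoc, r43, reassoc r15, zero_mul]
    rw [h5, smul_zero, add_zero, add_comm]
  · change (Sq 1 * Sq 2 + Sq 2 * Sq 1) * (Sq 4 * ((Sq 1 * Sq 2 + Sq 2 * Sq 1) * Sq 4)) =
      Sq 4 * ((Sq 1 * Sq 2 + Sq 2 * Sq 1) * (Sq 4 * (Sq 1 * Sq 2 + Sq 2 * Sq 1)))
    have e1 : (Sq 1 * Sq 2 + Sq 2 * Sq 1) * Sq 4 = Sq 7 + Sq 6 * Sq 1 := by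
      rw [r12, add_mul, r34, mul_assoc, r14, r25]
    have e2 : Sq 4 * (Sq 1 * Sq 2 + Sq 2 * Sq 1) = Sq 5 * Sq 2 + Sq 4 * (Sq 2 * Sq 1) := by
      rw [r12, mul_add, r43]
    rw [← mul_assoc _ (Sq 4), ← mul_assoc (Sq 4), e1, e2]
    simp only [mul_add, add_mul, mul_assoc, smul_mul_assoc, mul_smul_comm, r11, r12, r17, r23, r77,
      r95, reassoc r12, reassoc r13, reassoc r14, reassoc r15, reassoc r16, reassoc r22,
      reassoc r23, reassoc r24, reassoc r25, reassoc r46, reassoc r55, reassoc r56, reassoc r67,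
      reassoc r76, reassoc r85, mul_zero, zero_mul, smul_zero, add_zero, add_assoc, add_comm,
      add_left_comm, h2, h2']

/-! ### Ordered monomials and straightening -/

namespace HIndex

/-- The position of `h_{ij}` in the list of the generators. -/
def pos : HIndex → ℕ
  | .h10 => 0
  | .h11 => 1
  | .h12 => 2
  | .h20 => 3
  | .h21 => 4
  | .h30 => 5

theorem pos_injective : Function.Injective pos := by
  rintro (_ | _ | _ | _ | _ | _) (_ | _ | _ | _ | _ | _) h <;> first | rfl | cases h

instance : LinearOrder HIndex := LinearOrder.lift' pos pos_injective

instance : Fintype HIndex := ⟨{.h10, .h11, .h12, .h20, .h21, .h30}, by rintro (_ | _) <;> decide⟩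

/-- The May filtration of the element dual to `h_{ij}`. -/
def may : HIndex → ℕ
  | .h10 => 1
  | .h11 => 1
  | .h12 => 1
  | .h20 => 2
  | .h21 => 2
  | .h30 => 3

/-- The topological degree of the element dual to `h_{ij}`. -/
def topDeg : HIndex → ℕ
  | .h10 => 1
  | .h11 => 2
  | .h12 => 4
  | .h20 => 3
  | .h21 => 6
  | .h30 => 7

/-- The weight of the element dual to `h_{ij}`. -/
def weight : HIndex → ℕ
  | .h10 => 0
  | .h11 => 1
  | .h12 => 2
  | .h20 => 1
  | .h21 => 3
  | .h30 => 3

/-- The terms of the expansion of the product of two generators of `A(2)` in the wrong order: the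
pair `(n, u)` stands for `τⁿ` times the product of the word `u`. -/
def swapTerms : HIndex → HIndex → List (ℕ × List HIndex)
  | .h11, .h10 => [(0, [.h10, .h11]), (0, [.h20])]
  | .h12, .h10 => [(0, [.h10, .h12]), (0, [.h11, .h20])]
  | .h21, .h10 => [(0, [.h10, .h21]), (0, [.h30])]
  | .h12, .h11 => [(0, [.h11, .h12]), (0, [.h21])]
  | .h21, .h11 => [(0, [.h11, .h21]), (1, [.h10, .h30])]
  | .h20, .h12 => [(0, [.h12, .h20]), (0, [.h30])]
  | .h21, .h12 => [(0, [.h12, .h21]), (1, [.h10, .h11, .h30]), (1, [.h20, .h30])]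
  | .h10, .h10 => []
  | .h11, .h11 => [(1, [.h10, .h20])]
  | .h12, .h12 => [(0, [.h11, .h21])]
  | .h20, .h20 => []
  | .h21, .h21 => []
  | .h30, .h30 => []
  | j, i => [(0, [i, j])]

theorem swapTerms_topDeg (i j : HIndex) (hij : i ≤ j) (c : ℕ × List HIndex)
    (hc : c ∈ swapTerms j i) : (c.2.map topDeg).sum = topDeg j + topDeg i := by
  revert c; revert hij; cases j <;> cases i <;> decide

/-- Each term of the expansion has higher filtration, or it is shorter, or it is the transposed
product. -/
theorem swapTerms_may (i j : HIndex) (hij : i ≤ j) (c : ℕ × List HIndex)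
    (hc : c ∈ swapTerms j i) :
    may j + may i < (c.2.map may).sum ∨
      (may j + may i = (c.2.map may).sum ∧ c.2.length = 1) ∨ (i < j ∧ c.2 = [i, j]) := by
  revert c; revert hij; cases j <;> cases i <;> decide

end HIndex

/-- The product of a word in the elements `x i`. -/
def wordProd {ι B : Type*} [Monoid B] (x : ι → B) (u : List ι) : B := (u.map x).prod

section WordProd

variable {ι B : Type*} [Monoid B] (x : ι → B)

theorem wordProd_nil : wordProd x [] = 1 := rfl

theorem wordProd_cons (i : ι) (u : List ι) : wordProd x (i :: u) = x i * wordProd x u :=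
  List.prod_cons

theorem wordProd_append (u v : List ι) :
    wordProd x (u ++ v) = wordProd x u * wordProd x v := by
  rw [wordProd, List.map_append, List.prod_append]; rfl

theorem map_wordProd {B' F : Type*} [Monoid B'] [FunLike F B B'] [MonoidHomClass F B B'] (f : F)
    (u : List ι) : f (wordProd x u) = wordProd (fun i => f (x i)) u := by
  rw [wordProd, wordProd, map_list_prod, List.map_map]; rfl

/-- The ordered product of the elements `x i` with `i ∈ S`. -/
def monom [LinearOrder ι] (S : Finset ι) : B := wordProd x S.sort

theorem monom_eq_wordProd [LinearOrder ι] {u : List ι} (hu : u.Pairwise (· < ·)) :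
    monom x u.toFinset = wordProd x u := by
  rw [monom, (List.toFinset_sort (· ≤ ·) (hu.imp fun h => h.ne)).2 (hu.imp fun h => h.le)]

end WordProd

/-- A word that is not strictly increasing has two consecutive letters in the wrong order. -/
theorem exists_descent_of_not_pairwise_lt {ι : Type*} [LinearOrder ι] (u : List ι)
    (hu : ¬ u.Pairwise (· < ·)) : ∃ p j i q, u = p ++ j :: i :: q ∧ i ≤ j := by
  induction u with
  | nil => exact absurd List.Pairwise.nil hu
  | cons a u ih =>
    by_cases h : u.Pairwise (· < ·)
    · cases u with
      | nil => exact absurd (List.pairwise_singleton _ _) hu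
      | cons b u =>
        refine ⟨[], a, b, u, rfl, not_lt.1 fun hab => hu ?_⟩
        refine List.pairwise_cons.2 ⟨fun c hc => ?_, h⟩
        rcases List.mem_cons.1 hc with rfl | hc
        · exact hab
        · exact hab.trans ((List.pairwise_cons.1 h).1 c hc)
    · obtain ⟨p, j, i, q, rfl, hij⟩ := ih h
      exact ⟨a :: p, j, i, q, rfl, hij⟩

/-- A number attached to a word that decreases when two consecutive letters in the wrong order are
interchanged. -/
def disorder : List HIndex → ℕ
  | [] => 0
  | i :: u => i.pos * (u.length + 1) + disorder u

theorem disorder_swap (p q : List HIndex) {i j : HIndex} (hij : i < j) :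
    disorder (p ++ i :: j :: q) < disorder (p ++ j :: i :: q) := by
  have h : i.pos < j.pos := hij
  induction p with
  | nil => simp only [List.nil_append, disorder, List.length_cons]; nlinarith
  | cons a p ih => simp only [List.cons_append, disorder, List.length_append,
      List.length_cons] at ih ⊢; omega

/-- To prove something for all words in the generators of `A(2)`, it suffices to prove it for
strictly increasing words and to show that it is inherited under straightening. The induction is on
the amount by which the filtration falls short of the topological degree, then on the length, then
on the disorder of the word. -/
theorem word_straightening {P : List HIndex → Prop}
    (hs : ∀ u : List HIndex, u.Pairwise (· < ·) → P u)
    (hr : ∀ p j i q, i ≤ j → (∀ c ∈ HIndex.swapTerms j i, P (p ++ c.2 ++ q)) →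
      P (p ++ j :: i :: q)) (u : List HIndex) : P u := by
  let μ : List HIndex → ℕ ×ₗ ℕ ×ₗ ℕ := fun u =>
    toLex ((u.map HIndex.topDeg).sum - (u.map HIndex.may).sum, toLex (u.length, disorder u))
  have hle : ∀ u : List HIndex, (u.map HIndex.may).sum ≤ (u.map HIndex.topDeg).sum := by
    intro u
    exact List.sum_le_sum fun i _ => by cases i <;> decide
  induction u using (InvImage.wf μ wellFounded_lt).induction with
  | _ u ih =>
    by_cases hu : u.Pairwise (· < ·)
    · exact hs u hu
    · obtain ⟨p, j, i, q, rfl, hij⟩ := exists_descent_of_not_pairwise_lt u hu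
      refine hr p j i q hij fun c hc => ih _ ?_
      have ht := HIndex.swapTerms_topDeg i j hij c hc
      have h1 := hle (p ++ c.2 ++ q)
      change μ _ < μ _
      rw [Prod.Lex.lt_iff, Prod.Lex.lt_iff]
      simp only [μ, ofLex_toLex, List.map_append, List.sum_append, List.map_cons, List.sum_cons,
        List.length_append, List.length_cons] at h1 ⊢
      rcases HIndex.swapTerms_may i j hij c hc with h | ⟨h, hl⟩ | ⟨h, hc'⟩
      · left; omega
      · right; exact ⟨by omega, Or.inl (by omega)⟩
      · right
        rw [hc']
        refine ⟨by simp only [List.map_cons, List.sum_cons, List.map_nil, List.sum_nil]; omega,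
          Or.inr ⟨by simp only [List.length_cons, List.length_nil]; omega, ?_⟩⟩
        simpa using disorder_swap p q h

/-! ### The powers of the augmentation ideal of `A(2)` -/

theorem sqGen_mem (i : HIndex) : sqGen i ∈ A2 := by
  have h1 : Sq 1 ∈ A2 := Algebra.subset_adjoin (by simp)
  have h2 : Sq 2 ∈ A2 := Algebra.subset_adjoin (by simp)
  have h4 : Sq 4 ∈ A2 := Algebra.subset_adjoin (by simp)
  have h20 := add_mem (mul_mem h1 h2) (mul_mem h2 h1)
  cases i
  exacts [h1, h2, h4, h20, add_mem (mul_mem h2 h4) (mul_mem h4 h2),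
    add_mem (mul_mem h20 h4) (mul_mem h4 h20)]

/-- The elements `sqGen i`, as elements of `A(2)`. -/
def a2Gen (i : HIndex) : A2 := ⟨sqGen i, sqGen_mem i⟩

theorem a2Gen_mul (i j : HIndex) (hij : i ≤ j) : a2Gen j * a2Gen i =
    ((HIndex.swapTerms j i).map fun c => τ ^ c.1 • wordProd a2Gen c.2).sum := by
  have h := isPBWFamily_sqGen
  refine Subtype.ext ?_
  change sqGen j * sqGen i = A2.val _
  rw [map_list_sum, List.map_map]
  revert hij
  cases j <;> cases i <;> intro hij <;> first
    | exact absurd hij (by decide)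
    | simp [HIndex.swapTerms, wordProd, a2Gen, h.ba, h.ca, h.da, h.ea, h.fa, h.cb, h.db, h.eb, h.fb,
        h.dc, h.ec, h.fc, h.ed, h.fd, h.fe, h.aa, h.bb, h.cc, h.dd, h.ee, h.ff]

/-- The May filtration of the ordered monomial of `S`. -/
def mayDeg (S : Finset HIndex) : ℕ := ∑ i ∈ S, i.may

theorem mayDeg_eq_sum {u : List HIndex} (hu : u.Nodup) :
    mayDeg u.toFinset = (u.map HIndex.may).sum := by
  rw [mayDeg, List.sum_toFinset _ hu]

/-- The span of the ordered monomials of filtration at least `n`. -/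
def monomSpan (n : ℕ) : Submodule M2 A2 :=
  Submodule.span M2 {x | ∃ S, n ≤ mayDeg S ∧ monom a2Gen S = x}

theorem monomSpan_antitone : Antitone monomSpan := fun _ _ h =>
  Submodule.span_mono fun _ ⟨S, hS, e⟩ => ⟨S, h.trans hS, e⟩

theorem wordProd_mem_monomSpan (u : List HIndex) :
    wordProd a2Gen u ∈ monomSpan (u.map HIndex.may).sum := by
  induction u using word_straightening with
  | hs u hu =>
    refine Submodule.subset_span ⟨u.toFinset, ?_, monom_eq_wordProd _ hu⟩
    rw [mayDeg_eq_sum (hu.imp fun h => h.ne)]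
  | hr p j i q hij ih =>
    rw [wordProd_append, wordProd_cons, wordProd_cons, ← mul_assoc (a2Gen j), a2Gen_mul i j hij,
      ← List.sum_map_mul_right, ← List.sum_map_mul_left]
    refine list_sum_mem fun x hx => ?_
    simp only [List.mem_map] at hx
    obtain ⟨c, hc, rfl⟩ := hx
    rw [smul_mul_assoc, mul_smul_comm]
    refine Submodule.smul_mem _ _ ?_
    rw [← mul_assoc, ← wordProd_append, ← wordProd_append]
    refine monomSpan_antitone ?_ (ih c hc)
    have := HIndex.swapTerms_may i j hij c hc
    simp only [List.map_append, List.sum_append, List.map_cons, List.sum_cons]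
    rcases this with h | ⟨h, -⟩ | ⟨-, h⟩
    · omega
    · omega
    · rw [h]; simp only [List.map_cons, List.sum_cons, List.map_nil, List.sum_nil]; omega

theorem sum_map_may_sort (S : Finset HIndex) : (S.sort.map HIndex.may).sum = mayDeg S := by
  rw [← mayDeg_eq_sum (Finset.sort_nodup _ _), Finset.sort_toFinset]

theorem mul_mem_monomSpan {m n : ℕ} {x y : A2} (hx : x ∈ monomSpan m) (hy : y ∈ monomSpan n) :
    x * y ∈ monomSpan (m + n) := by
  have h := Submodule.mul_mem_mul hx hy
  rw [monomSpan, monomSpan, Submodule.span_mul_span] at h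
  refine Submodule.span_le.2 ?_ h
  rintro _ ⟨_, ⟨S, hS, rfl⟩, _, ⟨T, hT, rfl⟩, rfl⟩
  have := wordProd_mem_monomSpan (S.sort ++ T.sort)
  rw [wordProd_append, List.map_append, List.sum_append, sum_map_may_sort, sum_map_may_sort] at this
  exact monomSpan_antitone (add_le_add hS hT) this

theorem a2Gen_mem_monomSpan (i : HIndex) : a2Gen i ∈ monomSpan i.may := by
  have := wordProd_mem_monomSpan [i]
  simpa [wordProd] using this

theorem mem_monomSpan_zero (x : A2) : x ∈ monomSpan 0 := by
  obtain ⟨x, hx⟩ := x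
  have h1 : (1 : A2) ∈ monomSpan 0 := wordProd_mem_monomSpan []
  induction hx using Algebra.adjoin_induction with
  | mem x hx =>
    have : ∀ i, (⟨sqGen i, sqGen_mem i⟩ : A2) ∈ monomSpan 0 := fun i =>
      monomSpan_antitone (Nat.zero_le _) (a2Gen_mem_monomSpan i)
    rcases hx with rfl | rfl | rfl
    exacts [this .h10, this .h11, this .h12]
  | algebraMap r =>
    have : (⟨algebraMap M2 Steenrod r, A2.algebraMap_mem r⟩ : A2) = r • 1 :=
      Subtype.ext (Algebra.algebraMap_eq_smul_one r)
    rw [this]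
    exact Submodule.smul_mem _ _ h1
  | add x y hx hy h h' => exact add_mem h h'
  | mul x y hx hy h h' =>
    have := mul_mem_monomSpan h h'
    rw [add_zero] at this
    exact this

theorem coe_a2Gen (i : HIndex) : (a2Gen i : Steenrod) = sqGen i := rfl

theorem a2Gen_h20 : a2Gen .h20 = a2Gen .h10 * a2Gen .h11 + a2Gen .h11 * a2Gen .h10 :=
  Subtype.ext rfl

theorem a2Gen_h21 : a2Gen .h21 = a2Gen .h11 * a2Gen .h12 + a2Gen .h12 * a2Gen .h11 :=
  Subtype.ext rfl

theorem a2Gen_h30 : a2Gen .h30 = a2Gen .h20 * a2Gen .h12 + a2Gen .h12 * a2Gen .h20 :=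
  Subtype.ext rfl

theorem a2Gen_mem_pow (i : HIndex) : a2Gen i ∈ I2 ^ i.may := by
  have hg : ∀ i, sqGen i ∈ ({Sq 1, Sq 2, Sq 4} : Set Steenrod) → a2Gen i ∈ I2 := fun i hi => by
    rw [I2, TwoSidedIdeal.mem_asIdeal]
    refine TwoSidedIdeal.subset_span ?_
    rw [Set.mem_ofPred_eq, coe_a2Gen]
    exact hi
  have h0 : a2Gen .h10 ∈ I2 := hg _ (Or.inl rfl)
  have h1 : a2Gen .h11 ∈ I2 := hg _ (Or.inr (Or.inl rfl))
  have h2 : a2Gen .h12 ∈ I2 := hg _ (Or.inr (Or.inr rfl))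
  have hmul : ∀ m n {x y : A2}, x ∈ I2 ^ m → y ∈ I2 ^ n → x * y ∈ I2 ^ (m + n) :=
    fun m n x y hx hy => by rw [Ideal.IsTwoSided.pow_add]; exact Ideal.mul_mem_mul hx hy
  rw [← Submodule.pow_one I2] at h0 h1 h2
  have h20 : a2Gen .h20 ∈ I2 ^ 2 := by
    rw [a2Gen_h20]; exact add_mem (hmul 1 1 h0 h1) (hmul 1 1 h1 h0)
  have h21 : a2Gen .h21 ∈ I2 ^ 2 := by
    rw [a2Gen_h21]; exact add_mem (hmul 1 1 h1 h2) (hmul 1 1 h2 h1)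
  have h30 : a2Gen .h30 ∈ I2 ^ 3 := by
    rw [a2Gen_h30]; exact add_mem (hmul 2 1 h20 h2) (hmul 1 2 h2 h20)
  cases i
  exacts [h0, h1, h2, h20, h21, h30]

theorem wordProd_mem_pow (u : List HIndex) :
    wordProd a2Gen u ∈ I2 ^ (u.map HIndex.may).sum := by
  induction u with
  | nil => exact mem_pow_zero _ _
  | cons i u ih =>
    rw [wordProd_cons, List.map_cons, List.sum_cons, Ideal.IsTwoSided.pow_add]
    exact Ideal.mul_mem_mul (a2Gen_mem_pow i) ih

theorem monom_mem_pow (S : Finset HIndex) : monom a2Gen S ∈ I2 ^ mayDeg S := by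
  rw [← sum_map_may_sort]; exact wordProd_mem_pow _

/-- The powers of the ideal `I` of `A(2)` are spanned by ordered monomials. -/
theorem mem_pow_iff (n : ℕ) (x : A2) : x ∈ I2 ^ n ↔ x ∈ monomSpan n := by
  constructor
  · have hI : ∀ y ∈ I2, y ∈ monomSpan 1 := by
      intro y hy
      have hl : ∀ {x y : A2}, y ∈ monomSpan 1 → x * y ∈ monomSpan 1 := fun {x y} hy => by
        simpa only [zero_add] using mul_mem_monomSpan (mem_monomSpan_zero x) hy
      have hr : ∀ {x y : A2}, x ∈ monomSpan 1 → x * y ∈ monomSpan 1 := fun {x y} hx => by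
        simpa only [add_zero] using mul_mem_monomSpan hx (mem_monomSpan_zero y)
      let J : TwoSidedIdeal A2 := TwoSidedIdeal.mk' (monomSpan 1 : Set A2)
        (monomSpan 1).zero_mem (monomSpan 1).add_mem (monomSpan 1).neg_mem hl hr
      have h : TwoSidedIdeal.span
          {x : A2 | (x : Steenrod) ∈ ({Sq 1, Sq 2, Sq 4} : Set Steenrod)} ≤ J := by
        rw [TwoSidedIdeal.span_le]
        rintro ⟨z, hz⟩ hz'
        refine (TwoSidedIdeal.mem_mk' _ _ _ _ _ _ _).2 ?_
        rcases hz' with rfl | rfl | rfl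
        exacts [a2Gen_mem_monomSpan .h10, a2Gen_mem_monomSpan .h11, a2Gen_mem_monomSpan .h12]
      exact (TwoSidedIdeal.mem_mk' _ _ _ _ _ _ _).1 (h (TwoSidedIdeal.mem_asIdeal.1 hy))
    induction n generalizing x with
    | zero => exact fun _ => mem_monomSpan_zero x
    | succ n ih =>
      intro hx
      rw [Ideal.IsTwoSided.pow_add, Submodule.pow_one] at hx
      refine Submodule.smul_induction_on hx (fun r hr y hy => ?_) fun y z hy hz => add_mem hy hz
      exact mul_mem_monomSpan (ih r hr) (hI y hy)
  · intro hx
    refine Submodule.span_induction ?_ (zero_mem _) (fun _ _ _ _ h h' => add_mem h h')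
      (fun r y _ h => (I2 ^ n).smul_of_tower_mem r h) hx
    rintro _ ⟨S, hS, rfl⟩
    exact Ideal.pow_le_pow_right hS (monom_mem_pow S)

/-! ### Linear independence of the ordered monomials -/

/-- The action of the elements `sqGen i` on `𝔽₂[ξ₁, ξ₂, ξ₃]`. -/
def xiGen : HIndex → Module.End (ZMod 2) XiPoly
  | .h10 => xiSq 1
  | .h11 => xiSq 2
  | .h12 => xiSq 4
  | .h20 => xiQ1
  | .h21 => xiP21
  | .h30 => xiQ2

theorem natCast_xiPoly (n : ℕ) : (n : XiPoly) = ((n % 2 : ℕ) : XiPoly) := by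
  have h2 : (2 : XiPoly) = 0 := CharTwo.two_eq_zero
  conv_lhs => rw [← Nat.div_add_mod n 2]
  rw [Nat.cast_add, Nat.cast_mul, Nat.cast_ofNat, h2, zero_mul, zero_add]

theorem xiQ1_xi2_pow_mul (q p : ℕ) :
    xiQ1 (xi2 ^ q * xi1 ^ p) = (q : XiPoly) * (xi2 ^ (q - 1) * xi1 ^ p) := by
  rw [xiQ1_apply, divSq_xi2_pow_mul, Nat.choose_one_right]

theorem xiP21_xi2_pow_mul (q p : ℕ) :
    xiP21 (xi2 ^ q * xi1 ^ p) = ((q.choose 2 : ℕ) : XiPoly) * (xi2 ^ (q - 2) * xi1 ^ p) := by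
  rw [xiP21_apply, divSq_xi2_pow_mul]

theorem map_natCast_mul (f : Module.End (ZMod 2) XiPoly) (n : ℕ) (x : XiPoly) :
    f ((n : XiPoly) * x) = (n : XiPoly) * f x := by
  rw [← nsmul_eq_mul, map_nsmul, nsmul_eq_mul]

theorem xiQ2_apply (f : XiPoly) : xiQ2 f = xiSq 1 (xiP21 f) + xiP21 (xiSq 1 f) := rfl

theorem xiQ2_xi2_pow_mul {q : ℕ} (hq : q ≤ 3) : xiQ2 (xi2 ^ q * xi1 ^ 7) = 0 := by
  have hz : ∀ x : XiPoly, x + x = 0 := CharTwo.add_self_eq_zero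
  rw [xiQ2_apply]
  simp only [xiP21_xi2_pow_mul, xiSq_one_xi2_pow_mul, map_add, map_natCast_mul]
  rw [natCast_xiPoly 7, natCast_xiPoly q, natCast_xiPoly (q.choose 2),
    natCast_xiPoly ((q - 1).choose 2), natCast_xiPoly (q - 2)]
  interval_cases q <;> simp [Nat.choose, hz]

theorem xiQ2_xi3_mul {q : ℕ} (hq : q ≤ 3) :
    xiQ2 (xi3 * (xi2 ^ q * xi1 ^ 7)) = xi2 ^ q * xi1 ^ 7 := by
  have hz : ∀ x : XiPoly, x + x = 0 := CharTwo.add_self_eq_zero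
  have hQ := xiQ2_xi2_pow_mul hq
  have h4 : xiSq 1 (xi1 ^ 4) = 0 := by
    rw [xiSq_xi1_pow, natCast_xiPoly]; simp
  have hD : xiSq 1 (xiQ1 (xi2 ^ q * xi1 ^ 7)) = xiQ1 (xiSq 1 (xi2 ^ q * xi1 ^ 7)) := by
    simp only [xiQ1_xi2_pow_mul, xiSq_one_xi2_pow_mul, map_add, map_natCast_mul]
    ring
  have hE : xiP21 (xi2 ^ 2 * (xi2 ^ q * xi1 ^ 7)) =
      xi2 ^ 2 * xiP21 (xi2 ^ q * xi1 ^ 7) + xi2 ^ q * xi1 ^ 7 := by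
    rw [← mul_assoc, ← pow_add, xiP21_xi2_pow_mul, xiP21_xi2_pow_mul, natCast_xiPoly,
      natCast_xiPoly (q.choose 2)]
    interval_cases q <;> simp [Nat.choose, hz, ← mul_assoc, ← pow_succ]
  rw [xiQ2_apply] at hQ ⊢
  rw [xiP21_xi3_mul, map_add, xiSq_one_mul_apply, xiSq_one_mul_apply, xiSq_one_mul_apply, h4,
    xiSq_one_xi3, map_add, xiP21_xi3_mul, hD, hE]
  linear_combination xi3 * hQ + hz (xi2 ^ 2 * xiP21 (xi2 ^ q * xi1 ^ 7)) +
    hz (xi1 ^ 4 * xiQ1 (xiSq 1 (xi2 ^ q * xi1 ^ 7)))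

/-- The operator `f` if `b` holds, and the identity otherwise. -/
def optOp (f : Module.End (ZMod 2) XiPoly) (b : Bool) : Module.End (ZMod 2) XiPoly :=
  if b then f else 1

/-- The element `ξ₂^q ξ₁⁷`. -/
def xiVec (q : ℕ) : XiPoly := xi2 ^ q * xi1 ^ 7

theorem xiQ1_xiVec {q : ℕ} (hq : q ≤ 3) :
    xiQ1 (xiVec q) = if q % 2 = 1 then xiVec (q - 1) else 0 := by
  rw [xiVec, xiQ1_xi2_pow_mul, natCast_xiPoly]
  interval_cases q <;> simp [xiVec]

theorem xiP21_xiVec {q : ℕ} (hq : q ≤ 3) :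
    xiP21 (xiVec q) = if 2 ≤ q then xiVec (q - 2) else 0 := by
  rw [xiVec, xiP21_xi2_pow_mul, natCast_xiPoly]
  interval_cases q <;> simp [xiVec, Nat.choose]

/-- The vectors on which the products of the last three operators are triangular. -/
def testVec (l m n : Bool) : XiPoly :=
  if n then xi3 * xiVec (l.toNat + 2 * m.toNat) else xiVec (l.toNat + 2 * m.toNat)

/-- The products of the last three operators, evaluated at the test vectors, form a unitriangular
matrix times `ξ₁⁷`. -/
theorem optOp_testVec {l m n l' m' n' : Bool}
    (h : l.toNat + 2 * m.toNat + 4 * n.toNat ≤ l'.toNat + 2 * m'.toNat + 4 * n'.toNat) :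
    optOp xiQ1 l' (optOp xiP21 m' (optOp xiQ2 n' (testVec l m n))) =
      if l = l' ∧ m = m' ∧ n = n' then xiVec 0 else 0 := by
  have hw : ∀ q ≤ 3, xiQ2 (xi3 * xiVec q) = xiVec q := fun q hq => xiQ2_xi3_mul hq
  have hv : ∀ q ≤ 3, xiQ2 (xiVec q) = 0 := fun q hq => xiQ2_xi2_pow_mul hq
  cases l <;> cases m <;> cases n <;> cases l' <;> cases m' <;> cases n' <;>
    first
    | exact absurd h (by decide)
    | simp [optOp, testVec, hw, hv, xiQ1_xiVec, xiP21_xiVec]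

/-- The products of the first three operators are distinguished by their values at `ξ₁⁷`, because
all binomial coefficients with upper entry `7` are odd. -/
theorem optOp_xi1_pow (i j k : Bool) :
    optOp (xiSq 1) i (optOp (xiSq 2) j (optOp (xiSq 4) k (xiVec 0))) =
      xi1 ^ (7 - (i.toNat + 2 * j.toNat + 4 * k.toNat)) := by
  have h : ∀ n p : ℕ, p.choose n % 2 = 1 → xiSq n (xi1 ^ p) = xi1 ^ (p - n) := by
    intro n p h
    rw [xiSq_xi1_pow, natCast_xiPoly, h, Nat.cast_one, one_mul]
  have h4 : xiSq 4 (xi1 ^ 7) = xi1 ^ 3 := h 4 7 (by decide)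
  have h2 : xiSq 2 (xi1 ^ 7) = xi1 ^ 5 := h 2 7 (by decide)
  have h2' : xiSq 2 (xi1 ^ 3) = xi1 ^ 1 := h 2 3 (by decide)
  have h1 : xiSq 1 (xi1 ^ 7) = xi1 ^ 6 := h 1 7 (by decide)
  have h1' : xiSq 1 (xi1 ^ 5) = xi1 ^ 4 := h 1 5 (by decide)
  have h1'' : xiSq 1 (xi1 ^ 3) = xi1 ^ 2 := h 1 3 (by decide)
  have h1''' : xiSq 1 (xi1 ^ 1) = xi1 ^ 0 := h 1 1 (by decide)
  have h0 : xiVec 0 = xi1 ^ 7 := by rw [xiVec, pow_zero, one_mul]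
  cases i <;> cases j <;> cases k <;> simp only [h0, optOp, if_true, Bool.false_eq_true, if_false,
    Module.End.one_apply, h4, h2, h2', h1, h1', h1'', h1'''] <;> rfl

/-- The value of the operator `monom xiGen T`. -/
theorem monom_xiGen_apply (T : Finset HIndex) (v : XiPoly) : monom xiGen T v =
    optOp (xiSq 1) (.h10 ∈ T) (optOp (xiSq 2) (.h11 ∈ T) (optOp (xiSq 4) (.h12 ∈ T)
      (optOp xiQ1 (.h20 ∈ T) (optOp xiP21 (.h21 ∈ T) (optOp xiQ2 (.h30 ∈ T) v))))) := by
  have hp : ([.h10, .h11, .h12, .h20, .h21, .h30] : List HIndex).Pairwise (· < ·) := by decide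
  have hT : T = (([.h10, .h11, .h12, .h20, .h21, .h30] : List HIndex).filter
      (fun i => i ∈ T)).toFinset := by
    ext i
    cases i <;> simp
  have hf : ∀ (i : HIndex) (u : List HIndex) (w : XiPoly),
      wordProd xiGen ((i :: u).filter fun i => i ∈ T) w =
        optOp (xiGen i) (i ∈ T) (wordProd xiGen (u.filter fun i => i ∈ T) w) := by
    intro i u w
    by_cases h : i ∈ T
    · rw [List.filter_cons_of_pos (by simpa using h), wordProd_cons, optOp,
        if_pos (by simpa using h)]
      rfl
    · rw [List.filter_cons_of_neg (by simpa using h), optOp, if_neg (by simpa using h)]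
      rfl
  have h := congrArg (fun S => monom xiGen S v) hT
  refine h.trans ?_
  rw [monom_eq_wordProd _ (hp.filter _)]
  simp only [hf]
  rfl

/-- The coefficient of `ξ₁ᵖ`. -/
def xi1Coeff (p : ℕ) : XiPoly →ₗ[ZMod 2] ZMod 2 :=
  MvPolynomial.lcoeff (ZMod 2) (Finsupp.single (0 : Fin 3) p)

theorem xi1Coeff_pow (p q : ℕ) : xi1Coeff p (xi1 ^ q) = if q = p then 1 else 0 := by
  have h := MvPolynomial.coeff_X_pow (R := ZMod 2) (0 : Fin 3) (Finsupp.single 0 p) q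
  refine h.trans ?_
  simp only [(Finsupp.single_injective (0 : Fin 3)).eq_iff]

theorem linearIndependent_monom_xiGen :
    LinearIndependent (ZMod 2) (monom xiGen : Finset HIndex → Module.End (ZMod 2) XiPoly) := by
  rw [Fintype.linearIndependent_iff]
  intro c hc
  let code : Finset HIndex → ℕ := fun S => (decide (HIndex.h20 ∈ S)).toNat +
    2 * (decide (HIndex.h21 ∈ S)).toNat + 4 * (decide (HIndex.h30 ∈ S)).toNat
  let deg : Finset HIndex → ℕ := fun S => (decide (HIndex.h10 ∈ S)).toNat +
    2 * (decide (HIndex.h11 ∈ S)).toNat + 4 * (decide (HIndex.h12 ∈ S)).toNat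
  suffices h : ∀ n S, code S = n → c S = 0 from fun S => h _ S rfl
  intro n
  induction n using Nat.strong_induction_on with
  | _ n ih =>
    rintro S rfl
    have h := congrArg (fun f : Module.End (ZMod 2) XiPoly => xi1Coeff (7 - deg S)
      (f (testVec (.h20 ∈ S) (.h21 ∈ S) (.h30 ∈ S)))) hc
    simp only [LinearMap.sum_apply, map_sum, LinearMap.smul_apply, map_smul, LinearMap.zero_apply,
      map_zero, smul_eq_mul] at h
    rw [Finset.sum_eq_single S] at h
    · rw [monom_xiGen_apply, optOp_testVec le_rfl, if_pos ⟨rfl, rfl, rfl⟩, optOp_xi1_pow,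
        xi1Coeff_pow, if_pos rfl, mul_one] at h
      exact h
    · intro T _ hTS
      rcases lt_or_ge (code T) (code S) with hlt | hle
      · rw [ih _ hlt T rfl, zero_mul]
      · rw [monom_xiGen_apply, optOp_testVec hle]
        split_ifs with hST
        · rw [optOp_xi1_pow, xi1Coeff_pow, if_neg, mul_zero]
          intro hdeg
          refine hTS ?_
          have hd : (decide (HIndex.h10 ∈ T) = decide (HIndex.h10 ∈ S)) ∧
              (decide (HIndex.h11 ∈ T) = decide (HIndex.h11 ∈ S)) ∧
              (decide (HIndex.h12 ∈ T) = decide (HIndex.h12 ∈ S)) := by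
            have key : ∀ i j k i' j' k' : Bool,
                7 - (i.toNat + 2 * j.toNat + 4 * k.toNat) =
                  7 - (i'.toNat + 2 * j'.toNat + 4 * k'.toNat) → i = i' ∧ j = j' ∧ k = k' := by
              decide
            exact key _ _ _ _ _ _ hdeg
          simp only [decide_eq_decide] at hd hST
          ext i
          cases i
          exacts [hd.1, hd.2.1, hd.2.2, hST.1.symm, hST.2.1.symm, hST.2.2.symm]
        · simp
    · exact fun h => absurd (Finset.mem_univ S) h

open scoped TensorProduct

/-- The algebra `𝕄₂[u] ⊗ End(𝔽₂[ξ₁, ξ₂, ξ₃])`, in which the powers of `τ` and of `u` record the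
weight and the topological degree. -/
abbrev ModelAlg : Type := M2[X] ⊗[ZMod 2] Module.End (ZMod 2) XiPoly

/-- The operator `f`, placed in topological degree `t` and weight `w`. -/
def modelOp (t w : ℕ) (f : Module.End (ZMod 2) XiPoly) : ModelAlg := (C (τ ^ w) * X ^ t) ⊗ₜ f

theorem modelOp_mul (t w t' w' : ℕ) (f g : Module.End (ZMod 2) XiPoly) :
    modelOp t w f * modelOp t' w' g = modelOp (t + t') (w + w') (f * g) := by
  have h : (C (τ ^ (w + w')) * X ^ (t + t') : M2[X]) =
      (C (τ ^ w) * X ^ t) * (C (τ ^ w') * X ^ t') := by rw [pow_add, pow_add, C_mul]; ring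
  refine (Algebra.TensorProduct.tmul_mul_tmul _ _ f g).trans ?_
  rw [← h]; rfl

theorem modelOp_add (t w : ℕ) (f g : Module.End (ZMod 2) XiPoly) :
    modelOp t w (f + g) = modelOp t w f + modelOp t w g := TensorProduct.tmul_add _ _ _

theorem tau_pow_smul_modelOp (j t w : ℕ) (f : Module.End (ZMod 2) XiPoly) :
    τ ^ j • modelOp t w f = modelOp t (j + w) f := by
  rw [modelOp, TensorProduct.smul_tmul', modelOp, smul_eq_C_mul, ← mul_assoc, ← C_mul, pow_add]

theorem xiSq_zero : xiSq 0 = 1 := by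
  refine LinearMap.ext fun f => ?_
  have h : (constantCoeff.comp totalSq.toRingHom) = RingHom.id XiPoly := by
    refine xi_ringHom_ext ?_ ?_ ?_ <;> simp [totalSq, xiLift_xi1, xiLift_xi2, xiLift_xi3]
  exact DFunLike.congr_fun h f

/-- The action of the motivic Steenrod algebra on `𝔽₂[ξ₁, ξ₂, ξ₃]`, recording degrees. -/
def model : Steenrod →ₐ[M2] ModelAlg :=
  RingQuot.liftAlgHom M2 ⟨FreeAlgebra.lift M2 fun n : ℕ+ => modelOp n (n / 2) (xiSq n), by
    have key : ∀ n : ℕ, FreeAlgebra.lift M2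
        (fun n : ℕ+ => modelOp n (n / 2) (xiSq n)) (freeSq n) = modelOp n (n / 2) (xiSq n) := by
      intro n
      rw [freeSq]
      split_ifs with h
      · rw [FreeAlgebra.lift_ι_apply]; rfl
      · obtain rfl : n = 0 := by omega
        rw [map_one, xiSq_zero, modelOp]
        simp [Algebra.TensorProduct.one_def]
    rintro _ _ ⟨a, b, ha, hab⟩
    rw [map_mul, key, key, modelOp_mul, xiSq_adem a b hab, map_sum]
    have hs : ∀ (s : Finset ℕ) (f : ℕ → Module.End (ZMod 2) XiPoly) (t w : ℕ),
        modelOp t w (∑ c ∈ s, f c) = ∑ c ∈ s, modelOp t w (f c) := fun s f t w =>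
      TensorProduct.tmul_sum _ _ _
    rw [hs]
    refine Finset.sum_congr rfl fun c hc => ?_
    have hc' := Finset.mem_range.1 hc
    rw [map_smul, map_mul, key, key, modelOp_mul, Nat.cast_smul_eq_nsmul, ← nsmul_eq_mul,
      smul_assoc, tau_pow_smul_modelOp, show a + b - c + c = a + b by omega]
    -- The truncated subtraction in the exponent of `τ` matters only if `a`, `b` are odd and `c` is
    -- even, and then the binomial coefficient is even.
    by_cases hle : (a + b - c) / 2 + c / 2 ≤ a / 2 + b / 2
    · rw [Nat.sub_add_cancel hle, modelOp, modelOp, TensorProduct.tmul_smul]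
    · have h2 : (b - 1 - c).choose (a - 2 * c) % 2 = 0 := by
        have h1 : (b - 1 - c) % 2 = 0 ∧ (a - 2 * c) % 2 = 1 := by omega
        have := Choose.choose_modEq_choose_mod_mul_choose_div_nat (n := b - 1 - c)
          (k := a - 2 * c) (p := 2)
        rw [h1.1, h1.2] at this
        simpa [Nat.ModEq] using this
      obtain ⟨m, hm⟩ := Nat.dvd_of_mod_eq_zero h2
      have hz : ∀ x : ModelAlg, (2 * m) • x = 0 := fun x => by
        have : (2 : ZMod 2) = 0 := rfl
        rw [mul_comm, mul_smul, two_nsmul, ← two_smul (ZMod 2) x, this, zero_smul, smul_zero]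
      rw [hm, hz, modelOp, TensorProduct.tmul_smul, hz]⟩

theorem model_Sq (n : ℕ) : model (Sq n) = modelOp n (n / 2) (xiSq n) := by
  refine (RingQuot.liftAlgHom_mkAlgHom_apply M2 _ _ (freeSq n)).trans ?_
  rw [freeSq]
  split_ifs with h
  · rw [FreeAlgebra.lift_ι_apply]; rfl
  · obtain rfl : n = 0 := by omega
    rw [map_one, xiSq_zero, modelOp]
    simp [Algebra.TensorProduct.one_def]

theorem model_sqGen (i : HIndex) : model (sqGen i) = modelOp i.topDeg i.weight (xiGen i) := by
  have h0 := model_Sq 1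
  have h1 := model_Sq 2
  have h2 := model_Sq 4
  have h21 : model (sqGen .h21) = modelOp 6 3 xiP21 := by
    rw [sqGen, map_add, map_mul, map_mul, h1, h2, modelOp_mul, modelOp_mul, ← modelOp_add]; rfl
  cases i
  · exact h0
  · exact h1
  · exact h2
  · rw [sqGen, map_add, map_mul, map_mul, h0, h1, modelOp_mul, modelOp_mul, ← modelOp_add]; rfl
  · exact h21
  · have h : sqGen .h30 = sqGen .h10 * sqGen .h21 + sqGen .h21 * sqGen .h10 := by
      rw [isPBWFamily_sqGen.ea, ← add_assoc, steenrod_add_self, zero_add]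
    rw [h, map_add, map_mul, map_mul, h21, sqGen, h0, modelOp_mul, modelOp_mul, ← modelOp_add]; rfl

/-- The topological degree of the ordered monomial of `S`. -/
def topDegree (S : Finset HIndex) : ℕ := ∑ i ∈ S, i.topDeg

/-- The weight of the ordered monomial of `S`. -/
def weightDegree (S : Finset HIndex) : ℕ := ∑ i ∈ S, i.weight

theorem sum_map_sort {ι : Type*} [LinearOrder ι] (f : ι → ℕ) (S : Finset ι) :
    (S.sort.map f).sum = ∑ i ∈ S, f i := by
  rw [← List.sum_toFinset _ (Finset.sort_nodup _ _), Finset.sort_toFinset]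

theorem model_monom (S : Finset HIndex) :
    model (monom a2Gen S : A2) = modelOp (topDegree S) (weightDegree S) (monom xiGen S) := by
  have h : ∀ u : List HIndex, model (wordProd sqGen u) =
      modelOp (u.map HIndex.topDeg).sum (u.map HIndex.weight).sum (wordProd xiGen u) := by
    intro u
    induction u with
    | nil =>
      rw [wordProd_nil, map_one, wordProd_nil, modelOp]
      simp [Algebra.TensorProduct.one_def]
    | cons i u ih =>
      rw [wordProd_cons, map_mul, ih, model_sqGen, modelOp_mul, wordProd_cons]; rfl
  have h1 : ((monom a2Gen S : A2) : Steenrod) = wordProd sqGen S.sort :=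
    map_wordProd a2Gen A2.val (S.sort (· ≤ ·))
  rw [h1, h, sum_map_sort, sum_map_sort]; rfl

/-- The coefficients, in `𝕄₂[u]`, of an operator in the model at the ordered monomials. -/
theorem exists_modelCoord (S : Finset HIndex) : ∃ φ : ModelAlg →+ M2[X],
    (∀ (p : M2[X]) T, φ (p ⊗ₜ monom xiGen T) = if T = S then p else 0) ∧
    ∀ (p : M2[X]) f, φ (p ⊗ₜ f) = 0 ∨ φ (p ⊗ₜ f) = p := by
  have li := linearIndependent_monom_xiGen
  let c : (Finset HIndex →₀ ZMod 2) →ₗ[ZMod 2] ZMod 2 := Finsupp.lapply S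
  obtain ⟨l, hl'⟩ := LinearMap.exists_extend (c.comp li.repr)
  have hl : ∀ T, l (monom xiGen T) = if T = S then 1 else 0 := by
    intro T
    have h := DFunLike.congr_fun hl' (⟨monom xiGen T, Submodule.subset_span ⟨T, rfl⟩⟩ :
      Submodule.span (ZMod 2) (Set.range (monom xiGen)))
    refine h.trans ?_
    change li.repr _ S = _
    rw [li.repr_eq_single T _ rfl, Finsupp.single_apply]
  let φ := (TensorProduct.rid (ZMod 2) M2[X]).toLinearMap ∘ₗ LinearMap.lTensor M2[X] l
  have hφ : ∀ p f, φ (p ⊗ₜ f) = l f • p := fun p f => by simp [φ]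
  refine ⟨φ.toAddMonoidHom, fun p T => ?_, fun p f => ?_⟩
  · refine (hφ p _).trans ?_
    rw [hl]
    split_ifs <;> simp
  · have h2 : ∀ n : ZMod 2, n = 0 ∨ n = 1 := by decide
    refine (h2 (l f)).imp (fun h => (hφ p f).trans ?_) fun h => (hφ p f).trans ?_
    · rw [h, zero_smul]
    · rw [h, one_smul]

theorem linearIndependent_monom_a2Gen :
    LinearIndependent M2 (monom a2Gen : Finset HIndex → A2) := by
  rw [Fintype.linearIndependent_iff]
  intro c hc S
  obtain ⟨φ, hφ, -⟩ := exists_modelCoord S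
  have h := congrArg (fun x : A2 => φ (model x)) hc
  have hv : ∀ x : A2, model (x : Steenrod) = (model.comp A2.val) x := fun _ => rfl
  simp only [hv, map_sum, map_smul, map_zero] at h
  simp only [← hv, model_monom, modelOp, TensorProduct.smul_tmul', hφ] at h
  rw [Finset.sum_ite_eq' Finset.univ S, if_pos (Finset.mem_univ S), smul_eq_C_mul, ← mul_assoc,
    ← C_mul] at h
  have h0 : (C (c S * τ ^ weightDegree S) * X ^ topDegree S : M2[X]) = 0 := h
  rw [mul_eq_zero, C_eq_zero, mul_eq_zero] at h0
  rcases h0 with (h0 | h0) | h0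
  · exact h0
  · exact absurd h0 (pow_ne_zero _ X_ne_zero)
  · exact absurd h0 (pow_ne_zero _ X_ne_zero)

/-- The basis of `A(2)` consisting of the ordered monomials. -/
def a2Basis : Module.Basis (Finset HIndex) M2 A2 :=
  Module.Basis.mk linearIndependent_monom_a2Gen (by
    intro x _
    refine Submodule.span_mono ?_ (mem_monomSpan_zero x)
    rintro _ ⟨S, -, rfl⟩
    exact ⟨S, rfl⟩)

theorem a2Basis_apply (S : Finset HIndex) : a2Basis S = monom a2Gen S := by
  rw [a2Basis, Module.Basis.mk_apply]

theorem mem_pow_iff_repr (n : ℕ) (x : A2) :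
    x ∈ I2 ^ n ↔ ∀ S, a2Basis.repr x S ≠ 0 → n ≤ mayDeg S := by
  rw [mem_pow_iff]
  have h : {x | ∃ S, n ≤ mayDeg S ∧ monom a2Gen S = x} = a2Basis '' {S | n ≤ mayDeg S} := by
    ext x
    simp only [Set.mem_image, a2Basis_apply]
    rfl
  rw [monomSpan, h, Module.Basis.mem_span_image]
  constructor
  · intro h S hS
    exact h (Finset.mem_coe.2 (Finsupp.mem_support_iff.2 hS))
  · intro h S hS
    exact h S (Finsupp.mem_support_iff.1 (Finset.mem_coe.1 hS))

/-- The coordinates of a homogeneous element of `A(2)` are homogeneous. -/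
theorem repr_of_mem_steenrodDeg {t w : ℕ} {x : A2} (hx : (x : Steenrod) ∈ steenrodDeg t w)
    (S : Finset HIndex) (n : ℕ) (hn : (a2Basis.repr x S).coeff n ≠ 0) :
    topDegree S = t ∧ n + weightDegree S = w := by
  have hmodel : ∃ f, model (x : Steenrod) = modelOp t w f := by
    have hl : ∀ l : List ℕ, ∃ f, model (l.map Sq).prod =
        modelOp l.sum (l.map fun i => i / 2).sum f := by
      intro l
      induction l with
      | nil => exact ⟨1, by simp [modelOp, Algebra.TensorProduct.one_def]⟩
      | cons i l ih =>
        obtain ⟨f, hf⟩ := ih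
        exact ⟨_, by rw [List.map_cons, List.prod_cons, map_mul, hf, model_Sq, modelOp_mul]; rfl⟩
    refine AddSubgroup.closure_induction (p := fun x _ => ∃ f, model x = modelOp t w f) ?_ ?_ ?_ ?_
      hx
    · rintro _ ⟨j, l, -, rfl, rfl, rfl⟩
      obtain ⟨f, hf⟩ := hl l
      exact ⟨f, by rw [map_smul, hf, tau_pow_smul_modelOp]⟩
    · exact ⟨0, by rw [map_zero, modelOp, TensorProduct.tmul_zero]⟩
    · rintro x y - - ⟨f, hf⟩ ⟨g, hg⟩
      exact ⟨f + g, by rw [map_add, hf, hg, modelOp_add]⟩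
    · rintro x - ⟨f, hf⟩
      exact ⟨-f, by rw [map_neg, hf, modelOp, modelOp, TensorProduct.tmul_neg]⟩
  obtain ⟨f, hf⟩ := hmodel
  obtain ⟨φ, hφ, hφ'⟩ := exists_modelCoord S
  have h : φ (model (x : Steenrod)) = 0 ∨ φ (model (x : Steenrod)) = C (τ ^ w) * X ^ t := by
    rw [hf]; exact hφ' (C (τ ^ w) * X ^ t) f
  have hv : ∀ x : A2, model (x : Steenrod) = (model.comp A2.val) x := fun _ => rfl
  have hx' : φ (model (x : Steenrod)) =
      C (a2Basis.repr x S * τ ^ weightDegree S) * X ^ topDegree S := by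
    conv_lhs => rw [← a2Basis.sum_repr x]
    simp only [hv, map_sum, map_smul, a2Basis_apply]
    simp only [← hv, model_monom, modelOp, TensorProduct.smul_tmul', hφ]
    rw [Finset.sum_ite_eq' Finset.univ S, if_pos (Finset.mem_univ S), smul_eq_C_mul, ← mul_assoc,
      ← C_mul]
  rw [hx'] at h
  have hc : ∀ p : M2[X], C (a2Basis.repr x S * τ ^ weightDegree S) * X ^ topDegree S = p →
      (a2Basis.repr x S).coeff n = (p.coeff (topDegree S)).coeff (n + weightDegree S) := by
    rintro _ rfl
    rw [coeff_C_mul_X_pow, if_pos rfl, coeff_mul_X_pow]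
  rcases h with h | h
  · exact absurd (hc _ h) (by simpa using hn)
  · have h1 := hc _ h
    rw [coeff_C_mul_X_pow] at h1
    by_cases ht : topDegree S = t
    · refine ⟨ht, ?_⟩
      by_contra hne
      rw [if_pos ht, coeff_X_pow, if_neg hne] at h1
      exact hn h1
    · rw [if_neg ht, coeff_zero] at h1
      exact absurd h1 hn

/-! ### The associated graded algebra of `A(2)` -/

/-- The class of `x` in `I^m / I^{m+1}`, regarded as an element of `Gr A(2)`; the value is `0` if
`x` does not lie in `I^m`. -/
def grClass (m : ℕ) (x : A2) : GrA2 :=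
  open scoped Classical in if h : x ∈ I2 ^ m then grOf I2 m (grMk I2 x h) else 0

theorem grClass_of_mem {m : ℕ} {x : A2} (h : x ∈ I2 ^ m) :
    grClass m x = grOf I2 m (grMk I2 x h) := dif_pos h

theorem grClass_add {m : ℕ} {x y : A2} (hx : x ∈ I2 ^ m) (hy : y ∈ I2 ^ m) :
    grClass m (x + y) = grClass m x + grClass m y := by
  rw [grClass_of_mem hx, grClass_of_mem hy, grClass_of_mem (add_mem hx hy), ← map_add]
  rfl

theorem smul_mem_pow {m : ℕ} (r : M2) {x : A2} (hx : x ∈ I2 ^ m) : r • x ∈ I2 ^ m :=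
  (I2 ^ m).smul_of_tower_mem r hx

theorem smul_grOf (r : M2) (m : ℕ) (x : GrPiece I2 m) : r • grOf I2 m x = grOf I2 m (r • x) :=
  (map_smul (DirectSum.lof M2 ℕ (GrPiece I2) m) r x).symm

theorem grClass_smul {m : ℕ} (r : M2) {x : A2} (hx : x ∈ I2 ^ m) :
    grClass m (r • x) = r • grClass m x := by
  rw [grClass_of_mem hx, grClass_of_mem (smul_mem_pow r hx), smul_grOf]
  rfl

theorem mul_mem_pow {m n : ℕ} {x y : A2} (hx : x ∈ I2 ^ m) (hy : y ∈ I2 ^ n) :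
    x * y ∈ I2 ^ (m + n) := by
  rw [Ideal.IsTwoSided.pow_add]; exact Ideal.mul_mem_mul hx hy

theorem grClass_mul {m n : ℕ} {x y : A2} (hx : x ∈ I2 ^ m) (hy : y ∈ I2 ^ n) :
    grClass m x * grClass n y = grClass (m + n) (x * y) := by
  rw [grClass_of_mem hx, grClass_of_mem hy, grClass_of_mem (mul_mem_pow hx hy)]
  exact DirectSum.of_mul_of (A := GrPiece I2) _ _

theorem grClass_eq_zero {m : ℕ} {x : A2} (hx : x ∈ I2 ^ (m + 1)) : grClass m x = 0 := by
  have hx' : x ∈ I2 ^ m := Ideal.pow_le_pow_right (Nat.le_succ m) hx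
  rw [grClass_of_mem hx']
  have : grMk I2 x hx' = grMk I2 0 (zero_mem _) := (grPiece_mk_eq I2).2 (by simpa using hx)
  rw [this]
  exact map_zero (grOf I2 m)

theorem grClass_zero (m : ℕ) : grClass m 0 = 0 := grClass_eq_zero (zero_mem _)

theorem grClass_one : grClass 0 1 = 1 := grClass_of_mem (mem_pow_zero I2 1)

/-- `Gr A(2)` is additively generated by classes. -/
theorem gr_induction_on {P : GrA2 → Prop} (x : GrA2) (hc : ∀ m y, y ∈ I2 ^ m → P (grClass m y))
    (ha : ∀ x y, P x → P y → P (x + y)) : P x := by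
  refine DirectSum.induction_on (motive := P) x ?_ (fun m y => ?_) ha
  · have := hc 0 0 (zero_mem _)
    rwa [grClass_zero] at this
  · induction y using gr_induction with
    | h y hy =>
      have := hc m y hy
      rwa [grClass_of_mem hy] at this

theorem grA2Aug_grClass {m : ℕ} {x : A2} (hx : x ∈ I2 ^ m) :
    grA2Aug (grClass m x) = if m = 0 then a2Aug x else 0 := by
  have h : ∀ y : GrPiece I2 m, grA2Aug (grOf I2 m y) = grAugPiece I2 a2Aug a2Aug_I2 m y := fun y =>
    DirectSum.toAddMonoid_of (β := GrPiece I2)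
      (fun i => (grAugPiece I2 a2Aug a2Aug_I2 i).toAddMonoidHom) m y
  rw [grClass_of_mem hx, h]
  rfl

/-- The coordinate in degree `n` of the ordered monomial of `S`. -/
def grCoordPiece (S : Finset HIndex) (n : ℕ) : GrPiece I2 n →ₗ[M2] M2 where
  toFun x := Quotient.liftOn x (fun a => if n = mayDeg S then a2Basis.repr (a : A2) S else 0) (by
    intro a b hab
    have h : (a : A2) - b ∈ I2 ^ (n + 1) := (grPiece_mk_eq I2).1 (Quotient.sound hab)
    by_cases hn : n = mayDeg S
    · have h1 := (mem_pow_iff_repr _ _).1 h S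
      simp only [hn, if_true]
      by_contra hne
      have h2 := h1 (by rw [map_sub, Finsupp.sub_apply]; exact sub_ne_zero.2 hne)
      omega
    · simp only [hn, if_false])
  map_add' x y := by
    induction x using gr_induction with
    | h x hx =>
      induction y using gr_induction with
      | h y hy =>
        change (if n = mayDeg S then a2Basis.repr (x + y) S else 0) =
          (if n = mayDeg S then a2Basis.repr x S else 0) +
            if n = mayDeg S then a2Basis.repr y S else 0
        split_ifs <;> simp
  map_smul' r x := by
    induction x using gr_induction with
    | h x hx =>
      change (if n = mayDeg S then a2Basis.repr (r • x) S else 0) =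
        r • if n = mayDeg S then a2Basis.repr x S else 0
      split_ifs <;> simp

/-- The coordinate of an element of `Gr A(2)` at the ordered monomial of `S`. -/
def grCoord (S : Finset HIndex) : GrA2 →ₗ[M2] M2 :=
  DirectSum.toModule M2 ℕ M2 (grCoordPiece S)

theorem grCoord_grClass (S : Finset HIndex) {m : ℕ} {x : A2} (hx : x ∈ I2 ^ m) :
    grCoord S (grClass m x) = if m = mayDeg S then a2Basis.repr x S else 0 := by
  rw [grClass_of_mem hx]
  exact DirectSum.toModule_lof M2 m _

/-- The class in `Gr A(2)` of the ordered monomial of `S`. -/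
def grMonom (S : Finset HIndex) : GrA2 := grClass (mayDeg S) (monom a2Gen S)

theorem grCoord_grMonom (S T : Finset HIndex) :
    grCoord S (grMonom T) = if T = S then 1 else 0 := by
  rw [grMonom, grCoord_grClass S (monom_mem_pow T), ← a2Basis_apply, Module.Basis.repr_self,
    Finsupp.single_apply]
  by_cases h : T = S
  · simp [h]
  · simp [h]

theorem grClass_mem_span {m : ℕ} {x : A2} (hx : x ∈ I2 ^ m) :
    grClass m x ∈ Submodule.span M2 (Set.range grMonom) := by
  have hx' := (mem_pow_iff m x).1 hx
  refine (Submodule.span_induction (p := fun x _ => x ∈ I2 ^ m ∧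
    grClass m x ∈ Submodule.span M2 (Set.range grMonom)) ?_ ?_ ?_ ?_ hx').2
  · rintro _ ⟨S, hS, rfl⟩
    refine ⟨Ideal.pow_le_pow_right hS (monom_mem_pow S), ?_⟩
    rcases hS.eq_or_lt with rfl | hS
    · exact Submodule.subset_span ⟨S, rfl⟩
    · rw [grClass_eq_zero (Ideal.pow_le_pow_right hS (monom_mem_pow S))]
      exact zero_mem _
  · exact ⟨zero_mem _, by rw [grClass_zero]; exact zero_mem _⟩
  · rintro x y - - ⟨hx, hx'⟩ ⟨hy, hy'⟩
    exact ⟨add_mem hx hy, by rw [grClass_add hx hy]; exact add_mem hx' hy'⟩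
  · rintro r x - ⟨hx, hx'⟩
    exact ⟨smul_mem_pow r hx, by rw [grClass_smul r hx]; exact Submodule.smul_mem _ _ hx'⟩

/-- The basis of `Gr A(2)` consisting of the classes of the ordered monomials. -/
def grBasis : Module.Basis (Finset HIndex) M2 GrA2 :=
  Module.Basis.mk (v := grMonom)
    (by
      rw [Fintype.linearIndependent_iff]
      intro c hc S
      have h := congrArg (grCoord S) hc
      simp only [map_sum, map_smul, map_zero, grCoord_grMonom] at h
      simpa using h)
    (by
      intro x _
      induction x using gr_induction_on with
      | hc m y hy => exact grClass_mem_span hy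
      | ha x y hx hy => exact add_mem (hx trivial) (hy trivial))

theorem grBasis_apply (S : Finset HIndex) : grBasis S = grMonom S := by
  rw [grBasis, Module.Basis.mk_apply]

theorem grBasis_repr (S : Finset HIndex) (x : GrA2) : grBasis.repr x S = grCoord S x := by
  have h : (Finsupp.lapply S).comp grBasis.repr.toLinearMap = grCoord S := by
    refine grBasis.ext fun T => ?_
    rw [grBasis_apply, grCoord_grMonom, ← grBasis_apply]
    simp [Finsupp.single_apply]
  exact DFunLike.congr_fun h x

theorem grMonom_empty : grMonom ∅ = 1 := by
  rw [grMonom, monom, Finset.sort_empty, wordProd_nil]; exact grClass_one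

theorem mayDeg_eq_zero {S : Finset HIndex} : mayDeg S = 0 ↔ S = ∅ := by
  have h : ∀ i : HIndex, i.may ≠ 0 := by intro i; cases i <;> decide
  simp [mayDeg, Finset.sum_eq_zero_iff, h, Finset.eq_empty_iff_forall_notMem]

theorem grA2Aug_grMonom (S : Finset HIndex) : grA2Aug (grMonom S) = if S = ∅ then 1 else 0 := by
  split_ifs with h
  · rw [h, grMonom_empty, map_one]
  · rw [grMonom, grA2Aug_grClass (monom_mem_pow S), if_neg (by rwa [mayDeg_eq_zero])]

theorem grA2Aug_eq (x : GrA2) : grA2Aug x = grCoord ∅ x := by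
  have h : grA2Aug.toLinearMap = grCoord ∅ := by
    refine grBasis.ext fun T => ?_
    rw [grBasis_apply, grCoord_grMonom]
    exact grA2Aug_grMonom T
  exact DFunLike.congr_fun h x

/-- The letters of the words on which the cochains are evaluated: the nonempty sets of indices. -/
abbrev Letter (ι : Type*) : Type _ := {S : Finset ι // S.Nonempty}

/-- The class of the ordered monomial of a nonempty set, in the augmentation ideal. -/
def augMonom (S : Letter HIndex) : AugIdeal grA2Aug :=
  ⟨grMonom S.1, (grA2Aug_grMonom S.1).trans (if_neg S.2.ne_empty)⟩

/-- The basis of the augmentation ideal of `Gr A(2)`. -/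
def augBasis : Module.Basis (Letter HIndex) M2 (AugIdeal grA2Aug) :=
  Module.Basis.mk (v := augMonom)
    (by
      rw [Fintype.linearIndependent_iff]
      intro c hc S
      have h := congrArg (fun x : AugIdeal grA2Aug => grCoord S.1 (x : GrA2)) hc
      simp only [Submodule.coe_sum, map_sum, Submodule.coe_smul_of_tower, map_smul, augMonom,
        grCoord_grMonom] at h
      simpa [Subtype.coe_inj] using h)
    (by
      intro x _
      have h0 : grCoord ∅ (x : GrA2) = 0 := (grA2Aug_eq _).symm.trans (RingHom.mem_ker.1 x.2)
      have hx : x = ∑ S : Letter HIndex, grCoord S.1 (x : GrA2) • augMonom S := by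
        refine Subtype.ext ?_
        simp only [Submodule.coe_sum, Submodule.coe_smul_of_tower, augMonom]
        conv_lhs => rw [← grBasis.sum_repr (x : GrA2)]
        simp only [grBasis_repr, grBasis_apply]
        rw [← Finset.sum_subtype (Finset.univ.filter Finset.Nonempty) (by simp)
          fun S => grCoord S (x : GrA2) • grMonom S]
        refine (Finset.sum_filter_of_ne fun S _ hS => ?_).symm
        rw [Finset.nonempty_iff_ne_empty]
        rintro rfl
        exact hS (by rw [h0, zero_smul])
      rw [hx]
      exact sum_mem fun S _ => Submodule.smul_mem _ _ (Submodule.subset_span ⟨S, rfl⟩))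

theorem coe_augBasis (S : Letter HIndex) : (augBasis S : GrA2) = grMonom S.1 := by
  rw [augBasis, Module.Basis.mk_apply]; rfl

theorem augBasis_repr (S : Letter HIndex) (x : AugIdeal grA2Aug) :
    augBasis.repr x S = grCoord S.1 (x : GrA2) := by
  have hx : (x : GrA2) = ∑ T, augBasis.repr x T • grMonom T.1 := by
    conv_lhs => rw [← augBasis.sum_repr x]
    simp only [Submodule.coe_sum, Submodule.coe_smul_of_tower, coe_augBasis]
  rw [hx]
  simp [grCoord_grMonom, Subtype.coe_inj]

/-! ### Homogeneous elements and products in `Gr A(2)` -/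

theorem mul_mem_steenrodDeg {t w t' w' : ℕ} {x y : Steenrod} (hx : x ∈ steenrodDeg t w)
    (hy : y ∈ steenrodDeg t' w') : x * y ∈ steenrodDeg (t + t') (w + w') := by
  refine AddSubgroup.closure_induction
    (p := fun x _ => x * y ∈ steenrodDeg (t + t') (w + w')) ?_ ?_ ?_ ?_ hx
  · rintro _ ⟨j, l, hl, rfl, rfl, rfl⟩
    refine AddSubgroup.closure_induction
      (p := fun y _ => τ ^ j • (l.map Sq).prod * y ∈
        steenrodDeg (l.sum + t') (j + (l.map fun i => i / 2).sum + w')) ?_ ?_ ?_ ?_ hy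
    · rintro _ ⟨j', l', hl', rfl, rfl, rfl⟩
      refine AddSubgroup.subset_closure ⟨j + j', l ++ l', ?_, by simp, ?_, ?_⟩
      · intro i hi
        exact (List.mem_append.1 hi).elim (hl i) (hl' i)
      · rw [List.map_append, List.sum_append]; omega
      · rw [List.map_append, List.prod_append, smul_mul_smul_comm, pow_add]
    · rw [mul_zero]; exact zero_mem _
    · intro x y _ _ h h'; rw [mul_add]; exact add_mem h h'
    · intro x _ h; rw [mul_neg]; exact neg_mem h
  · rw [zero_mul]; exact zero_mem _
  · intro x y _ _ h h'; rw [add_mul]; exact add_mem h h'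
  · intro x _ h; rw [neg_mul]; exact neg_mem h

theorem Sq_mem_steenrodDeg {n : ℕ} (hn : 0 < n) : Sq n ∈ steenrodDeg n (n / 2) :=
  AddSubgroup.subset_closure ⟨0, [n], by simpa, by simp, by simp, by simp⟩

theorem sqGen_mem_steenrodDeg (i : HIndex) : sqGen i ∈ steenrodDeg i.topDeg i.weight := by
  have hc : ∀ {t w t' w' : ℕ} {x y : Steenrod}, x ∈ steenrodDeg t w → y ∈ steenrodDeg t' w' →
      x * y + y * x ∈ steenrodDeg (t + t') (w + w') := fun {t w t' w' x y} hx hy => by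
    refine add_mem (mul_mem_steenrodDeg hx hy) ?_
    rw [add_comm t, add_comm w]
    exact mul_mem_steenrodDeg hy hx
  have h0 : sqGen .h10 ∈ steenrodDeg 1 0 := Sq_mem_steenrodDeg one_pos
  have h1 : sqGen .h11 ∈ steenrodDeg 2 1 := Sq_mem_steenrodDeg two_pos
  have h2 : sqGen .h12 ∈ steenrodDeg 4 2 := Sq_mem_steenrodDeg four_pos
  have h20 : sqGen .h20 ∈ steenrodDeg 3 1 := by have h := hc h0 h1; exact h
  have h21 : sqGen .h21 ∈ steenrodDeg 6 3 := by have h := hc h1 h2; exact h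
  have h30 : sqGen .h30 ∈ steenrodDeg 7 3 := by have h := hc h20 h2; exact h
  cases i
  exacts [h0, h1, h2, h20, h21, h30]

theorem monom_mem_steenrodDeg (S : Finset HIndex) :
    ((monom a2Gen S : A2) : Steenrod) ∈ steenrodDeg (topDegree S) (weightDegree S) := by
  have h : ∀ u : List HIndex, wordProd sqGen u ∈
      steenrodDeg (u.map HIndex.topDeg).sum (u.map HIndex.weight).sum := by
    intro u
    induction u with
    | nil => exact AddSubgroup.subset_closure ⟨0, [], by simp, rfl, rfl, by simp [wordProd]⟩
    | cons i u ih =>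
      rw [wordProd_cons]
      exact mul_mem_steenrodDeg (sqGen_mem_steenrodDeg i) ih
  have h1 : ((monom a2Gen S : A2) : Steenrod) = wordProd sqGen S.sort :=
    map_wordProd a2Gen A2.val (S.sort (· ≤ ·))
  rw [h1, topDegree, weightDegree, ← sum_map_sort, ← sum_map_sort]
  exact h _

theorem GrA2Homogeneous.mul {m t w m' t' w' : ℕ} {x y : GrA2} (hx : GrA2Homogeneous m t w x)
    (hy : GrA2Homogeneous m' t' w' y) : GrA2Homogeneous (m + m') (t + t') (w + w') (x * y) := by
  obtain ⟨a, ha, ha', rfl⟩ := hx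
  obtain ⟨b, hb, hb', rfl⟩ := hy
  refine ⟨a * b, mul_mem_pow ha hb, mul_mem_steenrodDeg ha' hb', ?_⟩
  rw [← grClass_of_mem ha, ← grClass_of_mem hb, grClass_mul ha hb, grClass_of_mem]

theorem grMonom_homogeneous (S : Finset HIndex) :
    GrA2Homogeneous (mayDeg S) (topDegree S) (weightDegree S) (grMonom S) :=
  ⟨_, monom_mem_pow S, monom_mem_steenrodDeg S, grClass_of_mem _⟩

theorem GrA2Homogeneous.grCoord {m t w : ℕ} {x : GrA2} (hx : GrA2Homogeneous m t w x)
    (S : Finset HIndex) :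
    M2Homogeneous (m - mayDeg S) (t - topDegree S) (w - weightDegree S) (grCoord S x) := by
  obtain ⟨a, ha, ha', rfl⟩ := hx
  intro n hn
  rw [← grClass_of_mem ha, grCoord_grClass S ha] at hn
  split_ifs at hn with h
  · have := repr_of_mem_steenrodDeg ha' S n hn
    omega
  · exact absurd (coeff_zero n) hn

/-- The generator of `Gr A(2)` that is the class of `a2Gen i`. -/
def grGen (i : HIndex) : GrA2 := grClass i.may (a2Gen i)

theorem wordProd_grGen (u : List HIndex) :
    wordProd grGen u = grClass (u.map HIndex.may).sum (wordProd a2Gen u) := by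
  induction u with
  | nil => exact grClass_one.symm
  | cons i u ih =>
    rw [wordProd_cons, ih, grGen, grClass_mul (a2Gen_mem_pow i) (wordProd_mem_pow u)]; rfl

theorem grMonom_eq_monom (S : Finset HIndex) : grMonom S = monom grGen S := by
  rw [grMonom, monom, monom, wordProd_grGen, sum_map_may_sort]

namespace HIndex

/-- The terms of the expansion of a product in the wrong order, other than the transposed product.
-/
def bracketTerms (j i : HIndex) : List (ℕ × List HIndex) :=
  if i < j then (swapTerms j i).tail else swapTerms j i

theorem swapTerms_eq (i j : HIndex) (hij : i ≤ j) : swapTerms j i =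
    if i < j then (0, [i, j]) :: bracketTerms j i else bracketTerms j i := by
  revert hij; cases j <;> cases i <;> decide

theorem bracketTerms_may (i j : HIndex) (hij : i ≤ j) (c : ℕ × List HIndex)
    (hc : c ∈ bracketTerms j i) : may j + may i < (c.2.map may).sum ∨
      (may j + may i = (c.2.map may).sum ∧ c.2.length = 1) := by
  revert c; revert hij; cases j <;> cases i <;> decide

end HIndex

/-- The top coordinates of a word in the generators of `Gr A(2)` are those in the exterior algebra,
because the other terms that arise in straightening are shorter or have higher filtration. -/
theorem repr_wordProd_of_length_le (u : List HIndex) (R : Finset HIndex)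
    (hR : mayDeg R = (u.map HIndex.may).sum) (hc : u.length ≤ R.card) :
    a2Basis.repr (wordProd a2Gen u) R = if u.Nodup ∧ R = u.toFinset then 1 else 0 := by
  induction u using word_straightening with
  | hs u hu =>
    rw [← monom_eq_wordProd _ hu, ← a2Basis_apply, Module.Basis.repr_self, Finsupp.single_apply]
    have hn : u.Nodup := hu.imp fun h => h.ne
    simp only [hn, true_and, eq_comm]
  | hr p j i q hij ih =>
    rw [wordProd_append, wordProd_cons, wordProd_cons, ← mul_assoc (a2Gen j), a2Gen_mul i j hij,
      ← List.sum_map_mul_right, ← List.sum_map_mul_left]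
    have hz : ∀ c ∈ HIndex.bracketTerms j i,
        a2Basis.repr (wordProd a2Gen (p ++ c.2 ++ q)) R = 0 := by
      intro c hc'
      simp only [List.map_append, List.sum_append, List.map_cons, List.sum_cons,
        List.length_append, List.length_cons] at hR hc ih
      rcases HIndex.bracketTerms_may i j hij c hc' with h | ⟨h, hl⟩
      · by_contra hne
        have := (mem_pow_iff_repr _ _).1 (wordProd_mem_pow (p ++ c.2 ++ q)) R hne
        simp only [List.map_append, List.sum_append] at this
        omega
      · rw [ih c (by rw [HIndex.swapTerms_eq i j hij]; split_ifs <;> simp [hc'])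
          (by omega) (by omega), if_neg]
        rintro ⟨-, rfl⟩
        have := List.toFinset_card_le (p ++ c.2 ++ q)
        simp only [List.length_append] at this
        omega
    have hz' : a2Basis.repr ((((HIndex.bracketTerms j i).map
        fun c => τ ^ c.1 • wordProd a2Gen c.2).map fun x => x * wordProd a2Gen q).map
          fun x => wordProd a2Gen p * x).sum R = 0 := by
      have : ∀ l : List A2, (∀ x ∈ l, a2Basis.repr x R = 0) → a2Basis.repr l.sum R = 0 := by
        intro l hl
        induction l with
        | nil => simp
        | cons x l ihl =>
          rw [List.sum_cons, map_add, Finsupp.add_apply, hl x (by simp),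
            ihl fun y hy => hl y (by simp [hy]), add_zero]
      refine this _ fun x hx => ?_
      simp only [List.mem_map, List.map_map, Function.comp] at hx
      obtain ⟨c, hc', rfl⟩ := hx
      rw [smul_mul_assoc, mul_smul_comm, map_smul, Finsupp.smul_apply, ← mul_assoc,
        ← wordProd_append, ← wordProd_append, hz c hc', smul_zero]
    have hsw := HIndex.swapTerms_eq i j hij
    simp only [List.map_map, Function.comp_def] at hz' ⊢
    by_cases h : i < j
    · rw [if_pos h] at hsw
      have h1 := ih (0, [i, j]) (by rw [hsw]; simp)
        (by rw [hR]; simp only [List.map_append, List.sum_append, List.map_cons, List.sum_cons,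
              List.map_nil, List.sum_nil]; omega)
        (by simpa using hc)
      have hperm : (p ++ [i, j] ++ q).Perm (p ++ j :: i :: q) := by
        rw [List.append_assoc]
        exact (List.Perm.swap j i q).append_left p
      rw [hsw, List.map_cons, List.sum_cons, map_add, Finsupp.add_apply, hz', add_zero]
      simp only [pow_zero, one_smul]
      rw [← mul_assoc, ← wordProd_append, ← wordProd_append, h1]
      simp only [hperm.nodup_iff, List.toFinset_eq_of_perm _ _ hperm]
    · rw [if_neg h] at hsw
      obtain rfl : i = j := le_antisymm hij (not_lt.1 h)
      rw [hsw, hz', if_neg]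
      rintro ⟨hn, -⟩
      simp [List.nodup_append] at hn

/-- The product in `Gr A(2)` agrees with that of the exterior algebra up to shorter monomials. -/
theorem grCoord_grMonom_mul (S T R : Finset HIndex) (h : S.card + T.card ≤ R.card) :
    grCoord R (grMonom S * grMonom T) = if Disjoint S T ∧ R = S ∪ T then 1 else 0 := by
  rw [grMonom, grMonom, grClass_mul (monom_mem_pow S) (monom_mem_pow T),
    grCoord_grClass R (mul_mem_pow (monom_mem_pow S) (monom_mem_pow T)), monom, monom,
    ← wordProd_append]
  have hd : Disjoint S T ↔ (S.sort ++ T.sort).Nodup := by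
    rw [List.nodup_append', Finset.disjoint_left]
    simp [List.Disjoint, Finset.sort_nodup]
  have hu : (S.sort ++ T.sort).toFinset = S ∪ T := by simp
  split_ifs with h1 h2 h2
  · rw [repr_wordProd_of_length_le _ _ (by simp [sum_map_may_sort, ← h1]) (by simpa using h), hu,
      if_pos (by rwa [← hd])]
  · rw [repr_wordProd_of_length_le _ _ (by simp [sum_map_may_sort, ← h1]) (by simpa using h), hu,
      if_neg (by rwa [← hd])]
  · refine absurd ?_ h1
    rw [h2.2, mayDeg, mayDeg, mayDeg, Finset.sum_union h2.1]
  · rfl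

/-- The product of two generators of `Gr A(2)` in the wrong order. -/
theorem grGen_mul (i j : HIndex) (hij : i ≤ j) : grGen j * grGen i =
    ((HIndex.swapTerms j i).map fun c => if (c.2.map HIndex.may).sum = j.may + i.may then
      τ ^ c.1 • wordProd grGen c.2 else 0).sum := by
  have key : ∀ (l : List (ℕ × List HIndex)) (m : ℕ), (∀ c ∈ l, m ≤ (c.2.map HIndex.may).sum) →
      (l.map fun c => τ ^ c.1 • wordProd a2Gen c.2).sum ∈ I2 ^ m ∧
      grClass m (l.map fun c => τ ^ c.1 • wordProd a2Gen c.2).sum = (l.map fun c =>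
        if (c.2.map HIndex.may).sum = m then τ ^ c.1 • wordProd grGen c.2 else 0).sum := by
    intro l m hl
    induction l with
    | nil => exact ⟨zero_mem _, grClass_zero m⟩
    | cons c l ih =>
      have hc := hl c (by simp)
      obtain ⟨ih1, ih2⟩ := ih fun c' hc' => hl c' (by simp [hc'])
      have hw := wordProd_mem_pow c.2
      have hm : wordProd a2Gen c.2 ∈ I2 ^ m := Ideal.pow_le_pow_right hc hw
      simp only [List.map_cons, List.sum_cons]
      refine ⟨add_mem (smul_mem_pow _ hm) ih1, ?_⟩
      rw [grClass_add (smul_mem_pow _ hm) ih1, ih2, grClass_smul _ hm]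
      congr 1
      split_ifs with h
      · rw [wordProd_grGen, h]
      · rw [grClass_eq_zero (Ideal.pow_le_pow_right (by omega) hw), smul_zero]
  rw [grGen, grGen, grClass_mul (a2Gen_mem_pow j) (a2Gen_mem_pow i), a2Gen_mul i j hij]
  refine (key _ _ fun c hc => ?_).2
  rcases HIndex.swapTerms_may i j hij c hc with h | ⟨h, -⟩ | ⟨-, h⟩
  · omega
  · omega
  · rw [h]; simp only [List.map_cons, List.sum_cons, List.map_nil, List.sum_nil]; omega

/-! ### The contraction of the cobar complex onto the words in the generators -/

namespace Letter

section Size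

variable {ι : Type*}

/-- The letter with a single element. -/
def single (i : ι) : Letter ι := ⟨{i}, Finset.singleton_nonempty i⟩

theorem card_single (i : ι) : (single i).1.card = 1 := Finset.card_singleton i

/-- The total number of elements of the letters of a word. -/
def size (w : List (Letter ι)) : ℕ := (w.map fun S => S.1.card).sum

theorem size_cons (S : Letter ι) (w : List (Letter ι)) : size (S :: w) = S.1.card + size w := rfl

theorem length_le_size (w : List (Letter ι)) : w.length ≤ size w := by
  induction w with
  | nil => exact le_rfl
  | cons S w ih =>
    have := Finset.card_pos.2 S.2
    rw [size_cons, List.length_cons]; omega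

variable {Δ : Type*} [AddCommMonoid Δ]

/-- The degree of a word. -/
def degree (deg : ι → Δ) (w : List (Letter ι)) : Δ := (w.map fun S => ∑ i ∈ S.1, deg i).sum

theorem degree_cons (deg : ι → Δ) (S : Letter ι) (w : List (Letter ι)) :
    degree deg (S :: w) = ∑ i ∈ S.1, deg i + degree deg w := rfl

theorem single_injective : Function.Injective (single : ι → Letter ι) := fun _ _ h =>
  Finset.singleton_injective (congrArg Subtype.val h)

theorem degree_map_single {Δ : Type*} [AddCommMonoid Δ] (deg : ι → Δ) (w : List ι) :
    degree deg (w.map single) = (w.map deg).sum := by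
  rw [degree, List.map_map]
  congr 1
  refine List.map_congr_left fun i _ => ?_
  exact Finset.sum_singleton _ _

theorem size_map_single (w : List ι) : size (w.map single) = w.length := by
  induction w with
  | nil => rfl
  | cons i w ih => rw [List.map_cons, size_cons, card_single, ih, List.length_cons, add_comm]

theorem exists_eq_map_single (w : List (Letter ι)) (h : size w ≤ w.length) :
    ∃ u : List ι, w = u.map single := by
  induction w with
  | nil => exact ⟨[], rfl⟩
  | cons S w ih =>
    have h1 := Finset.card_pos.2 S.2
    have h2 := length_le_size w
    rw [size_cons, List.length_cons] at h
    obtain ⟨u, rfl⟩ := ih (by omega)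
    obtain ⟨i, hi⟩ := Finset.card_eq_one.1 (show S.1.card = 1 by omega)
    exact ⟨i :: u, by rw [List.map_cons]; congr 1; exact Subtype.ext hi⟩

end Size

section Basic

variable {ι : Type*} [LinearOrder ι]

/-- The least element of a letter. -/
def head (S : Letter ι) : ι := S.1.min' S.2

/-- The union of two letters. -/
def union (S T : Letter ι) : Letter ι := ⟨S.1 ∪ T.1, S.2.mono Finset.subset_union_left⟩

theorem head_mem (S : Letter ι) : S.head ∈ S.1 := Finset.min'_mem _ _

theorem head_le (S : Letter ι) {i : ι} (h : i ∈ S.1) : S.head ≤ i := Finset.min'_le _ _ h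

theorem head_single (i : ι) : (single i).head = i := Finset.min'_singleton i

theorem head_eq {S : Letter ι} {i : ι} (hi : i ∈ S.1) (h : ∀ j ∈ S.1, i ≤ j) : S.head = i :=
  le_antisymm (S.head_le hi) (h _ S.head_mem)

theorem head_union (S T : Letter ι) : (S.union T).head = min S.head T.head := by
  refine head_eq ?_ fun j hj => ?_
  · rcases min_choice S.head T.head with h | h <;> rw [h]
    exacts [Finset.mem_union_left _ S.head_mem, Finset.mem_union_right _ T.head_mem]
  · rcases Finset.mem_union.1 hj with h | h
    exacts [(min_le_left _ _).trans (S.head_le h), (min_le_right _ _).trans (T.head_le h)]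

theorem card_union {S T : Letter ι} (h : Disjoint S.1 T.1) :
    (S.union T).1.card = S.1.card + T.1.card := Finset.card_union_of_disjoint h

theorem card_erase_head (S : Letter ι) : (S.1.erase S.head).card + 1 = S.1.card :=
  Finset.card_erase_add_one S.head_mem

/-- The order of the letters, by the least element and the number of elements. -/
def key (S : Letter ι) : ι ×ₗ ℕ := toLex (S.head, S.1.card)

theorem key_lt_of_head_lt {S T : Letter ι} (h : S.head < T.head) : S.key < T.key :=
  Prod.Lex.lt_iff.2 (Or.inl h)

theorem single_head_lt {S : Letter ι} (h : (S.1.erase S.head).Nonempty) :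
    (single S.head).key < S.key := by
  refine Prod.Lex.lt_iff.2 (Or.inr ⟨head_single _, ?_⟩)
  change ({S.head} : Finset ι).card < S.1.card
  have := Finset.card_erase_add_one S.head_mem
  have := Finset.card_pos.2 h
  rw [Finset.card_singleton]
  omega

theorem eq_single {S : Letter ι} (h : ¬ (S.1.erase S.head).Nonempty) : S = single S.head := by
  refine Subtype.ext ?_
  rw [Finset.not_nonempty_iff_eq_empty, Finset.erase_eq_empty_iff] at h
  exact h.resolve_left S.2.ne_empty

/-- A word without letters of several elements. -/
theorem size_le_length_of_forall (w : List (Letter ι))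
    (h : ¬ ∃ S ∈ w, (S.1.erase S.head).Nonempty) : size w ≤ w.length := by
  induction w with
  | nil => exact le_rfl
  | cons S w ih =>
    have hS := eq_single fun hS => h ⟨S, by simp, hS⟩
    have hc : S.1.card = 1 := by rw [hS]; exact Finset.card_singleton _
    have := ih fun ⟨T, hT, hT'⟩ => h ⟨T, by simp [hT], hT'⟩
    rw [size_cons, List.length_cons]; omega

end Basic

section Contract

variable {ι k : Type*} [LinearOrder ι] [AddCommGroup k]

/-- The exterior part of the cobar differential: consecutive letters of a word are merged if they
are disjoint. -/
def extDiff : List (Letter ι) → (List (Letter ι) → k) → k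
  | [], _ => 0
  | [_], _ => 0
  | S :: T :: l, F => (if Disjoint S.1 T.1 then F (S.union T :: l) else 0) +
      extDiff (T :: l) fun l' => F (S :: l')

/-- The contracting homotopy: the least element of the first letter that is not a singleton is
split off, provided that the least elements of the letters up to this one decrease weakly, starting
below `b`. -/
def contract : List (Letter ι) → ι → (List (Letter ι) → k) → k
  | [], _, _ => 0
  | S :: l, b, F =>
      if S.head ≤ b then
        if h : (S.1.erase S.head).Nonempty then F (single S.head :: ⟨_, h⟩ :: l)
        else contract l S.head fun l' => F (S :: l')
      else 0

variable {Δ : Type*} [AddCommMonoid Δ]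

/-- The value of the homotopy at a word is zero or a value at a word with one more letter, the same
size, and the same degree. -/
theorem contract_mem (A : AddSubgroup k) (deg : ι → Δ) (l : List (Letter ι)) (b : ι)
    (F : List (Letter ι) → k)
    (h : ∀ w, w.length = l.length + 1 → size w = size l → degree deg w = degree deg l → F w ∈ A) :
    contract l b F ∈ A := by
  induction l generalizing b F with
  | nil => exact zero_mem _
  | cons S l ih =>
    rw [contract]
    split_ifs with h1 h2
    · refine h _ rfl ?_ ?_
      · have := Finset.card_erase_add_one S.head_mem
        simp only [size_cons, single, Finset.card_singleton]
        omega
      · simp only [degree_cons, single, Finset.sum_singleton]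
        rw [← add_assoc, Finset.add_sum_erase _ _ S.head_mem]
    · refine ih _ _ fun w hw hs hd => h _ ?_ ?_ ?_
      · rw [List.length_cons, hw, List.length_cons]
      · rw [size_cons, size_cons, hs]
      · rw [degree_cons, degree_cons, hd]
    · exact zero_mem _

theorem contract_eq_zero (l : List (Letter ι)) (b : ι) (F : List (Letter ι) → k)
    (h : ∀ w, w.length = l.length + 1 → size w = size l → F w = 0) : contract l b F = 0 :=
  (AddSubgroup.mem_bot).1 (contract_mem ⊥ (fun _ => (0 : ℕ)) l b F fun w hw hs _ =>
    (AddSubgroup.mem_bot).2 (h w hw hs))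

theorem contract_add (l : List (Letter ι)) (b : ι) (F G : List (Letter ι) → k) :
    contract l b (fun w => F w + G w) = contract l b F + contract l b G := by
  induction l generalizing b F G with
  | nil => exact (add_zero _).symm
  | cons S l ih =>
    simp only [contract]
    split_ifs
    · rfl
    · exact ih _ _ _
    · exact (add_zero _).symm

theorem contract_of_lt {S : Letter ι} {b : ι} (h : b < S.head) (l : List (Letter ι))
    (F : List (Letter ι) → k) : contract (S :: l) b F = 0 := by
  rw [contract, if_neg (not_le.2 h)]

theorem contract_single {i b : ι} (h : i ≤ b) (l : List (Letter ι)) (F : List (Letter ι) → k) :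
    contract (single i :: l) b F = contract l i fun l' => F (single i :: l') := by
  rw [contract, head_single, if_pos h, dif_neg]
  rw [single, Finset.erase_singleton]
  exact Finset.not_nonempty_empty

theorem extDiff_zero (l : List (Letter ι)) : extDiff l (fun _ => (0 : k)) = 0 := by
  induction l with
  | nil => rfl
  | cons S l ih =>
    cases l with
    | nil => rfl
    | cons T l => rw [extDiff, ih, ite_self, add_zero]

/-- `F` vanishes on the words that have the length and the size of `w` and precede it in the
lexicographic order. -/
def VanishesBelow (F : List (Letter ι) → k) (w : List (Letter ι)) : Prop :=
  ∀ w', w'.length = w.length → size w' = size w →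
    List.Lex (· < ·) (w'.map key) (w.map key) → F w' = 0

theorem VanishesBelow.tail {F : List (Letter ι) → k} {S : Letter ι} {w : List (Letter ι)}
    (h : VanishesBelow F (S :: w)) : VanishesBelow (fun l' => F (S :: l')) w := fun w' hl hs hw' =>
  h (S :: w') (by rw [List.length_cons, hl, List.length_cons]) (by rw [size_cons, size_cons, hs])
    (List.Lex.cons hw')

theorem VanishesBelow.eq_zero {F : List (Letter ι) → k} {S S' : Letter ι} {w w' : List (Letter ι)}
    (h : VanishesBelow F (S :: w)) (hS : S'.key < S.key) (hw : w'.length = w.length)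
    (hs : size (S' :: w') = size (S :: w)) : F (S' :: w') = 0 :=
  h (S' :: w') (by rw [List.length_cons, hw, List.length_cons]) hs (List.Lex.rel hS)

/-- If `F` vanishes below `w`, then splitting off the least element of a letter larger than the
first letter of `w` gives zero. -/
theorem VanishesBelow.contract_eq_zero {F : List (Letter ι) → k} {S S' T : Letter ι}
    {l : List (Letter ι)} (h : VanishesBelow F (S :: T :: l))
    (hS : (single S'.head).key < S.key) (hne : (S'.1.erase S'.head).Nonempty)
    (hc : S'.1.card = S.1.card + T.1.card) (b : ι) :
    contract (S' :: l) b F = 0 := by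
  rw [contract]
  split_ifs
  · refine h.eq_zero hS rfl ?_
    have := card_erase_head S'
    simp only [size_cons, card_single]
    omega
  · rfl

theorem erase_union_nonempty {S T : Letter ι} (hST : Disjoint S.1 T.1) (i : ι) :
    ((S.union T).1.erase i).Nonempty := by
  have h1 := Finset.card_pos.2 S.2
  have h2 := Finset.card_pos.2 T.2
  have h3 := card_union hST
  have h4 := Finset.pred_card_le_card_erase (s := (S.union T).1) (a := i)
  exact Finset.card_pos.1 (by omega)

/-- The leading terms of the homotopy formula. For a word `w` such that `F` vanishes below `w`, the
value at `w` of `extDiff (contract F)` is zero if the first letter of `w` begins above `b`, and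
otherwise `contract` is a contracting homotopy at `w`, unless all letters are singletons. -/
theorem extDiff_contract (hk : ∀ x : k, x + x = 0) (w : List (Letter ι)) (b : ι)
    (F : List (Letter ι) → k) (hF : VanishesBelow F w) :
    ((∀ S ∈ w.head?, b < S.head) → extDiff w (fun u => contract u b F) = 0) ∧
    ((∀ S ∈ w.head?, S.head ≤ b) → (∃ S ∈ w, (S.1.erase S.head).Nonempty) →
      extDiff w (fun u => contract u b F) + contract w b (fun u => extDiff u F) = F w) := by
  have hdisj : ∀ S : Letter ι, Disjoint (single S.head).1 (S.1.erase S.head) := fun S =>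
    Finset.disjoint_singleton_left.2 (Finset.notMem_erase _ _)
  have hunion : ∀ {S : Letter ι} {hS : (S.1.erase S.head).Nonempty},
      (single S.head).union ⟨_, hS⟩ = S := fun {S hS} =>
    Subtype.ext (Finset.insert_erase S.head_mem)
  induction w generalizing b F with
  | nil => exact ⟨fun _ => rfl, fun _ ⟨S, hS, _⟩ => absurd hS List.not_mem_nil⟩
  | cons S l ih =>
    cases l with
    | nil =>
      refine ⟨fun _ => rfl, fun hb ⟨S', hS', hne⟩ => ?_⟩
      obtain rfl := List.mem_singleton.1 hS'
      have hb' : S'.head ≤ b := hb S' rfl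
      rw [contract, if_pos hb', dif_pos hne, extDiff, extDiff, zero_add, extDiff, add_zero,
        if_pos (hdisj S'), hunion]
    | cons T l =>
      refine ⟨fun hb => ?_, fun hb hne => ?_⟩
      · have hb' : b < S.head := hb S rfl
        have h0 : (fun l' => contract (S :: l') b F) = fun _ => 0 :=
          funext fun l' => contract_of_lt hb' l' F
        rw [extDiff, h0, extDiff_zero, add_zero]
        split_ifs with hd
        · rcases lt_or_ge b (S.union T).head with h | h
          · exact contract_of_lt h _ _
          · refine hF.contract_eq_zero (key_lt_of_head_lt ?_) (erase_union_nonempty hd _)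
                  (card_union hd) b
            rw [head_single]
            exact h.trans_lt hb'
        · rfl
      · have hb' : S.head ≤ b := hb S rfl
        by_cases hS : (S.1.erase S.head).Nonempty
        -- The contraction splits `S`, and merging the two parts again gives the value at `w`.
        · have h0 : (fun l' => contract (S :: l') b F) =
              fun l' => F (single S.head :: ⟨_, hS⟩ :: l') :=
            funext fun l' => by rw [contract, if_pos hb', dif_pos hS]
          have h1 : (if Disjoint S.1 T.1 then contract (S.union T :: l) b F else 0) = 0 := by
            split_ifs with hd
            · refine hF.contract_eq_zero ?_ (erase_union_nonempty hd _) (card_union hd) b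
              rcases min_choice S.head T.head with h | h <;> rw [head_union, h]
              · exact single_head_lt hS
              · have hlt : T.head < S.head := lt_of_le_of_ne (min_eq_right_iff.1 h)
                  fun he => Finset.disjoint_left.1 hd (he ▸ S.head_mem) T.head_mem
                exact key_lt_of_head_lt (by rwa [head_single])
            · rfl
          have h2 : (if Disjoint (S.1.erase S.head) T.1 then
              F (single S.head :: union ⟨_, hS⟩ T :: l) else 0) = 0 := by
            split_ifs with hd
            · refine hF.eq_zero (w' := union _ T :: l) (single_head_lt hS) rfl ?_
              have := card_erase_head S
              have := card_union (S := ⟨_, hS⟩) hd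
              simp only [size_cons, card_single] at this ⊢
              omega
            · rfl
          rw [contract, if_pos hb', dif_pos hS, extDiff, h0, h1, zero_add, extDiff,
            if_pos (hdisj S), hunion, extDiff, h2, zero_add, add_left_comm, hk, add_zero]
        -- The letter `S` is a single generator `j`, and the contraction is applied to the rest.
        · obtain ⟨j, rfl⟩ : ∃ j, S = single j := ⟨_, eq_single hS⟩
          rw [head_single] at hb'
          obtain ⟨U, hU, hUne⟩ := hne
          have hne' : ∃ S ∈ T :: l, (S.1.erase S.head).Nonempty := by
            rcases List.mem_cons.1 hU with rfl | hU
            · exact absurd hUne hS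
            · exact ⟨U, hU, hUne⟩
          have hlt : ∀ U : Letter ι, U.head ≤ j → Disjoint (single j).1 U.1 →
              ((single j).union U).head < j := by
            intro U hU hd
            rw [head_union, head_single, min_eq_right hU]
            refine lt_of_le_of_ne hU fun he => ?_
            exact Finset.disjoint_left.1 hd (Finset.mem_singleton_self j) (he ▸ U.head_mem)
          have hkey : ∀ U : Letter ι, U.head ≤ j → Disjoint (single j).1 U.1 →
              ((single j).union U).key < (single j).key := fun U hU hd =>
            key_lt_of_head_lt (by rw [head_single j]; exact hlt U hU hd)
          let E : List (Letter ι) → k := fun u => match u with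
            | [] => 0
            | U :: u => if Disjoint (single j).1 U.1 then F ((single j).union U :: u) else 0
          have hE : (fun l' => extDiff (single j :: l') F) =
              fun l' => E l' + extDiff l' fun u => F (single j :: u) := by
            funext l'
            cases l' with
            | nil => exact (add_zero _).symm
            | cons U u => rfl
          have h0 : (fun l' => contract (single j :: l') b F) =
              fun l' => contract l' j fun u => F (single j :: u) :=
            funext fun l' => contract_single hb' l' F
          obtain ⟨ih1, ih2⟩ := ih j _ hF.tail
          rw [extDiff, h0, contract_single hb', hE, contract_add]
          rcases le_or_gt T.head j with hT | hT
          · have h1 : (if Disjoint (single j).1 T.1 then contract ((single j).union T :: l) b F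
                else 0) = 0 := by
              split_ifs with hd
              · refine hF.contract_eq_zero (key_lt_of_head_lt ?_) (erase_union_nonempty hd _)
                  (card_union hd) b
                rw [head_single, head_single]
                exact hlt T hT hd
              · rfl
            have h2 : contract (T :: l) j E = 0 := by
              rw [contract, if_pos hT]
              split_ifs with h
              · simp only [E]
                split_ifs with hd
                · refine hF.eq_zero (hkey _ (by rwa [head_single]) hd) rfl ?_
                  have := card_erase_head T
                  simp only [size_cons, card_union hd, card_single]
                  omega
                · rfl
              · refine Letter.contract_eq_zero _ _ _ fun w hw hsz => ?_
                simp only [E]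
                split_ifs with hd
                · refine hF.eq_zero (hkey _ hT hd) hw ?_
                  have : T.1.card = 1 := by rw [eq_single h]; exact card_single _
                  simp only [size_cons, card_union hd, card_single, hsz]
                  omega
                · rfl
            rw [h1, h2, zero_add, zero_add]
            exact ih2 (by simpa using hT) hne'
          -- If `j` precedes the letter `T`, then the value at `w` arises from merging `j` and `T`
          -- and splitting the result again.
          · have hjT : j ∉ T.1 := fun h => absurd (T.head_le h) (not_le.2 hT)
            have hd : Disjoint (single j).1 T.1 := Finset.disjoint_singleton_left.2 hjT
            have hh : ((single j).union T).head = j := by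
              rw [head_union, head_single, min_eq_left hT.le]
            have hT' : (⟨_, erase_union_nonempty hd ((single j).union T).head⟩ : Letter ι) = T := by
              refine Subtype.ext ?_
              rw [hh]
              exact Finset.erase_insert hjT
            rw [ih1 (by simpa using hT), contract_of_lt hT, contract_of_lt hT, if_pos hd, contract,
              hh, if_pos hb', add_zero, add_zero, add_zero]
            rw [hh] at hT'
            rw [dif_pos (hh ▸ erase_union_nonempty hd _), hT']

end Contract

end Letter

namespace Letter

/-! ### Acyclicity of the cochains that vanish on the words in the generators -/

section WordDiff

variable {ι k : Type*} [Fintype ι] [CommRing k]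
  (c : Letter ι → Letter ι → Letter ι → k)

/-- The cobar differential in coordinates: `c S T R` is the coefficient of the letter `R` in the
product of the letters `S` and `T`. -/
def wordDiff : List (Letter ι) → (List (Letter ι) → k) → k
  | [], _ => 0
  | [_], _ => 0
  | S :: T :: l, F => ∑ R, c S T R * F (R :: l) + wordDiff (T :: l) fun l' => F (S :: l')

theorem wordDiff_add (w : List (Letter ι)) (F G : List (Letter ι) → k) :
    wordDiff c w (fun u => F u + G u) = wordDiff c w F + wordDiff c w G := by
  induction w generalizing F G with
  | nil => exact (add_zero _).symm
  | cons S l ih =>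
    cases l with
    | nil => exact (add_zero _).symm
    | cons T l =>
      simp only [wordDiff, ih, mul_add, Finset.sum_add_distrib]
      ring

theorem wordDiff_mem {Δ : Type*} [AddCommMonoid Δ] {deg : ι → Δ} {G : Δ → AddSubgroup k}
    (hG : ∀ S T R e x, x ∈ G (e + ∑ i ∈ R.1, deg i) →
      c S T R * x ∈ G (e + (∑ i ∈ S.1, deg i + ∑ i ∈ T.1, deg i)))
    (w : List (Letter ι)) (F : List (Letter ι) → k) (e : Δ)
    (hF : ∀ u, F u ∈ G (e + degree deg u)) : wordDiff c w F ∈ G (e + degree deg w) := by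
  induction w generalizing F e with
  | nil => exact zero_mem _
  | cons S l ih =>
    cases l with
    | nil => exact zero_mem _
    | cons T l =>
      rw [wordDiff]
      refine add_mem (sum_mem fun R _ => ?_) ?_
      · have h := hG S T R (e + degree deg l) (F (R :: l)) (by
          have := hF (R :: l)
          rwa [degree_cons, add_comm (∑ i ∈ R.1, deg i), ← add_assoc] at this)
        rw [degree_cons, degree_cons]
        convert h using 2
        abel
      · have h := ih (fun l' => F (S :: l')) (e + ∑ i ∈ S.1, deg i) fun u => by
          have := hF (S :: u)
          rwa [degree_cons, ← add_assoc] at this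
        rwa [degree_cons, ← add_assoc]

variable {c} [LinearOrder ι]
  (hlead : ∀ S T R : Letter ι, S.1.card + T.1.card ≤ R.1.card →
    c S T R = if Disjoint S.1 T.1 ∧ R = S.union T then 1 else 0)

include hlead

theorem wordDiff_eq_extDiff (w : List (Letter ι)) (F : List (Letter ι) → k)
    (h : ∀ u, u.length + 1 = w.length → size u < size w → F u = 0) :
    wordDiff c w F = extDiff w F := by
  induction w generalizing F with
  | nil => rfl
  | cons S l ih =>
    cases l with
    | nil => rfl
    | cons T l =>
      rw [wordDiff, extDiff, ih _ fun u hu hs => h _ (by simp [hu]) (by simpa [size_cons] using hs)]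
      congr 1
      have hR : ∀ R : Letter ι, c S T R * F (R :: l) =
          if Disjoint S.1 T.1 ∧ R = S.union T then F (R :: l) else 0 := by
        intro R
        rcases lt_or_ge R.1.card (S.1.card + T.1.card) with hlt | hle
        · rw [h (R :: l) rfl (by simp only [size_cons]; omega), mul_zero, ite_self]
        · rw [hlead S T R hle, ite_mul, one_mul, zero_mul]
      simp only [hR, ite_and]
      by_cases hd : Disjoint S.1 T.1
      · simp [hd]
      · simp [hd]

theorem wordDiff_eq_zero (w : List (Letter ι)) (F : List (Letter ι) → k)
    (h : ∀ u, u.length + 1 = w.length → size u ≤ size w → F u = 0) : wordDiff c w F = 0 := by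
  induction w generalizing F with
  | nil => rfl
  | cons S l ih =>
    cases l with
    | nil => rfl
    | cons T l =>
      rw [wordDiff, ih _ fun u hu hs => h _ (by simp [hu]) (by simpa [size_cons] using hs),
        add_zero]
      refine Finset.sum_eq_zero fun R _ => ?_
      rcases le_or_gt R.1.card (S.1.card + T.1.card) with hle | hlt
      · rw [h (R :: l) rfl (by simp only [size_cons]; omega), mul_zero]
      · rw [hlead S T R hlt.le, if_neg, zero_mul]
        rintro ⟨-, rfl⟩
        exact absurd hlt (not_lt.2 (Finset.card_union_le _ _))

/-- A cochain of degree `n` that is a cocycle and vanishes on the words in the generators is the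
coboundary of a cochain that vanishes on the words in the generators. The words are ordered by their
size and then lexicographically, and subtracting the coboundary of the contraction increases the
rank of the first word on which the cochain does not vanish. -/
theorem exists_wordDiff_eq [OrderTop ι] (hk : ∀ x : k, x + x = 0)
    (hdd : ∀ w F, wordDiff c w (fun u => wordDiff c u F) = 0)
    {Δ : Type*} [AddCommMonoid Δ] {deg : ι → Δ} {G : Δ → AddSubgroup k}
    (hG : ∀ S T R e x, x ∈ G (e + ∑ i ∈ R.1, deg i) →
      c S T R * x ∈ G (e + (∑ i ∈ S.1, deg i + ∑ i ∈ T.1, deg i)))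
    (n : ℕ) (F : List (Letter ι) → k) (hF : ∀ w, F w ∈ G (degree deg w))
    (hs : ∀ w, w.length = n → size w ≤ n → F w = 0)
    (hd : ∀ w, w.length = n + 1 → wordDiff c w F = 0) :
    ∃ H : List (Letter ι) → k, (∀ u, H u ∈ G (degree deg u)) ∧
      (∀ u, u.length + 1 = n → size u ≤ n → H u = 0) ∧
      ∀ w, w.length = n → F w = wordDiff c w H := by
  let κ : List (Letter ι) → ℕ ×ₗ List (ι ×ₗ ℕ) := fun w => toLex (size w, w.map key)
  let K : Finset (ℕ ×ₗ List (ι ×ₗ ℕ)) := (List.finite_length_eq (Letter ι) n).toFinset.image κ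
  let rank : List (Letter ι) → ℕ := fun w => (K.filter (· < κ w)).card
  have hrank : ∀ u w, u.length = n → κ u < κ w → rank u < rank w := by
    intro u w hu huw
    refine Finset.card_lt_card ((Finset.ssubset_iff_of_subset ?_).2 ⟨κ u, ?_, by simp⟩)
    · intro x hx
      rw [Finset.mem_filter] at hx ⊢
      exact ⟨hx.1, hx.2.trans huw⟩
    · rw [Finset.mem_filter]
      exact ⟨Finset.mem_image_of_mem _ ((Set.Finite.mem_toFinset _).2 hu), huw⟩
  have hwd : ∀ (w : List (Letter ι)) (H : List (Letter ι) → k), (∀ u, H u ∈ G (degree deg u)) →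
      wordDiff c w H ∈ G (degree deg w) := by
    intro w H hH
    have := wordDiff_mem c hG w H 0 fun u => by rw [zero_add]; exact hH u
    rwa [zero_add] at this
  suffices h : ∀ m : ℕ, ∃ H : List (Letter ι) → k, (∀ u, H u ∈ G (degree deg u)) ∧
      (∀ u, u.length + 1 = n → size u ≤ n → H u = 0) ∧
      ∀ w, w.length = n → rank w < m → F w = wordDiff c w H by
    obtain ⟨H, h1, h2, h3⟩ := h (K.card + 1)
    exact ⟨H, h1, h2, fun w hw => h3 w hw (Nat.lt_succ_of_le (Finset.card_filter_le _ _))⟩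
  intro m
  induction m with
  | zero =>
    exact ⟨fun _ => 0, fun _ => zero_mem _, fun _ _ _ => rfl, fun _ _ h => absurd h (by omega)⟩
  | succ m ih =>
    obtain ⟨H, h1, h2, h3⟩ := ih
    let F' : List (Letter ι) → k := fun w => F w + wordDiff c w H
    have hF' : ∀ w, F' w ∈ G (degree deg w) := fun w => add_mem (hF w) (hwd w H h1)
    have hF'm : ∀ w, w.length = n → rank w < m → F' w = 0 := fun w hw hr => by
      simp only [F']
      rw [h3 w hw hr, hk]
    have hF's : ∀ w, w.length = n → size w ≤ n → F' w = 0 := fun w hw hsz => by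
      simp only [F']
      rw [hs w hw hsz, zero_add]
      exact wordDiff_eq_zero hlead w H fun u hu hsu => h2 u (by omega) (hsu.trans hsz)
    have hF'd : ∀ w, w.length = n + 1 → wordDiff c w F' = 0 := fun w hw => by
      rw [wordDiff_add, hd w hw, hdd, add_zero]
    let H' : List (Letter ι) → k := fun u => contract u ⊤ F'
    have hH's : ∀ u, u.length + 1 = n → size u ≤ n → H' u = 0 := fun u hu hsu =>
      Letter.contract_eq_zero u ⊤ F' fun w hw hsw => hF's w (by omega) (by omega)
    refine ⟨fun u => H u + H' u, fun u => add_mem (h1 u) ?_, fun u hu hsu => ?_, fun w hw hr => ?_⟩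
    · exact contract_mem _ deg u ⊤ F' fun w _ _ hw => hw ▸ hF' w
    · simp only [h2 u hu hsu, hH's u hu hsu, add_zero]
    · rw [wordDiff_add]
      suffices h : F' w = wordDiff c w H' by
        rw [← h]
        simp only [F']
        rw [add_left_comm, hk, add_zero]
      by_cases hne : ∃ S ∈ w, (S.1.erase S.head).Nonempty
      · have hbelow : ∀ u, u.length = n → κ u < κ w → F' u = 0 := fun u hu huw =>
          hF'm u hu (by have := hrank u w hu huw; omega)
        have hsize : ∀ u, u.length = n → size u < size w → F' u = 0 := fun u hu huw =>
          hbelow u hu (Prod.Lex.lt_iff.2 (Or.inl huw))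
        have hv : VanishesBelow F' w := fun u hu hsu hlex =>
          hbelow u (by omega) (Prod.Lex.lt_iff.2 (Or.inr ⟨hsu, hlex⟩))
        have key := (extDiff_contract hk w ⊤ F' hv).2 (fun _ _ => le_top) hne
        have hz : contract w ⊤ (fun u => extDiff u F') = 0 :=
          Letter.contract_eq_zero _ _ _ fun u hu hsu => by
            rw [← wordDiff_eq_extDiff hlead u F' fun v hv hsv => hsize v (by omega) (by omega)]
            exact hF'd u (by omega)
        rw [hz, add_zero] at key
        rw [← key, wordDiff_eq_extDiff hlead w H' fun u hu hsu =>
          Letter.contract_eq_zero _ _ _ fun v hv hsv => hsize v (by omega) (by omega)]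
      · have hsw := size_le_length_of_forall w hne
        rw [hF's w hw (by omega)]
        exact (wordDiff_eq_zero hlead w H' fun u hu hsu => hH's u (by omega) (by omega)).symm

end WordDiff

end Letter

/-! ### Sorting the words in the generators -/

/-- The words of length `n` in the generators. -/
def words (ι : Type*) [Fintype ι] (n : ℕ) : Finset (List ι) :=
  (List.finite_length_eq ι n).toFinset

theorem mem_words {ι : Type*} [Fintype ι] {n : ℕ} {w : List ι} : w ∈ words ι n ↔ w.length = n :=
  Set.Finite.mem_toFinset _

namespace Letter

section Sorting

variable {ι k : Type*} [Fintype ι] [CommRing k] {c : Letter ι → Letter ι → Letter ι → k}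

theorem wordDiff_zero (w : List (Letter ι)) : wordDiff c w (fun _ => 0) = 0 := by
  have h := wordDiff_add c w (fun _ => 0) fun _ => 0
  simpa using h

theorem wordDiff_sum {α : Type*} (s : Finset α) (w : List (Letter ι))
    (F : α → List (Letter ι) → k) :
    wordDiff c w (fun u => ∑ a ∈ s, F a u) = ∑ a ∈ s, wordDiff c w (F a) := by
  classical
  induction s using Finset.induction_on with
  | empty => simpa using wordDiff_zero w
  | insert a s ha ih => simp only [Finset.sum_insert ha, wordDiff_add, ih]

variable [LinearOrder ι]
  (hlead : ∀ S T R : Letter ι, S.1.card + T.1.card ≤ R.1.card →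
    c S T R = if Disjoint S.1 T.1 ∧ R = S.union T then 1 else 0)

include hlead

/-- The coboundary of the cochain dual to a word with a single letter of two elements, on the words
in the generators. -/
theorem wordDiff_pair {i j : ι} (hij : i ≠ j) (u v : List ι) (a : k) (w : List ι) :
    wordDiff c (w.map single) (fun y =>
      if y = u.map single ++ (single i).union (single j) :: v.map single then a else 0) =
      (if w = u ++ i :: j :: v then a else 0) + if w = u ++ j :: i :: v then a else 0 := by
  have hd : ∀ {x y : ι}, Disjoint (single x).1 (single y).1 ↔ x ≠ y := fun {x y} => by
    simp [single]
  have hcard : ((single i).union (single j)).1.card = 2 := by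
    rw [card_union (hd.2 hij)]; rfl
  have hne : ∀ x, single x ≠ (single i).union (single j) := fun x h => by
    have := congrArg (fun S : Letter ι => S.1.card) h
    simp only [hcard, card_single] at this
    omega
  induction u generalizing w with
  | nil =>
    rcases w with - | ⟨x, - | ⟨y, l⟩⟩
    · simp [wordDiff]
    · simp [wordDiff]
    · simp only [List.map_cons, List.map_nil, List.nil_append, wordDiff, List.cons.injEq, hne,
        false_and, if_false, wordDiff_zero, add_zero, List.map_inj_right single_injective]
      have h1 : ∀ R : Letter ι, c (single x) (single y) R *
          (if R = (single i).union (single j) ∧ l = v then a else 0) =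
          if R = (single i).union (single j) then
            (c (single x) (single y) ((single i).union (single j)) * if l = v then a else 0)
          else 0 := by
        intro R
        by_cases hR : R = (single i).union (single j)
        · simp [hR]
        · simp [hR]
      rw [Finset.sum_congr rfl fun R _ => h1 R, Finset.sum_ite_eq' Finset.univ,
        if_pos (Finset.mem_univ _), hlead _ _ _ (by rw [hcard, card_single, card_single])]
      have h2 : (single i).union (single j) = (single x).union (single y) ↔
          (x = i ∧ y = j) ∨ (x = j ∧ y = i) := by
        rw [Subtype.ext_iff]
        change ({i} ∪ {j} : Finset ι) = {x} ∪ {y} ↔ _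
        constructor
        · intro h
          have hx : x ∈ ({i} ∪ {j} : Finset ι) := by rw [h]; simp
          have hy : y ∈ ({i} ∪ {j} : Finset ι) := by rw [h]; simp
          have hi : i ∈ ({x} ∪ {y} : Finset ι) := by rw [← h]; simp
          have hj : j ∈ ({x} ∪ {y} : Finset ι) := by rw [← h]; simp
          simp only [Finset.mem_union, Finset.mem_singleton] at hx hy hi hj
          grind
        · rintro (⟨rfl, rfl⟩ | ⟨rfl, rfl⟩)
          · rfl
          · rw [Finset.union_comm]
      simp only [hd, h2]
      by_cases hl : l = v
      · grind
      · simp [hl]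
  | cons p u ih =>
    rcases w with - | ⟨x, - | ⟨y, l⟩⟩
    · simp [wordDiff]
    · simp [wordDiff]
    · have h0 : ∀ R : Letter ι, ¬ (R = single p ∧
          l.map single = u.map single ++ (single i).union (single j) :: v.map single) := by
        rintro R ⟨-, h⟩
        have hm : (single i).union (single j) ∈ l.map single := by rw [h]; simp
        obtain ⟨z, -, hz⟩ := List.mem_map.1 hm
        exact hne z hz
      simp only [List.map_cons, List.cons_append, wordDiff, List.cons.injEq, h0, if_false, mul_zero,
        Finset.sum_const_zero, zero_add]
      by_cases hx : x = p
      · subst hx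
        simp only [true_and]
        exact ih (y :: l)
      · have hx' : single x ≠ single p := fun h => hx (single_injective h)
        simp only [hx, hx', false_and, if_false, wordDiff_zero, add_zero]

variable {Δ : Type*} [AddCommMonoid Δ] {deg : ι → Δ} {G : Δ → AddSubgroup k}

/-- Permuting the letters of a word in the generators changes the dual cochain by a coboundary, as
far as the values on the words in the generators are concerned. -/
theorem exists_wordDiff_perm (hk : ∀ x : k, x + x = 0) {w w' : List ι} (h : w.Perm w')
    (u : List ι) (a : k) (ha : a ∈ G ((u ++ w).map deg).sum) :
    ∃ H : List (Letter ι) → k, (∀ y, H y ∈ G (degree deg y)) ∧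
      (∀ x : List ι, H (x.map single) = 0) ∧
      ∀ x : List ι, wordDiff c (x.map single) H =
        (if x = u ++ w then a else 0) + if x = u ++ w' then a else 0 := by
  induction h generalizing u with
  | nil =>
    exact ⟨fun _ => 0, fun _ => zero_mem _, fun _ => rfl, fun x => by rw [wordDiff_zero, hk]⟩
  | cons p h ih =>
    obtain ⟨H, h1, h2, h3⟩ := ih (u ++ [p]) (by rwa [List.append_assoc])
    refine ⟨H, h1, h2, fun x => ?_⟩
    rw [h3, List.append_assoc, List.append_assoc]; rfl
  | swap i j l =>
    by_cases hij : j = i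
    · subst hij
      exact ⟨fun _ => 0, fun _ => zero_mem _, fun _ => rfl, fun x => by rw [wordDiff_zero, hk]⟩
    · refine ⟨_, fun y => ?_, fun x => ?_, wordDiff_pair hlead hij u l a⟩
      · split_ifs with hy
        · rw [hy]
          have hd : Disjoint ({j} : Finset ι) {i} := by simpa using hij
          have : degree deg (u.map single ++ (single j).union (single i) :: l.map single) =
              ((u ++ j :: i :: l).map deg).sum := by
            rw [degree, List.map_append, List.sum_append, ← degree, degree_map_single,
              List.map_cons, List.sum_cons, ← degree, degree_map_single, List.map_append,
              List.sum_append, List.map_cons, List.sum_cons, List.map_cons, List.sum_cons]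
            change _ + (∑ i ∈ {j} ∪ {i}, deg i + _) = _
            rw [Finset.sum_union hd, Finset.sum_singleton, Finset.sum_singleton, add_assoc (deg j)]
          rwa [this]
        · exact zero_mem _
      · refine if_neg fun hx => ?_
        have h1 := size_map_single x
        have h2 : (single j).union (single i) ∈ x.map single := by rw [hx]; simp
        obtain ⟨z, -, hz⟩ := List.mem_map.1 h2
        have h3 := congrArg (fun S : Letter ι => S.1.card) hz
        have h4 : ((single j).union (single i)).1.card = 2 := by
          rw [card_union (by simpa [single] using hij)]; rfl
        simp only [h4, card_single] at h3
        omega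
  | trans h h' ih ih' =>
    obtain ⟨H, h1, h2, h3⟩ := ih u ha
    obtain ⟨H', h1', h2', h3'⟩ := ih' u (by
      rwa [← ((h.append_left u).map deg).sum_eq])
    refine ⟨fun y => H y + H' y, fun y => add_mem (h1 y) (h1' y),
      fun x => by simp only [h2, h2', add_zero], fun x => ?_⟩
    rw [wordDiff_add, h3, h3', add_assoc, ← add_assoc (ite _ a 0) (ite _ a 0) (ite _ a 0), hk,
      zero_add]

/-- If the sums of the values of a cochain over the words in the generators with given letters are
zero, then on the words in the generators it agrees with the coboundary of a cochain that vanishes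
on the words in the generators. -/
theorem exists_wordDiff_eq_on_single (hk : ∀ x : k, x + x = 0) (n : ℕ) (F : List (Letter ι) → k)
    (hF : ∀ w, F w ∈ G (degree deg w))
    (hsum : ∀ s : Multiset ι, ∑ w ∈ (words ι n).filter
      fun w : List ι => (w : Multiset ι) = s, F (w.map single) = 0) :
    ∃ H : List (Letter ι) → k, (∀ y, H y ∈ G (degree deg y)) ∧
      (∀ x : List ι, H (x.map single) = 0) ∧
      ∀ x : List ι, x.length = n → F (x.map single) = wordDiff c (x.map single) H := by
  have hperm : ∀ w : List ι, w.Perm (w : Multiset ι).sort := fun w =>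
    Multiset.coe_eq_coe.1 (Multiset.sort_eq _ _).symm
  choose H h1 h2 h3 using fun w : List ι => exists_wordDiff_perm (G := G) hlead hk (hperm w) []
    (F (w.map single)) (by have := hF (w.map single); rwa [degree_map_single] at this)
  refine ⟨fun y => ∑ w ∈ words ι n, H w y,
    fun y => sum_mem fun w _ => h1 w y, fun x => Finset.sum_eq_zero fun w _ => h2 w x,
    fun x hx => ?_⟩
  rw [wordDiff_sum]
  simp only [h3, List.nil_append]
  rw [Finset.sum_add_distrib, Finset.sum_ite_eq, if_pos (mem_words.2 hx)]
  have h4 : ∑ w ∈ words ι n,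
      (if x = (w : Multiset ι).sort then F (w.map single) else 0) = 0 := by
    by_cases hs : x = (x : Multiset ι).sort
    · refine Eq.trans ?_ (hsum x)
      rw [Finset.sum_filter]
      refine Finset.sum_congr rfl fun w _ => ?_
      congr 1
      refine propext ⟨fun h => ?_, fun h => by rw [h]; exact hs⟩
      rw [h, Multiset.sort_eq]
    · refine Finset.sum_eq_zero fun w _ => if_neg fun h => hs ?_
      conv_rhs => rw [h, Multiset.sort_eq]
      exact h
  rw [h4, add_zero]

end Sorting

end Letter

/-! ### Cochains in coordinates -/

/-- The cobar differential squares to zero, as the product is associative. -/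
theorem WordFun.diff_diff {X k : Type*} [CommRing k] (hk : ∀ x : k, x + x = 0) {μ : X → X → X}
    (hμ : ∀ x y z, μ (μ x y) z = μ x (μ y z)) (f : WordFun X k) (l : List X) :
    diff μ (diff μ f) l = 0 := by
  induction l generalizing f with
  | nil => rfl
  | cons x l ih =>
    rcases l with - | ⟨y, - | ⟨z, l⟩⟩
    · rfl
    · rw [diff_cons_cons, diff_single, zero_add, diff_single]
    · let A : WordFun X k := ⟨fun u => match u with
        | [] => 0
        | y :: u => f (μ x y :: u)⟩
      have hA : shift x (diff μ f) = A + diff μ (shift x f) := ext' fun u => by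
        cases u with
        | nil => exact (add_zero _).symm
        | cons y u => exact diff_cons_cons μ f x y u
      have hA' : shift y A = shift (μ x y) f := rfl
      have hA'' : A (μ y z :: l) = f (μ x (μ y z) :: l) := rfl
      rw [diff_cons_cons, hA, map_add, add_apply, ih, add_zero, diff_cons_cons, diff_cons_cons, hA',
        hA'', hμ, hk]

section Coordinates

variable {k B : Type*} [CommRing k] [Ring B] [Algebra k B] {ε : B →ₐ[k] k}

/-- The functions on words in the augmentation ideal that are linear in each letter. -/
structure IsMultilinear (f : WordFun (AugIdeal ε) k) : Prop where
  add : ∀ l₁ l₂ x y, f (l₁ ++ (x + y) :: l₂) = f (l₁ ++ x :: l₂) + f (l₁ ++ y :: l₂)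
  smul : ∀ l₁ l₂ (r : k) x, f (l₁ ++ (r • x) :: l₂) = r * f (l₁ ++ x :: l₂)

theorem mem_cobar_iff {f : WordFun (AugIdeal ε) k} :
    f ∈ cobar ε ↔ IsMultilinear f ∧ ∃ N : ℕ, ∀ l : List (AugIdeal ε), N < l.length → f l = 0 :=
  ⟨fun h => ⟨⟨h.1, h.2.1⟩, h.2.2⟩, fun h => ⟨h.1.1, h.1.2, h.2⟩⟩

namespace IsMultilinear

variable {f : WordFun (AugIdeal ε) k}

theorem shift (hf : IsMultilinear f) (x : AugIdeal ε) : IsMultilinear (WordFun.shift x f) :=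
  ⟨fun l₁ => hf.add (x :: l₁), fun l₁ => hf.smul (x :: l₁)⟩

theorem shift_add (hf : IsMultilinear f) (x y : AugIdeal ε) :
    WordFun.shift (x + y) f = WordFun.shift x f + WordFun.shift y f :=
  WordFun.ext' fun l => hf.add [] l x y

theorem shift_smul (hf : IsMultilinear f) (r : k) (x : AugIdeal ε) :
    WordFun.shift (r • x) f = r • WordFun.shift x f :=
  WordFun.ext' fun l => hf.smul [] l r x

/-- The linear map that inserts a first letter. -/
def shiftHom (hf : IsMultilinear f) : AugIdeal ε →ₗ[k] WordFun (AugIdeal ε) k where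
  toFun x := WordFun.shift x f
  map_add' := hf.shift_add
  map_smul' := hf.shift_smul

theorem augMul_add (x y z : AugIdeal ε) : augMul ε x (y + z) = augMul ε x y + augMul ε x z :=
  Subtype.ext (mul_add (x : B) y z)

theorem add_augMul (x y z : AugIdeal ε) : augMul ε (x + y) z = augMul ε x z + augMul ε y z :=
  Subtype.ext (add_mul (x : B) y z)

theorem augMul_smul (r : k) (x y : AugIdeal ε) : augMul ε x (r • y) = r • augMul ε x y :=
  Subtype.ext (mul_smul_comm r (x : B) (y : B))

theorem smul_augMul (r : k) (x y : AugIdeal ε) : augMul ε (r • x) y = r • augMul ε x y :=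
  Subtype.ext (smul_mul_assoc r (x : B) (y : B))

/-- The coboundary of a multilinear cochain is multilinear. -/
theorem diff (hf : IsMultilinear f) : IsMultilinear (WordFun.diff (augMul ε) f) := by
  have hsm : ∀ (r : k) (f g : WordFun (AugIdeal ε) k) l, (r • f + g) l = r * f l + g l :=
    fun _ _ _ _ => rfl
  constructor
  · intro l₁
    induction l₁ generalizing f with
    | nil =>
      intro l₂ x y
      cases l₂ with
      | nil => exact (add_zero _).symm
      | cons z l =>
        simp only [List.nil_append, WordFun.diff_cons_cons, hf.shift_add, map_add, add_augMul,
          WordFun.add_apply]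
        have := hf.add [] l (augMul ε x z) (augMul ε y z)
        simp only [List.nil_append] at this
        rw [this]
        ring
    | cons a l₁ ih =>
      intro l₂ x y
      cases l₁ with
      | nil =>
        have h1 := ih (hf.shift a) l₂ x y
        have h2 := hf.add [] l₂ (augMul ε a x) (augMul ε a y)
        simp only [List.nil_append, List.cons_append, WordFun.diff_cons_cons, augMul_add] at h1 h2 ⊢
        rw [h1, h2]
        ring
      | cons b l =>
        have h1 := ih (hf.shift a) l₂ x y
        have h2 := hf.add (augMul ε a b :: l) l₂ x y
        simp only [List.cons_append, WordFun.diff_cons_cons] at h1 h2 ⊢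
        rw [h1, h2]
        ring
  · intro l₁
    induction l₁ generalizing f with
    | nil =>
      intro l₂ r x
      cases l₂ with
      | nil => exact (mul_zero _).symm
      | cons z l =>
        simp only [List.nil_append, WordFun.diff_cons_cons, hf.shift_smul, map_smul, smul_augMul,
          WordFun.smul_apply]
        have := hf.smul [] l r (augMul ε x z)
        simp only [List.nil_append] at this
        rw [this]
        ring
    | cons a l₁ ih =>
      intro l₂ r x
      cases l₁ with
      | nil =>
        have h1 := ih (hf.shift a) l₂ r x
        have h2 := hf.smul [] l₂ r (augMul ε a x)
        simp only [List.nil_append, List.cons_append, WordFun.diff_cons_cons, augMul_smul]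
          at h1 h2 ⊢
        rw [h1, h2]
        ring
      | cons b l =>
        have h1 := ih (hf.shift a) l₂ r x
        have h2 := hf.smul (augMul ε a b :: l) l₂ r x
        simp only [List.cons_append, WordFun.diff_cons_cons] at h1 h2 ⊢
        rw [h1, h2]
        ring

end IsMultilinear

theorem diff_apply_eq_zero {f : WordFun (AugIdeal ε) k} {n : ℕ}
    (h : ∀ l, l.length = n → f l = 0) (l : List (AugIdeal ε)) (hl : l.length = n + 1) :
    WordFun.diff (augMul ε) f l = 0 := by
  induction l generalizing f n with
  | nil => rfl
  | cons x l ih =>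
    cases l with
    | nil => rfl
    | cons y l =>
      cases n with
      | zero => simp at hl
      | succ n =>
        rw [WordFun.diff_cons_cons, h _ (by simpa using hl), zero_add]
        exact ih (f := WordFun.shift x f) (n := n)
          (fun l hl => h (x :: l) (by rw [List.length_cons, hl])) (by simpa using hl)

theorem diff_mem_cobar {f : WordFun (AugIdeal ε) k} (hf : f ∈ cobar ε) :
    WordFun.diff (augMul ε) f ∈ cobar ε := by
  obtain ⟨hm, N, hN⟩ := mem_cobar_iff.1 hf
  refine mem_cobar_iff.2 ⟨hm.diff, N + 1, fun l hl => ?_⟩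
  exact diff_apply_eq_zero (n := l.length - 1) (fun u hu => hN u (by omega)) l (by omega)

variable {ι : Type*} [Fintype ι] (β : Module.Basis (Letter ι) k (AugIdeal ε))

/-- The structure constants of the augmentation ideal. -/
def structureConst (S T R : Letter ι) : k := β.repr (augMul ε (β S) (β T)) R

/-- The multilinear extension of a function on the words in the basis. -/
def extendWord : (List (Letter ι) → k) → List (AugIdeal ε) → k
  | F, [] => F []
  | F, x :: l => ∑ S, β.repr x S * extendWord (fun u => F (S :: u)) l

/-- The multilinear cochain with given values on the words in the basis. -/
def extendFun (F : List (Letter ι) → k) : WordFun (AugIdeal ε) k := ⟨extendWord β F⟩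

theorem extendFun_cons (F : List (Letter ι) → k) (x : AugIdeal ε) (l : List (AugIdeal ε)) :
    extendFun β F (x :: l) = ∑ S, β.repr x S * extendFun β (fun u => F (S :: u)) l := rfl

theorem extendFun_map (F : List (Letter ι) → k) (w : List (Letter ι)) :
    extendFun β F (w.map β) = F w := by
  induction w generalizing F with
  | nil => rfl
  | cons S w ih =>
    rw [List.map_cons, extendFun_cons, Finset.sum_eq_single S, ih, Module.Basis.repr_self,
      Finsupp.single_eq_same, one_mul]
    · intro T _ hT
      rw [Module.Basis.repr_self, Finsupp.single_eq_of_ne hT, zero_mul]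
    · exact fun h => absurd (Finset.mem_univ S) h

theorem isMultilinear_extendFun (F : List (Letter ι) → k) : IsMultilinear (extendFun β F) := by
  constructor
  · intro l₁
    induction l₁ generalizing F with
    | nil =>
      intro l₂ x y
      simp only [List.nil_append, extendFun_cons, map_add, Finsupp.add_apply, add_mul,
        Finset.sum_add_distrib]
    | cons a l₁ ih =>
      intro l₂ x y
      simp only [List.cons_append, extendFun_cons, ih, mul_add, Finset.sum_add_distrib]
  · intro l₁
    induction l₁ generalizing F with
    | nil =>
      intro l₂ r x
      simp only [List.nil_append, extendFun_cons, map_smul, Finsupp.smul_apply, smul_eq_mul,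
        mul_assoc, Finset.mul_sum]
    | cons a l₁ ih =>
      intro l₂ r x
      simp only [List.cons_append, extendFun_cons, ih, Finset.mul_sum, mul_left_comm]

theorem extendFun_eq_zero {n : ℕ} (F : List (Letter ι) → k) (h : ∀ w, w.length = n → F w = 0)
    (l : List (AugIdeal ε)) (hl : l.length = n) : extendFun β F l = 0 := by
  induction l generalizing n F with
  | nil => exact h [] hl
  | cons x l ih =>
    cases n with
    | zero => simp at hl
    | succ n =>
      rw [extendFun_cons]
      refine Finset.sum_eq_zero fun S _ => ?_
      rw [ih (n := n) (fun u => F (S :: u)) (fun w hw => h _ (by rw [List.length_cons, hw]))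
        (by simpa using hl), mul_zero]

theorem extendFun_mem_cobar (F : List (Letter ι) → k) (N : ℕ) (h : ∀ w, N < w.length → F w = 0) :
    extendFun β F ∈ cobar ε :=
  mem_cobar_iff.2 ⟨isMultilinear_extendFun β F, N, fun l hl =>
    extendFun_eq_zero β F (fun w hw => h w (by omega)) l rfl⟩

namespace IsMultilinear

variable {f : WordFun (AugIdeal ε) k}

theorem apply_cons (hf : IsMultilinear f) (x : AugIdeal ε) (l : List (AugIdeal ε)) :
    f (x :: l) = ∑ S, β.repr x S * f (β S :: l) := by
  have h : WordFun.shift x f = ∑ S, β.repr x S • WordFun.shift (β S) f := by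
    change hf.shiftHom x = ∑ S, β.repr x S • hf.shiftHom (β S)
    conv_lhs => rw [← β.sum_repr x]
    rw [map_sum]
    simp only [map_smul]
  have hs : ∀ (s : Finset (Letter ι)) (g : Letter ι → WordFun (AugIdeal ε) k),
      (∑ S ∈ s, g S) l = ∑ S ∈ s, g S l := by
    intro s g
    classical
    induction s using Finset.induction_on with
    | empty => rfl
    | insert a s ha ih => rw [Finset.sum_insert ha, Finset.sum_insert ha, WordFun.add_apply, ih]
  change WordFun.shift x f l = _
  rw [h, hs]
  rfl

/-- A multilinear cochain is determined by its values on the words in the basis. -/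
theorem eq_extendFun (hf : IsMultilinear f) : f = extendFun β fun w => f (w.map β) := by
  refine WordFun.ext' fun l => ?_
  induction l generalizing f with
  | nil => rfl
  | cons x l ih =>
    rw [hf.apply_cons β, extendFun_cons]
    refine Finset.sum_congr rfl fun S _ => ?_
    congr 1
    exact ih (hf.shift (β S))

theorem diff_map (hf : IsMultilinear f) (w : List (Letter ι)) :
    WordFun.diff (augMul ε) f (w.map β) =
      Letter.wordDiff (structureConst β) w fun u => f (u.map β) := by
  induction w generalizing f with
  | nil => rfl
  | cons S w ih =>
    cases w with
    | nil => rfl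
    | cons T w =>
      rw [List.map_cons, List.map_cons, WordFun.diff_cons_cons, hf.apply_cons β, Letter.wordDiff]
      congr 1
      exact ih (hf.shift (β S))

end IsMultilinear

/-- The differential in coordinates squares to zero, because it computes the cobar differential. -/
theorem wordDiff_wordDiff (hk : ∀ x : k, x + x = 0) (w : List (Letter ι))
    (F : List (Letter ι) → k) : Letter.wordDiff (structureConst β) w
      (fun u => Letter.wordDiff (structureConst β) u F) = 0 := by
  have h := isMultilinear_extendFun β F
  have h1 : (fun u => Letter.wordDiff (structureConst β) u F) =
      fun u => WordFun.diff (augMul ε) (extendFun β F) (u.map β) := by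
    funext u
    rw [h.diff_map β]
    simp only [extendFun_map]
  rw [h1, ← h.diff.diff_map β]
  exact WordFun.diff_diff hk (fun x y z => Subtype.ext (mul_assoc (x : B) y z)) _ _

end Coordinates

/-! ### The map from the cobar complex to the polynomial ring -/

theorem Letter.wordDiff_congr {ι k : Type*} [Fintype ι] [CommRing k]
    {c : Letter ι → Letter ι → Letter ι → k} (w : List (Letter ι)) {F G : List (Letter ι) → k}
    (h : ∀ u, u.length + 1 = w.length → F u = G u) : wordDiff c w F = wordDiff c w G := by
  induction w generalizing F G with
  | nil => rfl
  | cons S l ih =>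
    cases l with
    | nil => rfl
    | cons T l =>
      rw [wordDiff, wordDiff, ih (F := fun u => F (S :: u)) (G := fun u => G (S :: u))
        fun u hu => h _ (by rw [List.length_cons, hu]; rfl)]
      congr 1
      exact Finset.sum_congr rfl fun R _ => by rw [h (R :: l) rfl]

section Symbol

variable {k B ι : Type*} [CommRing k] [Ring B] [Algebra k B] {ε : B →ₐ[k] k} [Fintype ι]
  (β : Module.Basis (Letter ι) k (AugIdeal ε))

/-- The element of the augmentation ideal that corresponds to the generator `i`. -/
def letterGen (i : ι) : AugIdeal ε := β (Letter.single i)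

/-- The symbol of the component of degree `n` of a cochain: the sum, over the words of length `n` in
the generators, of the values of the cochain times the products of the variables. -/
def symbolPart : ℕ → WordFun (AugIdeal ε) k →ₗ[k] MvPolynomial ι k
  | 0 =>
    { toFun := fun f => MvPolynomial.C (f [])
      map_add' := fun _ _ => map_add MvPolynomial.C _ _
      map_smul' := fun r f => (map_mul MvPolynomial.C r (f [])).trans
        (MvPolynomial.smul_eq_C_mul _ r).symm }
  | n + 1 =>
    { toFun := fun f => ∑ i, MvPolynomial.X i * symbolPart n (WordFun.shift (letterGen β i) f)
      map_add' := fun f g => by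
        rw [← Finset.sum_add_distrib]
        refine Finset.sum_congr rfl fun i _ => ?_
        rw [← mul_add, ← map_add]; rfl
      map_smul' := fun r f => by
        rw [RingHom.id_apply, Finset.smul_sum]
        refine Finset.sum_congr rfl fun i _ => ?_
        rw [← mul_smul_comm, ← map_smul]; rfl }

theorem symbolPart_zero (f : WordFun (AugIdeal ε) k) :
    symbolPart β 0 f = MvPolynomial.C (f []) := rfl

theorem symbolPart_succ (n : ℕ) (f : WordFun (AugIdeal ε) k) : symbolPart β (n + 1) f =
    ∑ i, MvPolynomial.X i * symbolPart β n (WordFun.shift (letterGen β i) f) := rfl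

theorem symbolPart_mul (n : ℕ) (f g : WordFun (AugIdeal ε) k) : symbolPart β n (f * g) =
    ∑ p ∈ Finset.HasAntidiagonal.antidiagonal n, symbolPart β p.1 f * symbolPart β p.2 g := by
  induction n generalizing f with
  | zero => simp [symbolPart_zero, WordFun.mul_nil]
  | succ n ih =>
    rw [Finset.Nat.sum_antidiagonal_succ, symbolPart_zero, symbolPart_succ]
    simp only [WordFun.shift_mul, map_add, map_smul, ih, mul_add, Finset.sum_add_distrib]
    congr 1
    · rw [symbolPart_succ, Finset.mul_sum]
      refine Finset.sum_congr rfl fun i _ => ?_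
      rw [MvPolynomial.smul_eq_C_mul, mul_left_comm]
    · simp only [symbolPart_succ, Finset.mul_sum, Finset.sum_mul]
      rw [Finset.sum_comm]
      refine Finset.sum_congr rfl fun p _ => Finset.sum_congr rfl fun i _ => ?_
      rw [mul_assoc]

theorem symbolPart_one (n : ℕ) :
    symbolPart β n (1 : WordFun (AugIdeal ε) k) = if n = 0 then 1 else 0 := by
  cases n with
  | zero => exact map_one MvPolynomial.C
  | succ n =>
    rw [symbolPart_succ, if_neg (Nat.succ_ne_zero n)]
    refine Finset.sum_eq_zero fun i _ => ?_
    rw [WordFun.shift_one, map_zero, mul_zero]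

theorem symbolPart_eq_zero {n : ℕ} {f : WordFun (AugIdeal ε) k}
    (h : ∀ l, l.length = n → f l = 0) : symbolPart β n f = 0 := by
  induction n generalizing f with
  | zero => rw [symbolPart_zero, h [] rfl, map_zero]
  | succ n ih =>
    rw [symbolPart_succ]
    refine Finset.sum_eq_zero fun i _ => ?_
    rw [ih (f := WordFun.shift (letterGen β i) f)
      fun l hl => h (_ :: l) (by rw [List.length_cons, hl]), mul_zero]

theorem sum_words_succ {M : Type*} [AddCommMonoid M] (n : ℕ) (φ : List ι → M) :
    ∑ w ∈ words ι (n + 1), φ w = ∑ i, ∑ w ∈ words ι n, φ (i :: w) := by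
  rw [← Finset.sum_product']
  symm
  refine Finset.sum_bij (fun p _ => p.1 :: p.2) ?_ ?_ ?_ fun _ _ => rfl
  · rintro ⟨i, w⟩ h
    rw [Finset.mem_product, mem_words] at h
    exact mem_words.2 (by rw [List.length_cons, h.2])
  · rintro ⟨i, w⟩ - ⟨j, v⟩ - h
    obtain ⟨rfl, rfl⟩ := List.cons_eq_cons.1 h
    rfl
  · intro w hw
    rw [mem_words] at hw
    cases w with
    | nil => simp at hw
    | cons i w =>
      exact ⟨(i, w), Finset.mem_product.2 ⟨Finset.mem_univ _, mem_words.2 (by simpa using hw)⟩, rfl⟩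

theorem symbolPart_eq_sum [DecidableEq ι] (n : ℕ) (f : WordFun (AugIdeal ε) k) :
    symbolPart β n f = ∑ w ∈ words ι n,
      MvPolynomial.monomial (Multiset.toFinsupp (w : Multiset ι)) (f (w.map (letterGen β))) := by
  induction n generalizing f with
  | zero =>
    have : words ι 0 = {[]} := by
      ext w
      rw [mem_words, List.length_eq_zero_iff, Finset.mem_singleton]
    rw [this, Finset.sum_singleton, symbolPart_zero]
    rfl
  | succ n ih =>
    rw [sum_words_succ, symbolPart_succ]
    refine Finset.sum_congr rfl fun i _ => ?_
    rw [ih, Finset.mul_sum]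
    refine Finset.sum_congr rfl fun w _ => ?_
    rw [MvPolynomial.X, MvPolynomial.monomial_mul, one_mul, ← Multiset.cons_coe,
      ← Multiset.singleton_add, map_add, Multiset.toFinsupp_singleton]
    rfl

theorem coeff_symbolPart [DecidableEq ι] (n : ℕ) (f : WordFun (AugIdeal ε) k) (s : Multiset ι) :
    (symbolPart β n f).coeff (Multiset.toFinsupp s) =
      ∑ w ∈ (words ι n).filter fun w : List ι => (w : Multiset ι) = s,
        f (w.map (letterGen β)) := by
  rw [symbolPart_eq_sum, MvPolynomial.coeff_sum, Finset.sum_filter]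
  refine Finset.sum_congr rfl fun w _ => ?_
  simp only [MvPolynomial.coeff_monomial, EmbeddingLike.apply_eq_iff_eq]

theorem coeff_symbolPart_of_ne [DecidableEq ι] {n : ℕ} (f : WordFun (AugIdeal ε) k)
    {s : Multiset ι} (h : s.card ≠ n) :
    (symbolPart β n f).coeff (Multiset.toFinsupp s) = 0 := by
  rw [coeff_symbolPart]
  refine Finset.sum_eq_zero fun w hw => ?_
  rw [Finset.mem_filter, mem_words] at hw
  exact absurd (by rw [← hw.2, Multiset.coe_card, hw.1]) h

/-- The symbol is compatible with the differentials, because the derivation `D` is dual to the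
product of the generators. -/
theorem symbolPart_diff {D : Derivation k (MvPolynomial ι k) (MvPolynomial ι k)}
    (hD : ∀ φ : AugIdeal ε →ₗ[k] MvPolynomial ι k,
      ∑ i, ∑ j, MvPolynomial.X i * MvPolynomial.X j * φ (augMul ε (letterGen β i) (letterGen β j)) =
        ∑ l, D (MvPolynomial.X l) * φ (letterGen β l))
    (n : ℕ) {f : WordFun (AugIdeal ε) k} (hf : IsMultilinear f) :
    symbolPart β (n + 1) (WordFun.diff (augMul ε) f) = D (symbolPart β n f) := by
  induction n generalizing f with
  | zero =>
    rw [symbolPart_zero, symbolPart_succ]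
    refine (Finset.sum_eq_zero fun i _ => ?_).trans (D.map_algebraMap _).symm
    rw [symbolPart_zero, WordFun.shift_apply, WordFun.diff_single, map_zero, mul_zero]
  | succ n ih =>
    have h1 : ∀ i, symbolPart β (n + 1)
        (WordFun.shift (letterGen β i) (WordFun.diff (augMul ε) f)) =
        (∑ j, MvPolynomial.X j * symbolPart β n
          (WordFun.shift (augMul ε (letterGen β i) (letterGen β j)) f)) +
        D (symbolPart β n (WordFun.shift (letterGen β i) f)) := by
      intro i
      rw [← ih (hf.shift _), symbolPart_succ, symbolPart_succ, ← Finset.sum_add_distrib]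
      refine Finset.sum_congr rfl fun j _ => ?_
      rw [← mul_add, ← map_add]
      congr 2
      exact WordFun.ext' fun l => WordFun.diff_cons_cons _ f _ _ l
    have h2 := hD ((symbolPart β n).comp hf.shiftHom)
    rw [symbolPart_succ β (n + 1), symbolPart_succ β n, map_sum]
    simp only [h1, mul_add, Finset.sum_add_distrib, Derivation.leibniz, smul_eq_mul, Finset.mul_sum,
      ← mul_assoc]
    rw [add_comm]
    congr 1
    refine h2.trans (Finset.sum_congr rfl fun l _ => ?_)
    exact mul_comm _ _

/-- The symbols of the components of a cochain, as a polynomial in an additional variable that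
records the degree. -/
def symbolPoly (f : cobar ε) : (MvPolynomial ι k)[X] :=
  ∑ n ∈ Finset.range ((mem_cobar_iff.1 f.2).2.choose + 1), monomial n (symbolPart β n f)

theorem coeff_symbolPoly (f : cobar ε) (n : ℕ) : (symbolPoly β f).coeff n = symbolPart β n f := by
  have hN := (mem_cobar_iff.1 f.2).2.choose_spec
  rw [symbolPoly, finsetSum_coeff]
  simp only [coeff_monomial]
  rw [Finset.sum_ite_eq']
  split_ifs with h
  · rfl
  · refine (symbolPart_eq_zero β fun l hl => hN l ?_).symm
    rw [Finset.mem_range] at h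
    omega

/-- The symbol of a cochain, a homomorphism from the cobar complex to the polynomial ring: the sum
of the symbols of its components. -/
def symbol : cobar ε →ₐ[k] MvPolynomial ι k :=
  ((aeval (1 : MvPolynomial ι k)).restrictScalars k).comp
    (AlgHom.ofLinearMap (R := k) (A := cobar ε) (B := (MvPolynomial ι k)[X])
      { toFun := symbolPoly β
        map_add' := fun f g => by
          ext1 n
          rw [coeff_add, coeff_symbolPoly, coeff_symbolPoly, coeff_symbolPoly, ← map_add]; rfl
        map_smul' := fun r f => by
          ext1 n
          rw [coeff_smul, coeff_symbolPoly, coeff_symbolPoly, RingHom.id_apply, ← map_smul]; rfl }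
      (by
        ext1 n
        refine (coeff_symbolPoly β 1 n).trans ?_
        rw [coeff_one]
        exact symbolPart_one β n)
      (fun f g => by
        ext1 n
        refine (coeff_symbolPoly β (f * g) n).trans ?_
        change _ = (symbolPoly β f * symbolPoly β g).coeff n
        rw [coeff_mul]
        simp only [coeff_symbolPoly]
        exact symbolPart_mul β n f g))

theorem symbol_eq_sum (f : cobar ε) (N : ℕ)
    (hN : ∀ l, N ≤ l.length → (f : WordFun (AugIdeal ε) k) l = 0) :
    symbol β f = ∑ n ∈ Finset.range N, symbolPart β n f := by
  have h : symbol β f = aeval (1 : MvPolynomial ι k) (symbolPoly β f) := rfl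
  have h1 : symbolPoly β f = ∑ n ∈ Finset.range N, monomial n (symbolPart β n f) := by
    ext1 n
    rw [coeff_symbolPoly, finsetSum_coeff]
    simp only [coeff_monomial]
    rw [Finset.sum_ite_eq']
    split_ifs with h
    · rfl
    · refine symbolPart_eq_zero β fun l hl => hN l ?_
      rw [Finset.mem_range] at h
      omega
  rw [h, h1, map_sum]
  refine Finset.sum_congr rfl fun n _ => ?_
  rw [aeval_monomial, one_pow, mul_one]; rfl

theorem coeff_symbol [DecidableEq ι] (f : cobar ε) (s : Multiset ι) :
    (symbol β f).coeff (Multiset.toFinsupp s) =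
      ∑ w ∈ (words ι s.card).filter fun w : List ι => (w : Multiset ι) = s,
        (f : WordFun (AugIdeal ε) k) (w.map (letterGen β)) := by
  obtain ⟨N, hN⟩ := (mem_cobar_iff.1 f.2).2
  rw [symbol_eq_sum β f (N + 1) fun l hl => hN l hl, MvPolynomial.coeff_sum, ← coeff_symbolPart]
  refine (Finset.sum_eq_single s.card (fun n _ hn => coeff_symbolPart_of_ne β _ hn.symm)
    fun h => ?_)
  rw [Finset.mem_range] at h
  rw [symbolPart_eq_zero β fun l hl => hN l (by omega), MvPolynomial.coeff_zero]

theorem symbol_diff {D : Derivation k (MvPolynomial ι k) (MvPolynomial ι k)}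
    (hD : ∀ φ : AugIdeal ε →ₗ[k] MvPolynomial ι k,
      ∑ i, ∑ j, MvPolynomial.X i * MvPolynomial.X j * φ (augMul ε (letterGen β i) (letterGen β j)) =
        ∑ l, D (MvPolynomial.X l) * φ (letterGen β l)) (f : cobar ε) :
    symbol β ⟨WordFun.diff (augMul ε) f, diff_mem_cobar f.2⟩ = D (symbol β f) := by
  obtain ⟨hm, N, hN⟩ := mem_cobar_iff.1 f.2
  rw [symbol_eq_sum β f (N + 1) fun l hl => hN l hl, symbol_eq_sum β _ (N + 2) fun l hl =>
    diff_apply_eq_zero (n := l.length - 1) (fun u hu => hN u (by omega)) l (by omega),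
    Finset.sum_range_succ', map_sum]
  refine (congrArg₂ _ (Finset.sum_congr rfl fun n _ => symbolPart_diff β hD n hm) ?_).trans
    (add_zero _)
  rw [symbolPart_zero, WordFun.diff_nil, map_zero]

end Symbol

/-! ### The cohomology of the cobar complex -/

/-- A basis of the augmentation ideal, indexed by the nonempty sets of generators, for which the
product is that of an exterior algebra up to terms with fewer generators, together with the
derivation of the polynomial ring that is dual to the products of two generators. -/
structure IsKoszulBasis {k B ι : Type*} [CommRing k] [Ring B] [Algebra k B] {ε : B →ₐ[k] k}
    [Fintype ι] [LinearOrder ι] (β : Module.Basis (Letter ι) k (AugIdeal ε))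
    (D : Derivation k (MvPolynomial ι k) (MvPolynomial ι k)) : Prop where
  lead : ∀ S T R : Letter ι, S.1.card + T.1.card ≤ R.1.card →
    structureConst β S T R = if Disjoint S.1 T.1 ∧ R = S.union T then 1 else 0
  bracket : ∀ φ : AugIdeal ε →ₗ[k] MvPolynomial ι k,
    ∑ i, ∑ j, MvPolynomial.X i * MvPolynomial.X j * φ (augMul ε (letterGen β i) (letterGen β j)) =
      ∑ l, D (MvPolynomial.X l) * φ (letterGen β l)

section

variable {k B ι : Type*} [CommRing k] [Ring B] [Algebra k B] {ε : B →ₐ[k] k}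

/-- The multiset of the generators that occur in the letters of a word. -/
def content (w : List (Letter ι)) : Multiset ι := (w.map fun S => S.1.val).sum

theorem content_map_single (u : List ι) : content (u.map Letter.single) = u := by
  induction u with
  | nil => rfl
  | cons i u ih =>
    rw [← Multiset.cons_coe, ← ih, ← Multiset.singleton_add]
    rfl

variable [Fintype ι] {β : Module.Basis (Letter ι) k (AugIdeal ε)}

theorem IsMultilinear.eq_of_map {f g : WordFun (AugIdeal ε) k} (hf : IsMultilinear f)
    (hg : IsMultilinear g) (h : ∀ w : List (Letter ι), f (w.map β) = g (w.map β)) : f = g := by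
  rw [hf.eq_extendFun β, hg.eq_extendFun β]
  simp only [h]

variable [LinearOrder ι] {Δ : Type*} [AddCommMonoid Δ] {deg : ι → Δ} {G : Δ → AddSubgroup k}

/-- A cocycle with symbol zero is a coboundary, in coordinates. Here `G δ` contains the values that
are allowed at the words of degree `δ`; it serves to keep track of the grading. -/
theorem exists_primitive [OrderTop ι] (hk : ∀ x : k, x + x = 0)
    (hlead : ∀ S T R : Letter ι, S.1.card + T.1.card ≤ R.1.card →
      structureConst β S T R = if Disjoint S.1 T.1 ∧ R = S.union T then 1 else 0)
    (hG : ∀ S T R e x, x ∈ G (e + ∑ i ∈ R.1, deg i) →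
      structureConst β S T R * x ∈ G (e + (∑ i ∈ S.1, deg i + ∑ i ∈ T.1, deg i)))
    (F : List (Letter ι) → k) (hF : ∀ w, F w ∈ G (Letter.degree deg w))
    (hd : ∀ w, Letter.wordDiff (structureConst β) w F = 0)
    (hsum : ∀ (n : ℕ) (s : Multiset ι), ∑ w ∈ (words ι n).filter
      fun w : List ι => (w : Multiset ι) = s, F (w.map Letter.single) = 0) :
    ∃ H : List (Letter ι) → k, (∀ u, H u ∈ G (Letter.degree deg u)) ∧
      (∀ u : List ι, H (u.map Letter.single) = 0) ∧
      (∀ w, F w = Letter.wordDiff (structureConst β) w H) ∧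
      ∀ n, (∀ w, w.length = n + 1 → F w = 0) → ∀ u, u.length = n → H u = 0 := by
  have key : ∀ n : ℕ, ∃ H : List (Letter ι) → k, (∀ u, H u ∈ G (Letter.degree deg u)) ∧
      (∀ u : List ι, u.length + 1 = n → H (u.map Letter.single) = 0) ∧
      ∀ w, w.length = n → F w = Letter.wordDiff (structureConst β) w H := by
    intro n
    obtain ⟨H, h1, h2, h3⟩ := Letter.exists_wordDiff_eq_on_single (G := G) hlead hk n F hF (hsum n)
    have hwd := fun w => Letter.wordDiff_mem _ hG w H 0 fun u => by rw [zero_add]; exact h1 u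
    obtain ⟨H', h1', h2', h3'⟩ := Letter.exists_wordDiff_eq hlead hk (wordDiff_wordDiff β hk) hG n
      (fun w => F w + Letter.wordDiff (structureConst β) w H)
      (fun w => add_mem (hF w) (by have := hwd w; rwa [zero_add] at this))
      (fun w hw hs => by
        obtain ⟨u, rfl⟩ := Letter.exists_eq_map_single w (by omega)
        rw [h3 u (by simpa using hw), hk])
      (fun w _ => by rw [Letter.wordDiff_add, hd, wordDiff_wordDiff β hk, add_zero])
    refine ⟨fun u => H u + H' u, fun u => add_mem (h1 u) (h1' u), fun u hu => ?_, fun w hw => ?_⟩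
    · simp only [h2]
      rw [h2' _ (by simpa using hu) (by rw [Letter.size_map_single]; omega), add_zero]
    · rw [Letter.wordDiff_add, ← h3' w hw, add_left_comm, hk, add_zero]
  choose H h1 h2 h3 using key
  classical
  -- The primitive is taken to be zero in each degree in which `F` is zero, so that it is supported
  -- in finitely many degrees if `F` is.
  refine ⟨fun u => if ∀ w, w.length = u.length + 1 → F w = 0 then 0 else H (u.length + 1) u,
    fun u => ?_, fun u => ?_, fun w => ?_, fun n hn u hu => if_pos (by rwa [hu])⟩
  · dsimp only
    split_ifs
    · exact zero_mem _
    · exact h1 _ u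
  · dsimp only
    split_ifs
    · rfl
    · exact h2 _ u (by rw [List.length_map])
  · by_cases hw : ∀ v, v.length = w.length → F v = 0
    · rw [hw w rfl]
      refine (Letter.wordDiff_zero w).symm.trans
        (Letter.wordDiff_congr w fun u hu => (if_pos ?_).symm)
      rwa [hu]
    · rw [h3 w.length w rfl]
      refine Letter.wordDiff_congr w fun u hu => ?_
      rw [hu, if_neg hw]

/-- Every polynomial is the symbol of a cochain that is supported on the sorted words in the
generators. -/
theorem exists_symbol_eq (β : Module.Basis (Letter ι) k (AugIdeal ε)) (z : MvPolynomial ι k)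
    (hz : ∀ s : Multiset ι, z.coeff (Multiset.toFinsupp s) ∈ G (s.map deg).sum) :
    ∃ (F : List (Letter ι) → k) (N : ℕ) (hN : ∀ w, N < w.length → F w = 0),
      (∀ w, F w ∈ G (Letter.degree deg w)) ∧
      symbol β ⟨_, extendFun_mem_cobar β F N hN⟩ = z ∧
      ∀ n, (∀ s : Multiset ι, s.card = n → z.coeff (Multiset.toFinsupp s) = 0) →
        ∀ w, w.length = n → F w = 0 := by
  let F : List (Letter ι) → k := fun w => if w = (content w).sort.map Letter.single then
    z.coeff (Multiset.toFinsupp (content w)) else 0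
  have hF0 : ∀ n, (∀ s : Multiset ι, s.card = n → z.coeff (Multiset.toFinsupp s) = 0) →
      ∀ w, w.length = n → F w = 0 := by
    intro n hn w hw
    simp only [F]
    split_ifs with h
    · refine hn _ ?_
      rw [← hw, h, List.length_map, Multiset.length_sort, ← h]
    · rfl
  have hN : ∀ w, z.totalDegree < w.length → F w = 0 := by
    intro w hw
    refine hF0 w.length (fun s hs => ?_) w rfl
    by_contra hne
    have := MvPolynomial.le_totalDegree (MvPolynomial.mem_support_iff.2 hne)
    have h2 : (Multiset.toFinsupp s).sum (fun _ e => e) = s.card := by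
      have := Finsupp.card_toMultiset (Multiset.toFinsupp s)
      rw [Multiset.toFinsupp_toMultiset] at this
      exact this.symm
    omega
  refine ⟨F, z.totalDegree, hN, fun w => ?_, ?_, hF0⟩
  · simp only [F]
    split_ifs with h
    · have : Letter.degree deg w = ((content w).map deg).sum := by
        conv_lhs => rw [h, Letter.degree_map_single]
        conv_rhs => rw [← Multiset.sort_eq (content w) (· ≤ ·), Multiset.map_coe, Multiset.sum_coe]
      rw [this]
      exact hz _
    · exact zero_mem _
  · refine MvPolynomial.ext _ _ fun e => ?_
    obtain ⟨s, rfl⟩ : ∃ s : Multiset ι, e = Multiset.toFinsupp s :=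
      ⟨Finsupp.toMultiset e, (Finsupp.toMultiset_toFinsupp e).symm⟩
    have hFs : ∀ w : List ι, F (w.map Letter.single) =
        if w = (w : Multiset ι).sort then z.coeff (Multiset.toFinsupp (w : Multiset ι)) else 0 := by
      intro w
      simp only [F, content_map_single, List.map_inj_right Letter.single_injective]
    rw [coeff_symbol]
    have hgen : ∀ w : List ι, extendFun β F (w.map (letterGen β)) = F (w.map Letter.single) := by
      intro w
      rw [← extendFun_map β F, List.map_map]; rfl
    simp only [hgen, hFs]
    rw [Finset.sum_eq_single s.sort]
    · rw [Multiset.sort_eq, if_pos rfl]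
    · intro w hw hne
      rw [Finset.mem_filter] at hw
      rw [if_neg]
      rw [hw.2]
      exact hne
    · intro h
      refine absurd (Finset.mem_filter.2 ⟨mem_words.2 (Multiset.length_sort _), ?_⟩) h
      exact Multiset.sort_eq _ _

variable {D : Derivation k (MvPolynomial ι k) (MvPolynomial ι k)}

/-- The sums that enter into the symbol of a cochain with symbol zero. -/
theorem sum_words_eq_zero (f : cobar ε) (hf : symbol β f = 0) (n : ℕ) (s : Multiset ι) :
    ∑ w ∈ (words ι n).filter fun w : List ι => (w : Multiset ι) = s,
      (f : WordFun (AugIdeal ε) k) ((w.map Letter.single).map β) = 0 := by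
  by_cases h : s.card = n
  · subst h
    have := coeff_symbol β f s
    rw [hf, MvPolynomial.coeff_zero] at this
    rw [this]
    refine Finset.sum_congr rfl fun w _ => ?_
    rw [List.map_map]; rfl
  · refine Finset.sum_eq_zero fun w hw => ?_
    rw [Finset.mem_filter, mem_words] at hw
    exact absurd (by rw [← hw.2, Multiset.coe_card, hw.1]) h

/-- Every cocycle in the polynomial ring is the symbol of a cocycle in the cobar complex, which can
be chosen to have the same degree. -/
theorem IsKoszulBasis.exists_cocycle [OrderTop ι] (hβ : IsKoszulBasis β D) (hk : ∀ x : k, x + x = 0)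
    (hG : ∀ S T R e x, x ∈ G (e + ∑ i ∈ R.1, deg i) →
      structureConst β S T R * x ∈ G (e + (∑ i ∈ S.1, deg i + ∑ i ∈ T.1, deg i)))
    (z : MvPolynomial ι k) (hz : D z = 0)
    (hz' : ∀ s : Multiset ι, z.coeff (Multiset.toFinsupp s) ∈ G (s.map deg).sum) :
    ∃ (F : List (Letter ι) → k) (hF : extendFun β F ∈ cobar ε),
      (∀ w, F w ∈ G (Letter.degree deg w)) ∧
      WordFun.diff (augMul ε) (extendFun β F) = 0 ∧ symbol β ⟨_, hF⟩ = z ∧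
      ∀ n, (∀ s : Multiset ι, s.card = n → z.coeff (Multiset.toFinsupp s) = 0) →
        ∀ w, w.length = n → F w = 0 := by
  obtain ⟨F, N, hN, h1, h2, h3⟩ := exists_symbol_eq β z hz'
  have hm := isMultilinear_extendFun β F
  have hdF : ∀ w, Letter.wordDiff (structureConst β) w F =
      WordFun.diff (augMul ε) (extendFun β F) (w.map β) := by
    intro w
    rw [hm.diff_map β]
    simp only [extendFun_map]
  obtain ⟨H, h1', h2', h3', h4'⟩ := exists_primitive hk hβ.lead hG
    (fun w => Letter.wordDiff (structureConst β) w F)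
    (fun w => by
      have := Letter.wordDiff_mem _ hG w F 0 fun u => by rw [zero_add]; exact h1 u
      rwa [zero_add] at this)
    (fun w => wordDiff_wordDiff β hk w F)
    (fun n s => by
      simp only [hdF]
      refine sum_words_eq_zero (β := β) ⟨_, diff_mem_cobar (extendFun_mem_cobar β F N hN)⟩ ?_ n s
      rw [symbol_diff β hβ.bracket ⟨_, extendFun_mem_cobar β F N hN⟩, h2, hz])
  have hH0 : ∀ n, (∀ w, w.length = n → F w = 0) → ∀ w, w.length = n → H w = 0 := fun n hn =>
    h4' n fun w hw => by
      rw [Letter.wordDiff_congr (G := fun _ => 0) w fun u hu => hn u (by omega),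
        Letter.wordDiff_zero]
  have hHN : ∀ w, N < w.length → H w = 0 := fun w hw =>
    hH0 w.length (fun u hu => hN u (by omega)) w rfl
  have hadd : extendFun β (fun w => F w + H w) = extendFun β F + extendFun β H :=
    IsMultilinear.eq_of_map (β := β) (isMultilinear_extendFun β _)
      (mem_cobar_iff.1 (add_mem (extendFun_mem_cobar β F N hN)
        (extendFun_mem_cobar β H N hHN))).1 fun w => by
        rw [WordFun.add_apply, extendFun_map, extendFun_map, extendFun_map]
  have hmem : extendFun β (fun w => F w + H w) ∈ cobar ε :=
    extendFun_mem_cobar β _ N fun w hw => by rw [hN w hw, hHN w hw, add_zero]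
  refine ⟨fun w => F w + H w, hmem, fun w => add_mem (h1 w) (h1' w), ?_, ?_, fun n hn w hw => ?_⟩
  · refine IsMultilinear.eq_of_map (β := β) (isMultilinear_extendFun β _).diff
      (mem_cobar_iff.1 (zero_mem (cobar ε))).1 fun w => ?_
    rw [(isMultilinear_extendFun β _).diff_map β, WordFun.zero_apply]
    simp only [extendFun_map]
    rw [Letter.wordDiff_add, ← h3', hk]
  · have hs : (⟨_, hmem⟩ : cobar ε) = ⟨_, extendFun_mem_cobar β F N hN⟩ +
        ⟨_, extendFun_mem_cobar β H N hHN⟩ := Subtype.ext hadd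
    rw [hs, map_add, h2]
    refine add_eq_left.2 (MvPolynomial.ext _ _ fun e => ?_)
    obtain ⟨s, rfl⟩ : ∃ s : Multiset ι, e = Multiset.toFinsupp s :=
      ⟨Finsupp.toMultiset e, (Finsupp.toMultiset_toFinsupp e).symm⟩
    rw [coeff_symbol, MvPolynomial.coeff_zero]
    refine Finset.sum_eq_zero fun w _ => ?_
    have hgen : w.map (letterGen β) = (w.map Letter.single).map β := by rw [List.map_map]; rfl
    change extendFun β H _ = 0
    rw [hgen, extendFun_map, h2']
  · dsimp only
    rw [h3 n hn w hw, hH0 n (h3 n hn) w hw, add_zero]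

/-- A cocycle whose symbol is a coboundary is a coboundary. -/
theorem IsKoszulBasis.exists_coboundary [OrderTop ι] (hβ : IsKoszulBasis β D)
    (hk : ∀ x : k, x + x = 0)
    (f : cobar ε) (hf : WordFun.diff (augMul ε) (f : WordFun (AugIdeal ε) k) = 0)
    (p : MvPolynomial ι k) (hp : symbol β f = D p) :
    ∃ y ∈ cobar ε, WordFun.diff (augMul ε) y = f := by
  have hk' : ∀ x : WordFun (AugIdeal ε) k, x + x = 0 := fun x => WordFun.ext' fun l => hk (x l)
  obtain ⟨F, N, hN, -, h2, -⟩ := exists_symbol_eq (G := fun _ : ℕ => ⊤) (deg := fun _ => 0) β p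
    fun _ => AddSubgroup.mem_top _
  let f₀ : cobar ε := ⟨_, extendFun_mem_cobar β F N hN⟩
  let f' : cobar ε := f + ⟨_, diff_mem_cobar f₀.2⟩
  have hf' : symbol β f' = 0 := by
    rw [map_add, symbol_diff β hβ.bracket f₀, h2, hp]
    refine MvPolynomial.ext _ _ fun e => ?_
    rw [MvPolynomial.coeff_add, hk, MvPolynomial.coeff_zero]
  have hdf' : WordFun.diff (augMul ε) (f' : WordFun (AugIdeal ε) k) = 0 := by
    change WordFun.diff (augMul ε) ((f : WordFun (AugIdeal ε) k) +
      WordFun.diff (augMul ε) (f₀ : WordFun (AugIdeal ε) k)) = 0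
    rw [map_add, hf, zero_add]
    exact WordFun.ext' fun l =>
      WordFun.diff_diff hk (fun x y z => Subtype.ext (mul_assoc (x : B) y z)) _ l
  obtain ⟨hm, N', hN'⟩ := mem_cobar_iff.1 f'.2
  obtain ⟨H, -, -, h3, h4⟩ := exists_primitive (β := β) (G := fun _ : ℕ => ⊤) (deg := fun _ => 0) hk
    hβ.lead (fun _ _ _ _ _ _ => AddSubgroup.mem_top _)
    (fun w => (f' : WordFun (AugIdeal ε) k) (w.map β)) (fun _ => AddSubgroup.mem_top _)
    (fun w => by rw [← hm.diff_map β, hdf', WordFun.zero_apply])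
    (fun n s => sum_words_eq_zero f' hf' n s)
  have hH : extendFun β H ∈ cobar ε := extendFun_mem_cobar β H N' fun w hw =>
    h4 w.length (fun v hv => hN' _ (by rw [List.length_map]; omega)) w rfl
  refine ⟨extendFun β H + f₀, add_mem hH f₀.2, ?_⟩
  have h5 : WordFun.diff (augMul ε) (extendFun β H) = f' := by
    refine IsMultilinear.eq_of_map (β := β) (isMultilinear_extendFun β _).diff hm fun w => ?_
    rw [(isMultilinear_extendFun β _).diff_map β, h3]
    simp only [extendFun_map]
  rw [map_add, h5]
  change (f : WordFun (AugIdeal ε) k) + _ + _ = _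
  rw [add_assoc, hk', add_zero]

end

/-! ### The comparison for `Gr A(2)` -/

instance : OrderTop HIndex where
  top := .h30
  le_top i := by cases i <;> decide

theorem letterGen_augBasis (i : HIndex) : (letterGen augBasis i : GrA2) = grGen i := by
  rw [letterGen, coe_augBasis, grMonom_eq_monom]
  change wordProd grGen (Finset.sort {i}) = _
  rw [Finset.sort_singleton, wordProd_cons, wordProd_nil, mul_one]

theorem structureConst_augBasis (S T R : Letter HIndex) :
    structureConst augBasis S T R = grCoord R.1 (grMonom S.1 * grMonom T.1) := by
  rw [structureConst, augBasis_repr]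
  change grCoord R.1 ((augBasis S : GrA2) * (augBasis T : GrA2)) = _
  rw [coe_augBasis, coe_augBasis]

theorem sum_hIndex {M : Type*} [AddCommMonoid M] (f : HIndex → M) :
    ∑ i, f i = f .h10 + (f .h11 + (f .h12 + (f .h20 + (f .h21 + f .h30)))) := by
  have h : (Finset.univ : Finset HIndex) = {.h10, .h11, .h12, .h20, .h21, .h30} := rfl
  rw [h, Finset.sum_insert (by decide), Finset.sum_insert (by decide),
    Finset.sum_insert (by decide), Finset.sum_insert (by decide), Finset.sum_insert (by decide), Finset.sum_singleton]

/-- The nonzero commutators of the generators of `Gr A(2)` are `[h₁₀, h₁₁] = h₂₀`,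
`[h₁₁, h₁₂] = h₂₁` and `[h₁₀, h₂₁] = [h₁₂, h₂₀] = h₃₀`, where a generator stands for the dual
element, and `hDiff` is dual to them; the squares of the generators are zero. -/
theorem isKoszulBasis_augBasis : IsKoszulBasis augBasis hDiff where
  lead S T R h := by
    rw [structureConst_augBasis, grCoord_grMonom_mul _ _ _ h]
    simp only [Subtype.ext_iff, Letter.union]
  bracket φ := by
    obtain ⟨y, hyd⟩ : ∃ y, y = letterGen augBasis := ⟨_, rfl⟩
    have hy : ∀ i, (y i : GrA2) = grGen i := hyd ▸ letterGen_augBasis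
    have key : ∀ i j, i ≤ j → ∀ z : AugIdeal grA2Aug,
        ((HIndex.swapTerms j i).map fun c => if (c.2.map HIndex.may).sum = j.may + i.may then
          τ ^ c.1 • wordProd grGen c.2 else 0).sum = (z : GrA2) →
        φ (augMul grA2Aug (y j) (y i)) = φ z := by
      intro i j hij z hz
      congr 1
      refine Subtype.ext ?_
      rw [← hz, ← grGen_mul i j hij, ← hy, ← hy]; rfl
    have hs : ∀ i, φ (augMul grA2Aug (y i) (y i)) = 0 := by
      intro i
      rw [key i i le_rfl 0 (by cases i <;> simp [HIndex.swapTerms, HIndex.may]), map_zero]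
    have hc : ∀ i j z, i < j → ((HIndex.swapTerms j i).map fun c =>
        if (c.2.map HIndex.may).sum = j.may + i.may then τ ^ c.1 • wordProd grGen c.2 else 0).sum =
          grGen i * grGen j + z → ∀ z' : AugIdeal grA2Aug, (z' : GrA2) = z →
        φ (augMul grA2Aug (y j) (y i)) = φ (augMul grA2Aug (y i) (y j)) + φ z' := by
      rintro i j z hij hz z' rfl
      rw [key i j hij.le (augMul grA2Aug (y i) (y j) + z') (by
        rw [hz, ← hy, ← hy]; rfl), map_add]
    have hd : ∀ i j, i < j → ((HIndex.swapTerms j i).map fun c =>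
        if (c.2.map HIndex.may).sum = j.may + i.may then τ ^ c.1 • wordProd grGen c.2 else 0).sum =
          grGen i * grGen j →
        φ (augMul grA2Aug (y j) (y i)) = φ (augMul grA2Aug (y i) (y j)) := by
      intro i j hij hz
      rw [hc i j 0 hij (by rw [hz, add_zero]) 0 rfl, map_zero, add_zero]
    have hX : ∀ i, hDiff (MvPolynomial.X i) = _ := fun i => MvPolynomial.mkDerivation_X M2 _ i
    have h2 : ∀ x : HPoly, x + x = 0 := fun x => CharTwo.add_self_eq_zero x
    have e1 := hc .h10 .h11 (grGen .h20) (by decide)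
      (by simp [HIndex.swapTerms, HIndex.may, wordProd_cons, wordProd_nil]) (y .h20) (hy _)
    have e2 := hc .h10 .h21 (grGen .h30) (by decide)
      (by simp [HIndex.swapTerms, HIndex.may, wordProd_cons, wordProd_nil]) (y .h30) (hy _)
    have e3 := hc .h11 .h12 (grGen .h21) (by decide)
      (by simp [HIndex.swapTerms, HIndex.may, wordProd_cons, wordProd_nil]) (y .h21) (hy _)
    have e4 := hc .h12 .h20 (grGen .h30) (by decide)
      (by simp [HIndex.swapTerms, HIndex.may, wordProd_cons, wordProd_nil]) (y .h30) (hy _)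
    have f : ∀ c ∈ ([(.h10, .h12), (.h10, .h20), (.h10, .h30), (.h11, .h20), (.h11, .h21),
        (.h11, .h30), (.h12, .h21), (.h12, .h30), (.h20, .h21), (.h20, .h30), (.h21, .h30)] :
          List (HIndex × HIndex)),
        φ (augMul grA2Aug (y c.2) (y c.1)) = φ (augMul grA2Aug (y c.1) (y c.2)) := by
      simp only [List.forall_mem_cons]
      refine ⟨?_, ?_, ?_, ?_, ?_, ?_, ?_, ?_, ?_, ?_, ?_, List.forall_mem_nil _⟩ <;>
        exact hd _ _ (by decide)
          (by simp [HIndex.swapTerms, HIndex.may, wordProd_cons, wordProd_nil])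
    simp only [List.forall_mem_cons] at f
    obtain ⟨f1, f2, f3, f4, f5, f6, f7, f8, f9, f10, f11, -⟩ := f
    simp only [← hyd, sum_hIndex, hX, hs, hvar]
    rw [e1, e2, e3, e4, f1, f2, f3, f4, f5, f6, f7, f8, f9, f10, f11]
    have g : ∀ i j, MvPolynomial.X i * MvPolynomial.X j * φ (augMul grA2Aug (y i) (y j)) +
        MvPolynomial.X i * MvPolynomial.X j * φ (augMul grA2Aug (y i) (y j)) = 0 :=
      fun i j => h2 _
    linear_combination g .h10 .h11 + g .h10 .h12 + g .h10 .h20 + g .h10 .h21 + g .h10 .h30 +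
      g .h11 .h12 + g .h11 .h20 + g .h11 .h21 + g .h11 .h30 + g .h12 .h20 +
      g .h12 .h21 + g .h12 .h30 + g .h20 .h21 + g .h20 .h30 + g .h21 .h30

/-! ### Homogeneous cochains in coordinates -/

theorem M2Homogeneous.mul {m t w m' t' w' : ℤ} {p p' : M2} (h : M2Homogeneous m t w p)
    (h' : M2Homogeneous m' t' w' p') : M2Homogeneous (m + m') (t + t') (w + w') (p * p') := by
  intro n hn
  rw [coeff_mul] at hn
  obtain ⟨x, hx, hx'⟩ := Finset.exists_ne_zero_of_sum_ne_zero hn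
  have h1 := h x.1 (left_ne_zero_of_mul hx')
  have h2 := h' x.2 (right_ne_zero_of_mul hx')
  rw [Finset.HasAntidiagonal.mem_antidiagonal] at hx
  omega

theorem M2Homogeneous.zero (m t w : ℤ) : M2Homogeneous m t w 0 := fun n hn =>
  absurd (coeff_zero n) hn

theorem M2Homogeneous.add {m t w : ℤ} {p p' : M2} (h : M2Homogeneous m t w p)
    (h' : M2Homogeneous m t w p') : M2Homogeneous m t w (p + p') := by
  intro n hn
  by_cases hp : p.coeff n = 0
  · refine h' n fun hp' => hn ?_
    rw [coeff_add, hp, hp', add_zero]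
  · exact h n hp

/-- The tridegree (May filtration, topological degree, weight) of the generators of `Gr A(2)`. -/
def tridegree (i : HIndex) : ℕ × ℕ × ℕ := (i.may, i.topDeg, i.weight)

theorem sum_tridegree (S : Finset HIndex) :
    ∑ i ∈ S, tridegree i = (mayDeg S, topDegree S, weightDegree S) := by
  refine Prod.ext ?_ (Prod.ext ?_ ?_)
  · exact Prod.fst_sum
  · rw [Prod.snd_sum, Prod.fst_sum]; rfl
  · rw [Prod.snd_sum, Prod.snd_sum]; rfl

/-- The possible values of a cochain of degree `q = (m, s, a, w)` at the words of a given tridegree.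
-/
def valueSubgroup (q : ℤ × ℤ × ℤ × ℤ) (δ : ℕ × ℕ × ℕ) : AddSubgroup M2 where
  carrier := {p | M2Homogeneous (δ.1 - q.1) (δ.2.1 - (q.2.1 + q.2.2.1)) (δ.2.2 - q.2.2.2) p}
  zero_mem' := M2Homogeneous.zero _ _ _
  add_mem' h h' := M2Homogeneous.add h h'
  neg_mem' {p} h := by
    intro n hn
    exact h n (by simpa using hn)

theorem mem_valueSubgroup {q : ℤ × ℤ × ℤ × ℤ} {δ : ℕ × ℕ × ℕ} {p : M2} :
    p ∈ valueSubgroup q δ ↔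
      M2Homogeneous (δ.1 - q.1) (δ.2.1 - (q.2.1 + q.2.2.1)) (δ.2.2 - q.2.2.2) p := Iff.rfl

theorem structureConst_mul_mem (q : ℤ × ℤ × ℤ × ℤ) (S T R : Letter HIndex) (e : ℕ × ℕ × ℕ) (x : M2)
    (hx : x ∈ valueSubgroup q (e + ∑ i ∈ R.1, tridegree i)) :
    structureConst augBasis S T R * x ∈
      valueSubgroup q (e + (∑ i ∈ S.1, tridegree i + ∑ i ∈ T.1, tridegree i)) := by
  rw [structureConst_augBasis]
  have h := (((grMonom_homogeneous S.1).mul (grMonom_homogeneous T.1)).grCoord R.1).mul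
    (mem_valueSubgroup.1 hx)
  rw [mem_valueSubgroup]
  simp only [sum_tridegree, Prod.fst_add, Prod.snd_add, Nat.cast_add] at h ⊢
  convert h using 1 <;> ring

/-- The coercion of lists that occurs in the definition of homogeneous cochains. -/
theorem bind_pure_coe (l : List (AugIdeal grA2Aug)) :
    (do let a ← l; pure (a : GrA2)) = l.map Subtype.val :=
  List.flatMap_pure_eq_map _ l

theorem cochainHomogeneous_extendFun (q : ℤ × ℤ × ℤ × ℤ) (F : List (Letter HIndex) → M2)
    (hF : ∀ w, F w ∈ valueSubgroup q (Letter.degree tridegree w))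
    (hl : ∀ w, (w.length : ℤ) ≠ q.2.2.1 → F w = 0) :
    CochainHomogeneous q (extendFun augBasis F) := by
  refine ⟨fun l hl' => extendFun_eq_zero augBasis F (n := l.length)
    (fun w hw => hl w (by rwa [hw])) l rfl, fun l δ h => ?_⟩
  have key : ∀ (e : ℕ × ℕ × ℕ) (F : List (Letter HIndex) → M2),
      (∀ w, F w ∈ valueSubgroup q (e + Letter.degree tridegree w)) →
      extendFun augBasis F l ∈ valueSubgroup q
        (e + ((δ.map fun e => e.1).sum, (δ.map fun e => e.2.1).sum,
          (δ.map fun e => e.2.2).sum)) := by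
    clear hF hl
    rw [bind_pure_coe, List.forall₂_map_left_iff] at h
    induction h with
    | nil => exact fun e F hF => hF []
    | @cons b d l δ hb h ih =>
      intro e F hF
      rw [extendFun_cons]
      refine sum_mem fun S _ => ?_
      have h1 := ih (e + ∑ i ∈ S.1, tridegree i) (fun u => F (S :: u)) fun w => by
        have := hF (S :: w)
        rwa [Letter.degree_cons, ← add_assoc] at this
      have h2 := (hb.grCoord S.1).mul (mem_valueSubgroup.1 h1)
      rw [augBasis_repr, mem_valueSubgroup]
      simp only [sum_tridegree, Prod.fst_add, Prod.snd_add, Nat.cast_add, List.map_cons,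
        List.sum_cons] at h2 ⊢
      convert h2 using 1 <;> ring
  have := key 0 F fun w => by rw [zero_add]; exact hF w
  rwa [zero_add] at this

theorem sum_map_hDegree (s : Multiset HIndex) : (s.map hDegree).sum =
    (((s.map tridegree).sum.1 : ℤ), ((s.map tridegree).sum.2.1 : ℤ) - s.card, (s.card : ℤ),
      ((s.map tridegree).sum.2.2 : ℤ)) := by
  induction s using Multiset.induction_on with
  | empty => rfl
  | cons i s ih =>
    have h : hDegree i = ((i.may : ℤ), (i.topDeg : ℤ) - 1, 1, (i.weight : ℤ)) := by cases i <;> rfl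
    rw [Multiset.map_cons, Multiset.sum_cons, ih, h, Multiset.map_cons, Multiset.sum_cons,
      Multiset.card_cons]
    simp only [Prod.mk_add_mk, Prod.fst_add, Prod.snd_add, tridegree, Nat.cast_add, Nat.cast_one,
      Prod.mk.injEq]
    refine ⟨trivial, ?_, ?_, trivial⟩ <;> ring

/-- Homogeneity of a polynomial, in terms of the coefficients indexed by multisets of variables. -/
theorem hPolyHomogeneous_iff (q : ℤ × ℤ × ℤ × ℤ) (p : HPoly) : HPolyHomogeneous q p ↔
    ∀ s : Multiset HIndex,
      p.coeff (Multiset.toFinsupp s) ∈ valueSubgroup q (s.map tridegree).sum ∧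
      ((s.card : ℤ) ≠ q.2.2.1 → p.coeff (Multiset.toFinsupp s) = 0) := by
  have hsum : ∀ s : Multiset HIndex, ((Multiset.toFinsupp s).sum fun i r => r • hDegree i) =
      (s.map hDegree).sum := by
    intro s
    rw [Finset.sum_multiset_map_count]
    refine Finset.sum_congr (Multiset.toFinsupp_support s) fun i _ => rfl
  obtain ⟨m, t, a, w⟩ := q
  have hiff : ∀ (s : Multiset HIndex) (n : ℕ),
      ((s.map hDegree).sum + n • ((0, 0, 0, -1) : ℤ × ℤ × ℤ × ℤ) = (m, t, a, w)) ↔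
      ((s.card : ℤ) = a ∧ ((s.map tridegree).sum.1 : ℤ) - m = 0 ∧
        ((s.map tridegree).sum.2.1 : ℤ) - (t + a) = 0 ∧
        ((s.map tridegree).sum.2.2 : ℤ) - w = n) := by
    intro s n
    rw [sum_map_hDegree]
    simp only [Prod.smul_mk, Prod.mk_add_mk, Prod.mk.injEq, nsmul_eq_mul, mul_zero, mul_neg,
      mul_one]
    omega
  constructor
  · intro h s
    have h' : ∀ n, (p.coeff (Multiset.toFinsupp s)).coeff n ≠ 0 → _ := fun n hn =>
      (hiff s n).1 (hsum s ▸ h (Multiset.toFinsupp s) n hn)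
    refine ⟨fun n hn => (h' n hn).2, fun hs => ?_⟩
    ext1 n
    by_contra hn
    exact hs (h' n hn).1
  · intro h e n hn
    obtain ⟨s, rfl⟩ : ∃ s : Multiset HIndex, e = Multiset.toFinsupp s :=
      ⟨Finsupp.toMultiset e, (Finsupp.toMultiset_toFinsupp e).symm⟩
    rw [hsum, hiff]
    refine ⟨?_, (h s).1 n hn⟩
    by_contra hs
    rw [(h s).2 hs] at hn
    exact hn (coeff_zero n)

theorem hPolyHomogeneous_symbol {q : ℤ × ℤ × ℤ × ℤ} (f : cobar grA2Aug)
    (hf : CochainHomogeneous q (f : WordFun (AugIdeal grA2Aug) M2)) :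
    HPolyHomogeneous q (symbol augBasis f) := by
  rw [hPolyHomogeneous_iff]
  intro s
  rw [coeff_symbol]
  refine ⟨sum_mem fun w hw => ?_, fun hs => Finset.sum_eq_zero fun w hw => ?_⟩
  · rw [Finset.mem_filter] at hw
    rw [← hw.2, Multiset.map_coe, Multiset.sum_coe, mem_valueSubgroup]
    have h := hf.2 (w.map (letterGen augBasis)) (w.map tridegree) (by
      rw [bind_pure_coe, List.forall₂_map_left_iff, List.forall₂_map_left_iff,
        List.forall₂_map_right_iff]
      refine List.forall₂_same.2 fun i _ => ?_
      have := grMonom_homogeneous {i}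
      rw [mayDeg, topDegree, weightDegree, Finset.sum_singleton, Finset.sum_singleton,
        Finset.sum_singleton] at this
      rw [letterGen, coe_augBasis]
      exact this)
    have hsum : (w.map tridegree).sum = (((w.map tridegree).map fun e => e.1).sum,
        ((w.map tridegree).map fun e => e.2.1).sum,
        ((w.map tridegree).map fun e => e.2.2).sum) := by
      generalize w.map tridegree = l
      induction l with
      | nil => rfl
      | cons a l ih => rw [List.sum_cons, ih]; rfl
    rw [hsum]
    exact h
  · rw [Finset.mem_filter, mem_words] at hw
    exact hf.1 _ (by rwa [List.length_map, hw.1])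

/-! ### The isomorphism of `Ext` with the cohomology of the polynomial ring -/

theorem m2_add_self (x : M2) : x + x = 0 := CharTwo.add_self_eq_zero x

/-- The symbol, on cocycles. -/
def symbolCocycles : cocycles (cobar grA2Aug) (WordFun.diff (augMul grA2Aug)) (WordFun.diff_mul _)
    →ₐ[M2] HCocycles :=
  AlgHom.codRestrict ((symbol augBasis).comp (Subalgebra.inclusion
    (show cocycles _ _ _ ≤ cobar grA2Aug from
      fun x hx => (show x ∈ cobar grA2Aug ∧ _ from hx).1))) HCocycles
    fun x => by
      refine ⟨Algebra.mem_top, ?_⟩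
      refine (symbol_diff augBasis isKoszulBasis_augBasis.bracket ⟨x.1, x.2.1⟩).symm.trans ?_
      have : (⟨WordFun.diff (augMul grA2Aug) x.1, diff_mem_cobar x.2.1⟩ : cobar grA2Aug) = 0 :=
        Subtype.ext x.2.2
      rw [this, map_zero]

theorem coe_symbolCocycles (x : cocycles (cobar grA2Aug) (WordFun.diff (augMul grA2Aug))
    (WordFun.diff_mul _)) : (symbolCocycles x : HPoly) = symbol augBasis ⟨x.1, x.2.1⟩ := rfl

/-- The map induced by the symbol on cohomology. -/
def symbolCohomology : ExtGrA2 →ₐ[M2] HCohomology :=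
  Ideal.quotientMapₐ _ symbolCocycles (by
    rintro x ⟨y, hy, hyx⟩
    refine ⟨symbol augBasis ⟨y, hy⟩, Algebra.mem_top, ?_⟩
    refine (symbol_diff augBasis isKoszulBasis_augBasis.bracket ⟨y, hy⟩).symm.trans ?_
    rw [coe_symbolCocycles]
    congr 1
    exact Subtype.ext hyx)

theorem symbolCohomology_mk (x : cocycles (cobar grA2Aug) (WordFun.diff (augMul grA2Aug))
    (WordFun.diff_mul _)) : symbolCohomology (Ideal.Quotient.mk _ x) =
      Ideal.Quotient.mk _ (symbolCocycles x) := rfl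

theorem symbolCohomology_injective : Function.Injective symbolCohomology := by
  rw [injective_iff_map_eq_zero]
  intro x hx
  obtain ⟨x, rfl⟩ := Ideal.Quotient.mk_surjective x
  rw [symbolCohomology_mk, Ideal.Quotient.eq_zero_iff_mem] at hx
  obtain ⟨p, -, hp⟩ := hx
  rw [Ideal.Quotient.eq_zero_iff_mem]
  exact isKoszulBasis_augBasis.exists_coboundary m2_add_self ⟨x.1, x.2.1⟩ x.2.2 p hp.symm

theorem symbolCohomology_surjective : Function.Surjective symbolCohomology := by
  intro x
  obtain ⟨z, rfl⟩ := Ideal.Quotient.mk_surjective x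
  obtain ⟨F, hF, -, h1, h2, -⟩ := isKoszulBasis_augBasis.exists_cocycle
    (G := fun _ : ℕ => ⊤) (deg := fun _ => 0) m2_add_self (fun _ _ _ _ _ _ => AddSubgroup.mem_top _)
    z.1 z.2.2 fun _ => AddSubgroup.mem_top _
  refine ⟨Ideal.Quotient.mk _ ⟨extendFun augBasis F, hF, h1⟩, ?_⟩
  rw [symbolCohomology_mk]
  congr 1
  exact Subtype.ext h2

/-- The isomorphism of `Ext` with the cohomology of the polynomial ring. -/
def extEquiv : HCohomology ≃ₐ[M2] ExtGrA2 :=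
  (AlgEquiv.ofBijective symbolCohomology
    ⟨symbolCohomology_injective, symbolCohomology_surjective⟩).symm

theorem extEquiv_homogeneous (q : ℤ × ℤ × ℤ × ℤ) (x : HCohomology) :
    HCohomologyHomogeneous q x ↔ ExtHomogeneous q (extEquiv x) := by
  have hsymm : ∀ y, extEquiv (symbolCohomology y) = y := fun y =>
    AlgEquiv.ofBijective_symm_apply_apply symbolCohomology _ y
  constructor
  · rintro ⟨z, hz, rfl⟩
    rw [hPolyHomogeneous_iff] at hz
    obtain ⟨F, hF, h0, h1, h2, h3⟩ := isKoszulBasis_augBasis.exists_cocycle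
      (G := valueSubgroup q) (deg := tridegree) m2_add_self (structureConst_mul_mem q)
      z.1 z.2.2 fun s => (hz s).1
    refine ⟨⟨extendFun augBasis F, hF, h1⟩, cochainHomogeneous_extendFun q F h0 fun w hw => ?_, ?_⟩
    · exact h3 w.length (fun s hs => (hz s).2 (by rwa [hs])) w rfl
    · rw [← hsymm (Ideal.Quotient.mk _ _), symbolCohomology_mk]
      congr 2
      exact Subtype.ext h2
  · rintro ⟨z, hz, hzx⟩
    refine ⟨symbolCocycles z, hPolyHomogeneous_symbol ⟨z.1, z.2.1⟩ hz, ?_⟩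
    rw [← symbolCohomology_mk, hzx]
    exact AlgEquiv.ofBijective_apply_symm_apply symbolCohomology _ x

/-! ### The polynomial ring as a free module over a ring of cocycles -/

theorem hPoly_add_self (x : HPoly) : x + x = 0 := CharTwo.add_self_eq_zero x

/-- The endomorphism of the polynomial ring that fixes `h_{1j}` and squares the other variables.
Its image consists of cocycles, and the polynomial ring is free over the image on the squarefree
monomials in `h₂₀`, `h₂₁` and `h₃₀`. -/
def squareHom : HPoly →ₐ[M2] HPoly :=
  MvPolynomial.aeval fun i => match i with
    | .h10 => hvar .h10
    | .h11 => hvar .h11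
    | .h12 => hvar .h12
    | .h20 => hvar .h20 ^ 2
    | .h21 => hvar .h21 ^ 2
    | .h30 => hvar .h30 ^ 2

theorem squareHom_X (i : HIndex) : squareHom (MvPolynomial.X i) = match i with
    | .h10 => hvar .h10
    | .h11 => hvar .h11
    | .h12 => hvar .h12
    | .h20 => hvar .h20 ^ 2
    | .h21 => hvar .h21 ^ 2
    | .h30 => hvar .h30 ^ 2 := MvPolynomial.aeval_X _ i

theorem squareHom_injective : Function.Injective squareHom := by
  have h := (MvPolynomial.algebraicIndependent_X HIndex M2).polynomial_aeval_of_transcendental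
    (f := fun i => match i with
      | .h10 | .h11 | .h12 => Polynomial.X
      | .h20 | .h21 | .h30 => Polynomial.X ^ 2) (by
    have h1 : Transcendental M2 (Polynomial.X : Polynomial M2) := Polynomial.transcendental_X M2
    have h2 := h1.pow (n := 2) two_pos
    intro i
    cases i <;> assumption)
  intro p q hpq
  refine h ?_
  convert hpq using 1 <;> rw [squareHom] <;> congr 2 <;> funext i <;> cases i <;> simp

theorem derivation_squareHom (D : Derivation M2 HPoly HPoly) (h0 : D (hvar .h10) = 0)
    (h1 : D (hvar .h11) = 0) (h2 : D (hvar .h12) = 0) (p : HPoly) : D (squareHom p) = 0 := by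
  induction p using MvPolynomial.induction_on with
  | C a => rw [squareHom, MvPolynomial.aeval_C, Derivation.map_algebraMap]
  | add p q hp hq => rw [map_add, map_add, hp, hq, add_zero]
  | mul_X p i hp =>
    rw [map_mul, Derivation.leibniz, hp, smul_zero, add_zero, squareHom_X]
    cases i <;> simp only [h0, h1, h2, smul_zero, pow_two, Derivation.leibniz, hPoly_add_self]

/-- The combination of the squarefree monomials in `h₂₀`, `h₂₁` and `h₃₀` with given coefficients.
-/
def evenSum (a : Fin 8 → HPoly) : HPoly :=
  squareHom (a 0) + squareHom (a 1) * hvar .h20 + squareHom (a 2) * hvar .h21 +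
    squareHom (a 3) * hvar .h30 + squareHom (a 4) * (hvar .h20 * hvar .h21) +
    squareHom (a 5) * (hvar .h20 * hvar .h30) + squareHom (a 6) * (hvar .h21 * hvar .h30) +
    squareHom (a 7) * (hvar .h20 * hvar .h21 * hvar .h30)

theorem evenSum_add (a b : Fin 8 → HPoly) : evenSum (a + b) = evenSum a + evenSum b := by
  simp only [evenSum, Pi.add_apply, map_add]
  ring

theorem exists_evenSum_eq (p : HPoly) : ∃ a, evenSum a = p := by
  induction p using MvPolynomial.induction_on with
  | C r => exact ⟨![MvPolynomial.C r, 0, 0, 0, 0, 0, 0, 0], by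
      simp [evenSum, squareHom, MvPolynomial.algebraMap_eq]⟩
  | add p q hp hq =>
    obtain ⟨a, rfl⟩ := hp
    obtain ⟨b, rfl⟩ := hq
    exact ⟨a + b, evenSum_add a b⟩
  | mul_X p i hp =>
    obtain ⟨a, rfl⟩ := hp
    have key : ∀ c : HPoly, evenSum (fun n => a n * c) = evenSum a * squareHom c := by
      intro c
      simp only [evenSum, map_mul]
      ring
    cases i with
    | h10 => exact ⟨fun n => a n * hvar .h10, by rw [key, squareHom_X]⟩
    | h11 => exact ⟨fun n => a n * hvar .h11, by rw [key, squareHom_X]⟩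
    | h12 => exact ⟨fun n => a n * hvar .h12, by rw [key, squareHom_X]⟩
    | h20 =>
      let b := MvPolynomial.X (R := M2) HIndex.h20
      refine ⟨![b * a 1, a 0, b * a 4, b * a 5, a 2, a 3, b * a 7, a 6], ?_⟩
      change squareHom (b * a 1) + squareHom (a 0) * _ + squareHom (b * a 4) * _ +
        squareHom (b * a 5) * _ + squareHom (a 2) * _ + squareHom (a 3) * _ +
        squareHom (b * a 7) * _ + squareHom (a 6) * _ = _
      simp only [map_mul, b, squareHom_X, evenSum]
      ring
    | h21 =>
      let b := MvPolynomial.X (R := M2) HIndex.h21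
      refine ⟨![b * a 2, b * a 4, a 0, b * a 6, a 1, b * a 7, a 3, a 5], ?_⟩
      change squareHom (b * a 2) + squareHom (b * a 4) * _ + squareHom (a 0) * _ +
        squareHom (b * a 6) * _ + squareHom (a 1) * _ + squareHom (b * a 7) * _ +
        squareHom (a 3) * _ + squareHom (a 5) * _ = _
      simp only [map_mul, b, squareHom_X, evenSum]
      ring
    | h30 =>
      let b := MvPolynomial.X (R := M2) HIndex.h30
      refine ⟨![b * a 3, b * a 5, b * a 6, a 0, b * a 7, a 1, a 2, a 4], ?_⟩
      change squareHom (b * a 3) + squareHom (b * a 5) * _ + squareHom (b * a 6) * _ +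
        squareHom (a 0) * _ + squareHom (b * a 7) * _ + squareHom (a 1) * _ +
        squareHom (a 2) * _ + squareHom (a 4) * _ = _
      simp only [map_mul, b, squareHom_X, evenSum]
      ring

/-- The coefficients are recovered by partial derivatives, since squares have derivative zero. -/
theorem evenSum_injective : Function.Injective evenSum := by
  have key : ∀ a, evenSum a = 0 → a = 0 := by
    intro a ha
    have hz : ∀ (i j : HIndex), i ≠ j →
        MvPolynomial.pderiv (R := M2) i (MvPolynomial.X j) = 0 :=
      fun i j h => MvPolynomial.pderiv_X_of_ne h.symm
    have hq : ∀ (i : HIndex), i ≠ .h10 → i ≠ .h11 → i ≠ .h12 → ∀ p,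
        MvPolynomial.pderiv (R := M2) i (squareHom p) = 0 := fun i h0 h1 h2 p =>
      derivation_squareHom _ (hz i _ h0) (hz i _ h1) (hz i _ h2) p
    have h0 : ∀ p, squareHom p = 0 → p = 0 := fun p hp =>
      (injective_iff_map_eq_zero squareHom).1 squareHom_injective p hp
    have rx : ∀ p, MvPolynomial.pderiv (R := M2) .h20 (squareHom p) = 0 :=
      hq .h20 (by simp) (by simp) (by simp)
    have ry : ∀ p, MvPolynomial.pderiv (R := M2) .h21 (squareHom p) = 0 :=
      hq .h21 (by simp) (by simp) (by simp)
    have rz : ∀ p, MvPolynomial.pderiv (R := M2) .h30 (squareHom p) = 0 :=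
      hq .h30 (by simp) (by simp) (by simp)
    have h1 := congrArg (MvPolynomial.pderiv (R := M2) .h20) ha
    have h2 := congrArg (MvPolynomial.pderiv (R := M2) .h21) ha
    have h3 := congrArg (MvPolynomial.pderiv (R := M2) .h30) ha
    have h4 := congrArg (MvPolynomial.pderiv (R := M2) .h21) h1
    have h5 := congrArg (MvPolynomial.pderiv (R := M2) .h30) h1
    have h6 := congrArg (MvPolynomial.pderiv (R := M2) .h30) h2
    have h7 := congrArg (MvPolynomial.pderiv (R := M2) .h30) h4
    have nxy := hz .h20 .h21 (by simp)
    have nxz := hz .h20 .h30 (by simp)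
    have nyx := hz .h21 .h20 (by simp)
    have nyz := hz .h21 .h30 (by simp)
    have nzx := hz .h30 .h20 (by simp)
    have nzy := hz .h30 .h21 (by simp)
    simp only [evenSum, map_add, map_zero, Derivation.leibniz, rx, ry, rz, nxy, nxz, nyx, nyz, nzx,
      nzy, MvPolynomial.pderiv_X_self, smul_eq_mul, mul_zero, zero_add, add_zero, mul_one]
      at h1 h2 h3 h4 h5 h6 h7
    have a7 := h0 _ h7
    simp only [a7, map_zero, zero_mul, add_zero] at h1 h2 h3 h4 h5 h6
    have a4 := h0 _ h4
    have a5 := h0 _ h5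
    have a6 := h0 _ h6
    simp only [a4, a5, a6, map_zero, zero_mul, add_zero] at h1 h2 h3
    have a1 := h0 _ h1
    have a2 := h0 _ h2
    have a3 := h0 _ h3
    simp only [evenSum, a1, a2, a3, a4, a5, a6, a7, map_zero, zero_mul, add_zero] at ha
    have a0 := h0 _ ha
    funext n
    fin_cases n <;> assumption
  intro a b hab
  have h := key (a + b) (by rw [evenSum_add, hab, hPoly_add_self])
  funext n
  exact CharTwo.add_eq_zero.1 (congrFun h n)

theorem hDiff_X (i : HIndex) : hDiff (MvPolynomial.X i) = match i with
    | .h10 => 0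
    | .h11 => 0
    | .h12 => 0
    | .h20 => hvar .h10 * hvar .h11
    | .h21 => hvar .h11 * hvar .h12
    | .h30 => hvar .h10 * hvar .h21 + hvar .h20 * hvar .h12 := MvPolynomial.mkDerivation_X M2 _ i

theorem hDiff_squareHom (p : HPoly) : hDiff (squareHom p) = 0 :=
  derivation_squareHom hDiff (hDiff_X _) (hDiff_X _) (hDiff_X _) p

theorem hDiff_evenSum (a : Fin 8 → HPoly) : hDiff (evenSum a) = evenSum
    ![a 1 * (hvar .h10 * hvar .h11) + a 2 * (hvar .h11 * hvar .h12) +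
        a 5 * (hvar .h12 * hvar .h20) + a 6 * (hvar .h10 * hvar .h21),
      a 3 * hvar .h12 + a 4 * (hvar .h11 * hvar .h12) + a 7 * (hvar .h10 * hvar .h21),
      a 3 * hvar .h10 + a 4 * (hvar .h10 * hvar .h11) + a 7 * (hvar .h12 * hvar .h20),
      a 5 * (hvar .h10 * hvar .h11) + a 6 * (hvar .h11 * hvar .h12),
      a 5 * hvar .h10 + a 6 * hvar .h12,
      a 7 * (hvar .h11 * hvar .h12),
      a 7 * (hvar .h10 * hvar .h11),
      0] := by
  change _ = squareHom (_ + _) + squareHom (_ + _) * _ + squareHom (_ + _) * _ +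
    squareHom (_ + _) * _ + squareHom (_ + _) * _ + squareHom (a 7 * _) * _ +
    squareHom (a 7 * _) * _ + squareHom 0 * _
  simp only [evenSum, map_add, map_mul, map_zero, squareHom_X, Derivation.leibniz, hDiff_squareHom,
    hDiff_X, smul_eq_mul]
  ring

/-! ### The cocycles of the polynomial ring -/

theorem prime_hvar (i : HIndex) : Prime (hvar i) := MvPolynomial.X_prime

theorem dvd_of_X_mul_eq {i j : HIndex} (hij : i ≠ j) {p q : HPoly} (h : hvar i * p = hvar j * q) :
    ∃ u, q = hvar i * u := by
  refine ((prime_hvar i).dvd_or_dvd (Dvd.intro p h)).resolve_left fun hd => hij ?_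
  rwa [MvPolynomial.X_dvd_X] at hd

/-- Every cocycle is, up to a coboundary, a combination of `1` and `h₀(1)` with coefficients in the
image of `squareHom`. -/
theorem exists_of_hDiff_eq_zero (p : HPoly) (hp : hDiff p = 0) : ∃ a c e : HPoly,
    p = squareHom a + squareHom c * genPoly .h01 + hDiff e := by
  obtain ⟨a, rfl⟩ := exists_evenSum_eq p
  rw [hDiff_evenSum, show (0 : HPoly) = evenSum 0 by simp [evenSum]] at hp
  have h := evenSum_injective hp
  have h0 : a 1 * (hvar .h10 * hvar .h11) + a 2 * (hvar .h11 * hvar .h12) +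
    a 5 * (hvar .h12 * hvar .h20) + a 6 * (hvar .h10 * hvar .h21) = 0 := congrFun h 0
  have h2 : a 3 * hvar .h10 + a 4 * (hvar .h10 * hvar .h11) + a 7 * (hvar .h12 * hvar .h20) = 0 :=
    congrFun h 2
  have h4 : a 5 * hvar .h10 + a 6 * hvar .h12 = 0 := congrFun h 4
  have h5 : a 7 * (hvar .h11 * hvar .h12) = 0 := congrFun h 5
  clear h hp
  have hX : ∀ i, (hvar i : HPoly) ≠ 0 := fun i => MvPolynomial.X_ne_zero i
  have e7 : a 7 = 0 := (mul_eq_zero.1 h5).resolve_right (mul_ne_zero (hX _) (hX _))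
  have e3 : a 3 = hvar .h11 * a 4 := by
    refine mul_left_cancel₀ (hX .h10) (CharTwo.add_eq_zero.1 ?_)
    rw [e7] at h2
    linear_combination h2
  obtain ⟨u, e6⟩ : ∃ u, a 6 = hvar .h10 * u :=
    dvd_of_X_mul_eq (i := .h10) (j := .h12) (by simp) (p := a 5) (CharTwo.add_eq_zero.1 (by
      linear_combination h4))
  have e5 : a 5 = hvar .h12 * u := by
    refine mul_left_cancel₀ (hX .h10) (CharTwo.add_eq_zero.1 ?_)
    rw [e6] at h4
    linear_combination h4
  rw [e5, e6] at h0
  have hu : hvar .h11 ∣ u * (hvar .h12 ^ 2 * hvar .h20 + hvar .h10 ^ 2 * hvar .h21) :=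
    ⟨a 1 * hvar .h10 + a 2 * hvar .h12, CharTwo.add_eq_zero.1 (by linear_combination h0)⟩
  obtain ⟨v, rfl⟩ : hvar .h11 ∣ u := by
    refine ((prime_hvar _).dvd_or_dvd hu).resolve_right fun hd => ?_
    -- The second factor does not vanish at this point, whereas `h₁₁` does.
    have := map_dvd (MvPolynomial.aeval fun i => match i with
      | .h11 | .h21 => (0 : M2)
      | _ => 1) hd
    simp at this
  have h0' : hvar .h10 * (a 1 + v * hvar .h10 * hvar .h21) =
      hvar .h12 * (a 2 + v * hvar .h12 * hvar .h20) := by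
    refine mul_left_cancel₀ (hX .h11) (CharTwo.add_eq_zero.1 ?_)
    linear_combination h0
  obtain ⟨w, e2⟩ := dvd_of_X_mul_eq (by simp) h0'
  have e1 : a 1 + v * hvar .h10 * hvar .h21 = hvar .h12 * w := by
    refine mul_left_cancel₀ (hX .h10) ?_
    rw [h0', e2]
    ring
  have e1' : a 1 = hvar .h12 * w + v * hvar .h10 * hvar .h21 := by
    linear_combination e1 - hPoly_add_self (v * hvar .h10 * hvar .h21)
  have e2' : a 2 = hvar .h10 * w + v * hvar .h12 * hvar .h20 := by
    linear_combination e2 - hPoly_add_self (v * hvar .h12 * hvar .h20)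
  refine ⟨a 0, a 4, squareHom w * hvar .h30 +
    squareHom v * (hvar .h20 * hvar .h21 * hvar .h30), ?_⟩
  simp only [evenSum, genPoly, e1', e2', e3, e5, e6, e7, map_add, map_mul, map_zero, squareHom_X,
    Derivation.leibniz, hDiff_squareHom, hDiff_X, smul_eq_mul]
  ring

/-! ### The presentation of the cohomology -/

/-- The generators of the presentation other than `h₀(1)`, indexed by the corresponding variables
of the polynomial ring. -/
def HIndex.toGen : HIndex → Gen
  | .h10 => .h0
  | .h11 => .h1
  | .h12 => .h2
  | .h20 => .b20
  | .h21 => .b21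
  | .h30 => .b30

/-- The polynomials in the generators other than `h₀(1)`. -/
def genRename : HPoly →ₐ[M2] MvPolynomial Gen M2 := MvPolynomial.rename HIndex.toGen

theorem genRename_X (i : HIndex) :
    genRename (MvPolynomial.X i) = MvPolynomial.X i.toGen := MvPolynomial.rename_X _ i

/-- The algebra map that sends the generators to the cocycles that represent them. -/
def genEval : MvPolynomial Gen M2 →ₐ[M2] HPoly := MvPolynomial.aeval genPoly

theorem genEval_X (g : Gen) : genEval (MvPolynomial.X g) = genPoly g := MvPolynomial.aeval_X _ g

theorem genEval_genRename (p : HPoly) : genEval (genRename p) = squareHom p := by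
  refine congrArg (fun f : HPoly →ₐ[M2] HPoly => f p)
    (MvPolynomial.algHom_ext (f := genEval.comp genRename) (g := squareHom) fun i => ?_)
  rw [AlgHom.comp_apply, genRename_X, genEval_X, squareHom_X]
  cases i <;> rfl

theorem hDiff_genEval (p : MvPolynomial Gen M2) : hDiff (genEval p) = 0 := by
  induction p using MvPolynomial.induction_on with
  | C a => rw [genEval, MvPolynomial.aeval_C, Derivation.map_algebraMap]
  | add p q hp hq => rw [map_add, map_add, hp, hq, add_zero]
  | mul_X p g hp =>
    rw [map_mul, Derivation.leibniz, hp, genEval_X, hDiff_genPoly, smul_zero, smul_zero, add_zero]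

/-- The polynomial ring on the generators modulo the relations is spanned by `1` and `h₀(1)` over
the polynomials in the other generators. -/
theorem exists_sub_mem_span_relations (p : MvPolynomial Gen M2) : ∃ a c : HPoly,
    p - (genRename a + genRename c * MvPolynomial.X .h01) ∈ Ideal.span relations := by
  induction p using MvPolynomial.induction_on with
  | C r =>
    refine ⟨MvPolynomial.C r, 0, ?_⟩
    rw [genRename, MvPolynomial.rename_C, map_zero, zero_mul, add_zero, sub_self]
    exact zero_mem _
  | add p q hp hq =>
    obtain ⟨a, c, h⟩ := hp
    obtain ⟨a', c', h'⟩ := hq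
    refine ⟨a + a', c + c', ?_⟩
    convert add_mem h h' using 1
    simp only [map_add]
    ring
  | mul_X p g hp =>
    obtain ⟨a, c, h⟩ := hp
    have key : ∀ i : HIndex, g = i.toGen → ∃ a c : HPoly, p * MvPolynomial.X g -
        (genRename a + genRename c * MvPolynomial.X .h01) ∈ Ideal.span relations := by
      rintro i rfl
      refine ⟨a * MvPolynomial.X i, c * MvPolynomial.X i, ?_⟩
      convert Ideal.mul_mem_right (MvPolynomial.X i.toGen) _ h using 1
      simp only [map_mul, genRename_X]
      ring
    cases g with
    | h01 =>
      refine ⟨c * (hvar .h20 * hvar .h21 + hvar .h11 ^ 2 * hvar .h30), a, ?_⟩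
      have hr : (MvPolynomial.X .h01 ^ 2 - (MvPolynomial.X .b20 * MvPolynomial.X .b21 +
          MvPolynomial.X .h1 ^ 2 * MvPolynomial.X .b30) : MvPolynomial Gen M2) ∈
          Ideal.span relations :=
        Ideal.subset_span (by simp [relations])
      convert add_mem (Ideal.mul_mem_right (MvPolynomial.X .h01) _ h)
        (Ideal.mul_mem_left _ (genRename c) hr) using 1
      simp only [map_mul, map_add, map_pow, genRename_X, HIndex.toGen]
      ring
    | h0 => exact key .h10 rfl
    | h1 => exact key .h11 rfl
    | h2 => exact key .h12 rfl
    | b20 => exact key .h20 rfl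
    | b21 => exact key .h21 rfl
    | b30 => exact key .h30 rfl

/-- The relations hold in cohomology. -/
theorem exists_hDiff_eq_of_mem_relations (r : MvPolynomial Gen M2) (hr : r ∈ relations) :
    ∃ e, hDiff e = genEval r := by
  have h2 := hPoly_add_self
  rcases hr with rfl | rfl | rfl | rfl | rfl
  · exact ⟨hvar .h20, by rw [map_mul, genEval_X, genEval_X, hDiff_X]; rfl⟩
  · exact ⟨hvar .h21, by rw [map_mul, genEval_X, genEval_X, hDiff_X]; rfl⟩
  · refine ⟨hvar .h20 * hvar .h30, ?_⟩
    simp only [map_sub, map_mul, genEval_X, genPoly, Derivation.leibniz, hDiff_X, smul_eq_mul]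
    linear_combination h2 (hvar .h10 * (hvar .h20 * hvar .h21 + hvar .h11 * hvar .h30))
  · refine ⟨hvar .h21 * hvar .h30, ?_⟩
    simp only [map_sub, map_mul, genEval_X, genPoly, Derivation.leibniz, hDiff_X, smul_eq_mul]
    linear_combination h2 (hvar .h10 * hvar .h21 ^ 2)
  · refine ⟨0, ?_⟩
    simp only [map_sub, map_add, map_mul, map_pow, genEval_X, genPoly, map_zero]
    linear_combination -h2 (hvar .h20 * hvar .h21 * (hvar .h11 * hvar .h30))

/-- The relations suffice: if a combination of `1` and `h₀(1)` is a coboundary, then it is in the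
ideal generated by the relations. -/
theorem mem_span_relations_of_hDiff_eq (a c e : HPoly)
    (h : hDiff e = squareHom a + squareHom c * genPoly .h01) :
    genRename a + genRename c * MvPolynomial.X .h01 ∈ Ideal.span relations := by
  obtain ⟨b, rfl⟩ := exists_evenSum_eq e
  have hb : squareHom a + squareHom c * genPoly .h01 =
      evenSum ![a, 0, 0, hvar .h11 * c, c, 0, 0, 0] := by
    change _ = squareHom a + squareHom 0 * _ + squareHom 0 * _ + squareHom (hvar .h11 * c) * _ +
      squareHom c * _ + squareHom 0 * _ + squareHom 0 * _ + squareHom 0 * _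
    simp only [genPoly, map_zero, map_mul, squareHom_X]
    ring
  rw [hb, hDiff_evenSum] at h
  have h' := evenSum_injective h
  have ha : b 1 * (hvar .h10 * hvar .h11) + b 2 * (hvar .h11 * hvar .h12) +
    b 5 * (hvar .h12 * hvar .h20) + b 6 * (hvar .h10 * hvar .h21) = a := congrFun h' 0
  have hc : b 5 * hvar .h10 + b 6 * hvar .h12 = c := congrFun h' 4
  have hr : ∀ r ∈ relations, r ∈ Ideal.span relations := fun r hr => Ideal.subset_span hr
  have r1 := hr (MvPolynomial.X .h0 * MvPolynomial.X .h1) (by simp [relations])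
  have r2 := hr (MvPolynomial.X .h1 * MvPolynomial.X .h2) (by simp [relations])
  have r3 := hr (MvPolynomial.X .h2 * MvPolynomial.X .b20 -
    MvPolynomial.X .h0 * MvPolynomial.X .h01) (by simp [relations])
  have r4 := hr (MvPolynomial.X .h2 * MvPolynomial.X .h01 -
    MvPolynomial.X .h0 * MvPolynomial.X .b21) (by simp [relations])
  convert add_mem (add_mem (add_mem (Ideal.mul_mem_left _ (genRename (b 1)) r1)
    (Ideal.mul_mem_left _ (genRename (b 2)) r2)) (Ideal.mul_mem_left _ (genRename (b 5)) r3))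
    (Ideal.mul_mem_left _ (genRename (b 6)) r4) using 1
  rw [← ha, ← hc]
  have h2 : ∀ x : MvPolynomial Gen M2, x + x = 0 := fun x => CharTwo.add_self_eq_zero x
  simp only [map_add, map_mul, genRename_X, HIndex.toGen]
  linear_combination
    h2 (genRename (b 5) * MvPolynomial.X .h0 * MvPolynomial.X .h01) +
    h2 (genRename (b 6) * MvPolynomial.X .h0 * MvPolynomial.X .b21)

/-- The algebra map from the polynomial ring on the generators to the cohomology. -/
def genCohomology : MvPolynomial Gen M2 →ₐ[M2] HCohomology :=
  (Ideal.Quotient.mkₐ M2 _).comp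
    (genEval.codRestrict HCocycles fun p => ⟨Algebra.mem_top, hDiff_genEval p⟩)

theorem genCohomology_apply (p : MvPolynomial Gen M2) : genCohomology p =
    Ideal.Quotient.mk _ (⟨genEval p, Algebra.mem_top, hDiff_genEval p⟩ : HCocycles) := rfl

theorem genCohomology_eq_zero_iff (p : MvPolynomial Gen M2) :
    genCohomology p = 0 ↔ ∃ e, hDiff e = genEval p := by
  rw [genCohomology_apply, Ideal.Quotient.eq_zero_iff_mem]
  exact ⟨fun ⟨e, _, he⟩ => ⟨e, he⟩, fun ⟨e, he⟩ => ⟨e, Algebra.mem_top, he⟩⟩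

theorem genCohomology_of_mem {p : MvPolynomial Gen M2} (hp : p ∈ Ideal.span relations) :
    genCohomology p = 0 := by
  have h : Ideal.span relations ≤ RingHom.ker genCohomology := Ideal.span_le.2 fun r hr =>
    (genCohomology_eq_zero_iff r).2 (exists_hDiff_eq_of_mem_relations r hr)
  exact h hp

/-- The map of the presentation to the cohomology. -/
def presentationHom : (MvPolynomial Gen M2 ⧸ Ideal.span relations) →ₐ[M2] HCohomology :=
  Ideal.Quotient.liftₐ _ genCohomology fun _ hp => genCohomology_of_mem hp

theorem presentationHom_mk (p : MvPolynomial Gen M2) :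
    presentationHom (Ideal.Quotient.mk _ p) = genCohomology p := rfl

theorem presentationHom_injective : Function.Injective presentationHom := by
  rw [injective_iff_map_eq_zero]
  intro x hx
  obtain ⟨p, rfl⟩ := Ideal.Quotient.mk_surjective x
  rw [presentationHom_mk] at hx
  obtain ⟨a, c, h⟩ := exists_sub_mem_span_relations p
  have h' := genCohomology_of_mem h
  rw [map_sub, hx, zero_sub, neg_eq_zero, genCohomology_eq_zero_iff] at h'
  obtain ⟨e, he⟩ := h'
  rw [map_add, map_mul, genEval_genRename, genEval_genRename, genEval_X] at he
  rw [Ideal.Quotient.eq_zero_iff_mem]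
  simpa using add_mem h (mem_span_relations_of_hDiff_eq a c e he)

theorem presentationHom_surjective : Function.Surjective presentationHom := by
  intro x
  obtain ⟨z, rfl⟩ := Ideal.Quotient.mk_surjective x
  obtain ⟨a, c, e, h⟩ := exists_of_hDiff_eq_zero z.1 z.2.2
  refine ⟨Ideal.Quotient.mk _ (genRename a + genRename c * MvPolynomial.X .h01), ?_⟩
  rw [presentationHom_mk, genCohomology_apply, Ideal.Quotient.eq]
  refine ⟨e, Algebra.mem_top, ?_⟩
  change hDiff e = genEval _ - z.1
  rw [h, map_add, map_mul, genEval_genRename, genEval_genRename, genEval_X]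
  linear_combination hPoly_add_self (hDiff e)

/-- The presentation of the cohomology of the polynomial ring. -/
def presentationEquiv : (MvPolynomial Gen M2 ⧸ Ideal.span relations) ≃ₐ[M2] HCohomology :=
  AlgEquiv.ofBijective presentationHom ⟨presentationHom_injective, presentationHom_surjective⟩

theorem presentationEquiv_X (g : Gen) :
    presentationEquiv (Ideal.Quotient.mk _ (MvPolynomial.X g)) = genClass g := by
  change presentationHom (Ideal.Quotient.mk _ (MvPolynomial.X g)) = _
  rw [presentationHom_mk, genCohomology_apply, genClass]
  congr 2
  exact genEval_X g

/-! ### The degrees of the generators -/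

theorem HPolyHomogeneous.X (i : HIndex) : HPolyHomogeneous (hDegree i) (MvPolynomial.X i) := by
  intro e n h
  rw [MvPolynomial.coeff_X] at h
  split_ifs at h with he
  · subst he
    rw [coeff_one] at h
    have hn : n = 0 := by by_contra hn; exact h (if_neg hn)
    rw [hn, Finsupp.sum_single_index (h := fun i r => r • hDegree i) (zero_smul ℕ _), one_smul,
      zero_smul, add_zero]
  · exact absurd (coeff_zero n) h

theorem HPolyHomogeneous.mul {q q' : ℤ × ℤ × ℤ × ℤ} {p p' : HPoly} (h : HPolyHomogeneous q p)
    (h' : HPolyHomogeneous q' p') : HPolyHomogeneous (q + q') (p * p') := by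
  intro e n hn
  rw [MvPolynomial.coeff_mul, finsetSum_coeff] at hn
  obtain ⟨x, hx, hx'⟩ := Finset.exists_ne_zero_of_sum_ne_zero hn
  rw [coeff_mul] at hx'
  obtain ⟨y, hy, hy'⟩ := Finset.exists_ne_zero_of_sum_ne_zero hx'
  rw [Finset.HasAntidiagonal.mem_antidiagonal] at hx hy
  rw [← h x.1 y.1 (left_ne_zero_of_mul hy'), ← h' x.2 y.2 (right_ne_zero_of_mul hy'), ← hx, ← hy,
    Finsupp.sum_add_index' (h := fun i r => r • hDegree i) (fun _ => zero_smul ℕ _)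
      (fun _ _ _ => add_smul _ _ _), add_smul]
  abel

theorem HPolyHomogeneous.add {q : ℤ × ℤ × ℤ × ℤ} {p p' : HPoly} (h : HPolyHomogeneous q p)
    (h' : HPolyHomogeneous q p') : HPolyHomogeneous q (p + p') := by
  intro e n hn
  by_cases hp : (p.coeff e).coeff n = 0
  · refine h' e n fun hp' => hn ?_
    rw [MvPolynomial.coeff_add, coeff_add, hp, hp', add_zero]
  · exact h e n hp

theorem hPolyHomogeneous_genPoly (g : Gen) : HPolyHomogeneous (genDegree g) (genPoly g) := by
  have hX := HPolyHomogeneous.X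
  cases g with
  | h0 => exact hX .h10
  | h1 => exact hX .h11
  | h2 => exact hX .h12
  | b20 => rw [genPoly, pow_two]; exact (hX .h20).mul (hX .h20)
  | b21 => rw [genPoly, pow_two]; exact (hX .h21).mul (hX .h21)
  | b30 => rw [genPoly, pow_two]; exact (hX .h30).mul (hX .h30)
  | h01 => exact ((hX .h20).mul (hX .h21)).add ((hX .h11).mul (hX .h30))

end MotivicA2

end

open MotivicA2

theorem mainTheorem4 :
    ∃ (e : (MvPolynomial Gen M2 ⧸ Ideal.span relations) ≃ₐ[M2] ExtGrA2)
      (Ψ : HCohomology ≃ₐ[M2] ExtGrA2),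
      (∀ q x, HCohomologyHomogeneous q x ↔ ExtHomogeneous q (Ψ x)) ∧
      ∀ g : Gen,
        ExtHomogeneous (genDegree g) (e (Ideal.Quotient.mk _ (MvPolynomial.X g))) ∧
        e (Ideal.Quotient.mk _ (MvPolynomial.X g)) = Ψ (genClass g) := by
  refine ⟨presentationEquiv.trans extEquiv, extEquiv, extEquiv_homogeneous, fun g => ?_⟩
  have h : (presentationEquiv.trans extEquiv) (Ideal.Quotient.mk _ (MvPolynomial.X g)) =
      extEquiv (genClass g) := congrArg extEquiv (presentationEquiv_X g)
  rw [h]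
  exact ⟨(extEquiv_homogeneous _ _).1 ⟨_, hPolyHomogeneous_genPoly g, rfl⟩, rfl⟩
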